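/- Let $E$ be a separable (not necessarily complete) metric space and let $u$ be a càdlàg Markov process with values in $E$ (laws $\mathbb P_x$, $x\in E$) that admits an invariant (not necessarily reversible) probability measure $m$ with full support on $E$. Write $P_tf(x)=\mathbb E_x[f(u(t))]$ and $\mathcal R_\lambda f=\int_0^\infty e^{-\lambda t}P_tf\,dt$, $\lambda>0$, $f\in L^2(E,m)$. For every $N$ let $E_N\subset E$ and let $u_N$ be a (jointly measurable) Markov process on $E_N$ with an invariant probability measure $m_N$ with full support on $E_N$, and with resolvent $\mathcal R^N_\lambda$. Let $E^-$ be a Polish space in which $E$ is continuously embedded (that is, through a continuous injection), such that the paths of the $u_N$ are càdlàg in $E^-$. Let $\mathcal C$ be a set of bounded continuous functions $E\to\mathbb C$ and, for $\psi\in\mathcal C$, let $\Sigma^\psi$ and $\Sigma^\psi_N$ be finite complex measures on $E$ and on $E_N$. Assume: 1. (Characterization of the limit) For every $\lambda>0$ and every bounded Lipschitz $f:E\to\mathbb R$, $\mathcal R_\lambda f$ is ($m$-a.e. equal to) the unique bounded Lipschitz function $F:E\to\mathbb R$ such that $$-\int_E F\psi\,d\Sigma^\psi+\lambda\int_E F\psi\,dm=\int_E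 f\psi\,dm\qquad\text{for all }\psi\in\mathcal C .$$ 2. (State space) For every $N$ there is a map $\pi_N:E\to E_N$ with $d_E(x,\pi_N(x))=\inf_{y\in E_N}d_E(x,y)$ for all $x\in E$, and $m_N$ converges weakly to $m$ (as measures on $E$). 3. (Tightness) If each $u_N$ starts from $m_N$, then the sequence $(u_N)_N$ is tight in the Skorokhod space $\mathbb D([0,\infty),E^-)$ (with the $J_1$ topology). 4. (Equicontinuity) For every $\lambda>0$ there is a constant $C$ such that for all $N$ and all bounded Lipschitz $f:E_N\to\mathbb R$, $\mathcal R^N_\lambda f$ has an ($m_N$-a.e. equal) Lipschitz version with $[\mathcal R^N_\lambda f]_{\mathrm{Lip}(E_N)}\le C\,[f]_{\mathrm{Lip}(E_N)}$. 5. (Discrete characterization and convergence) For every $\psi\in\mathcal C$: for all $N$, all $\lambda>0$ and all $f\in L^2(E_N,m_N)$ such that $\mathcal R^N_\lambda f$ has a bounded continuous version $F$, $$-\int_{E_N} F\psi\,d\Sigma_N^\psi+\lambda\int_{E_N} F\psi\,dm_N=\int_{E_N} f\psi\,dm_N ,$$ and $\Sigma^\psi_N$ converges weakly to $\Sigma^\psi$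 as $N\to\infty$. Then, with $u_N$ started from $m_N$ for every $N$ and $u$ started from $m$, the sequence $(u_N)_N$ converges in law to $u$ in $\mathbb D([0,\infty),E^-)$. -/

import Mathlib

open MeasureTheory ProbabilityTheory Filter Topology Set
open scoped NNReal ENNReal BoundedContinuousFunction

/-! ### The Skorokhod space `D([0,∞), S)` -/

/-- A path `[0,∞) → S` is càdlàg: right-continuous with left limits. -/
def IsCadlag {S : Type*} [TopologicalSpace S] (x : ℝ≥0 → S) : Prop :=
  ∀ t, ContinuousWithinAt x (Ici t) t ∧ ∃ l, Tendsto x (𝓝[<] t) (𝓝 l)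

theorem IsCadlag.comp {S S' : Type*} [TopologicalSpace S] [TopologicalSpace S'] {x : ℝ≥0 → S}
    (hx : IsCadlag x) {g : S → S'} (hg : Continuous g) : IsCadlag (fun t => g (x t)) := by
  intro t
  obtain ⟨h1, l, h2⟩ := hx t
  exact ⟨hg.continuousAt.comp_continuousWithinAt h1, g l, (hg.tendsto l).comp h2⟩

/-- The set `D([0,∞), S)` of càdlàg paths. -/
def SkorokhodSpace (S : Type*) [TopologicalSpace S] : Type _ :=
  {x : ℝ≥0 → S // IsCadlag x}

namespace SkorokhodSpace

variable {S : Type*} [PseudoMetricSpace S]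

/-- Basic `J₁`-neighbourhoods of `x`: the paths that are `ε`-close to `x` on `[0, T]`, up to a
time change (an increasing bijection of `[0,∞)`) that moves the points of `[0, T]` by less
than `ε`. -/
def nbhd (x : SkorokhodSpace S) (T : ℝ≥0) (ε : ℝ) : Set (SkorokhodSpace S) :=
  {y | ∃ τ : ℝ≥0 ≃o ℝ≥0, ∀ t ≤ T, dist (τ t) t < ε ∧ dist (y.1 t) (x.1 (τ t)) < ε}

theorem nbhd_mono (x : SkorokhodSpace S) {T T' : ℝ≥0} {ε ε' : ℝ} (hT : T' ≤ T) (hε : ε ≤ ε') :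
    nbhd x T ε ⊆ nbhd x T' ε' := by
  rintro y ⟨τ, h⟩
  exact ⟨τ, fun t ht => ⟨(h t (ht.trans hT)).1.trans_le hε, (h t (ht.trans hT)).2.trans_le hε⟩⟩

/-- Skorokhod's `J₁` topology on `D([0,∞), S)`: `xₙ → x` iff for every `T` there are time changes
`τₙ` such that `τₙ t - t → 0` and `dist (xₙ t) (x (τₙ t)) → 0`, uniformly in `t ≤ T`. -/
instance : TopologicalSpace (SkorokhodSpace S) where
  IsOpen U := ∀ x ∈ U, ∃ (T : ℝ≥0) (ε : ℝ), 0 < ε ∧ nbhd x T ε ⊆ U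
  isOpen_univ := fun _ _ => ⟨0, 1, one_pos, subset_univ _⟩
  isOpen_inter := by
    rintro U V hU hV x ⟨hxU, hxV⟩
    obtain ⟨T, ε, hε, h⟩ := hU x hxU
    obtain ⟨T', ε', hε', h'⟩ := hV x hxV
    exact ⟨max T T', min ε ε', lt_min hε hε', subset_inter
      ((nbhd_mono x (le_max_left _ _) (min_le_left _ _)).trans h)
      ((nbhd_mono x (le_max_right _ _) (min_le_right _ _)).trans h')⟩
  isOpen_sUnion := by
    rintro 𝒰 h𝒰 x ⟨U, hU, hx⟩
    obtain ⟨T, ε, hε, h⟩ := h𝒰 U hU x hx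
    exact ⟨T, ε, hε, h.trans (subset_sUnion_of_mem hU)⟩

instance : MeasurableSpace (SkorokhodSpace S) := borel _

instance : BorelSpace (SkorokhodSpace S) := ⟨rfl⟩

end SkorokhodSpace

/-! ### Markov processes, their semigroup and their resolvent -/

/-- The process `X` on `Ω`, together with its laws `P x` started from the points `x` of the state
space `S`, is a (time-homogeneous, measurable) Markov process. The Markov property is the one with
respect to the natural filtration `σ(X r, r ≤ s)`. -/
structure IsMarkovProcess {S Ω : Type*} [MeasurableSpace S] [MeasurableSpace Ω]
    (P : Kernel S Ω) (X : ℝ≥0 → Ω → S) : Prop where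
  measurable : Measurable (fun p : ℝ≥0 × Ω => X p.1 p.2)
  start : ∀ x, ∀ᵐ ω ∂(P x), X 0 ω = x
  markov : ∀ (x : S) (s t : ℝ≥0) (A : Set Ω) (B : Set S),
    MeasurableSet[⨆ r : Iic s, MeasurableSpace.comap (X r) inferInstance] A → MeasurableSet B →
      P x (A ∩ X (s + t) ⁻¹' B) = ∫⁻ ω in A, P (X s ω) (X t ⁻¹' B) ∂(P x)

/-- `m` is invariant: the process started from `m` has law `m` at all times. -/
def IsInvariantFor {S Ω : Type*} [MeasurableSpace S] [MeasurableSpace Ω]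
    (P : Kernel S Ω) (X : ℝ≥0 → Ω → S) (m : Measure S) : Prop :=
  ∀ t, (m.bind P).map (X t) = m

/-- The semigroup `P_t f (x) = 𝔼_x[f(X_t)]`. -/
noncomputable def semigroup {S Ω : Type*} [MeasurableSpace S] [MeasurableSpace Ω]
    (P : Kernel S Ω) (X : ℝ≥0 → Ω → S) (t : ℝ≥0) (f : S → ℝ) (x : S) : ℝ :=
  ∫ ω, f (X t ω) ∂(P x)

/-- The resolvent `R_l f (x) = ∫_0^∞ e^{-l t} P_t f (x) dt`. For bounded measurable `f` this is
meaningful at every `x`; for `f ∈ L²(m)`, `m` an invariant probability measure, at `m`-almost every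
`x`, and it is then a version of the `L²(m)`-valued integral `∫_0^∞ e^{-l t} P_t f dt`. -/
noncomputable def markovResolvent {S Ω : Type*} [MeasurableSpace S] [MeasurableSpace Ω]
    (P : Kernel S Ω) (X : ℝ≥0 → Ω → S) (l : ℝ) (f : S → ℝ) (x : S) : ℝ :=
  ∫ t in Ioi (0 : ℝ), Real.exp (-l * t) * semigroup P X t.toNNReal f x

/-! ### Function classes and the integral identity -/

/-- Bounded Lipschitz functions. -/
def BddLipschitz {S : Type*} [PseudoMetricSpace S] (f : S → ℝ) : Prop :=
  (∃ K, LipschitzWith K f) ∧ ∃ M, ∀ x, |f x| ≤ M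

/-- The integral of a complex function against a complex measure. -/
noncomputable def complexIntegral {S : Type*} [MeasurableSpace S] (σ : ComplexMeasure S)
    (g : S → ℂ) : ℂ :=
  VectorMeasure.integral σ g (ContinuousLinearMap.mul ℝ ℂ)

/-- `-∫ F ψ dσ + l ∫ F ψ dm = ∫ f ψ dm`. -/
def ResolventIdentity {S : Type*} [MeasurableSpace S] (m : Measure S) (σ : ComplexMeasure S)
    (ψ : S → ℂ) (l : ℝ) (f F : S → ℝ) : Prop :=
  -complexIntegral σ (fun u => (F u : ℂ) * ψ u) + (l : ℂ) * ∫ u, (F u : ℂ) * ψ u ∂m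
    = ∫ u, (f u : ℂ) * ψ u ∂m

/-! ### The five assumptions -/

/-- Characterization of the limit: for every `l > 0` and every bounded Lipschitz `f`, the class
`R_l f ∈ L²(m)` contains a bounded Lipschitz function, and this is the unique bounded Lipschitz
function that satisfies the integral identity for all `ψ ∈ 𝒞`. -/
def CharacterizesLimit {E Ω : Type*} [MetricSpace E] [MeasurableSpace E] [MeasurableSpace Ω]
    (P : Kernel E Ω) (X : ℝ≥0 → Ω → E) (m : Measure E) (𝒞 : Set (E →ᵇ ℂ))
    (Sig : (E →ᵇ ℂ) → ComplexMeasure E) : Prop :=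
  ∀ l : ℝ, 0 < l → ∀ f : E → ℝ, BddLipschitz f →
    ∃ F : E → ℝ, F =ᵐ[m] markovResolvent P X l f ∧ BddLipschitz F ∧
      (∀ ψ ∈ 𝒞, ResolventIdentity m (Sig ψ) ψ l f F) ∧
      ∀ G : E → ℝ, BddLipschitz G → (∀ ψ ∈ 𝒞, ResolventIdentity m (Sig ψ) ψ l f G) → G = F

/-- State spaces: the distance to each `E_N` is achieved, and `m_N` converges weakly to `m`. -/
def StateSpaceConvergence {E : Type*} [MetricSpace E] [MeasurableSpace E]
    (EN : ℕ → Set E) (mN : ∀ N, Measure (EN N)) (m : Measure E) : Prop :=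
  (∀ N, ∃ π : E → EN N, ∀ x, dist x (π x : E) = ⨅ y : EN N, dist x (y : E)) ∧
    ∀ φ : E →ᵇ ℝ, Tendsto (fun N => ∫ u : EN N, φ (u : E) ∂(mN N)) atTop (𝓝 (∫ u, φ u ∂m))

/-- Tightness of a sequence of random elements `Y N` of a topological space, under the
laws `μ N`. -/
def IsTightSequence {D : Type*} [TopologicalSpace D] {Ω : ℕ → Type*}
    [∀ N, MeasurableSpace (Ω N)] (μ : ∀ N, Measure (Ω N)) (Y : ∀ N, Ω N → D) : Prop :=
  ∀ ε : ℝ≥0∞, 0 < ε → ∃ K : Set D, IsCompact K ∧ ∀ N, μ N {ω | Y N ω ∉ K} ≤ ε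

/-- Equicontinuity: `[R^N_l f]_Lip ≤ C [f]_Lip` with `C` depending on `l` only. It is asked for
bounded Lipschitz `f` only, and for a version of the class `R^N_l f ∈ L²(m_N)`. -/
def ResolventEquicontinuity {E : Type*} [MetricSpace E] [MeasurableSpace E] {EN : ℕ → Set E}
    {Ω : ℕ → Type*} [∀ N, MeasurableSpace (Ω N)] (PN : ∀ N, Kernel (EN N) (Ω N))
    (XN : ∀ N, ℝ≥0 → Ω N → EN N) (mN : ∀ N, Measure (EN N)) : Prop :=
  ∀ l : ℝ, 0 < l → ∃ C : ℝ≥0, ∀ (N : ℕ) (f : EN N → ℝ) (K : ℝ≥0),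
    LipschitzWith K f → (∃ M, ∀ x, |f x| ≤ M) →
      ∃ F : EN N → ℝ, F =ᵐ[mN N] markovResolvent (PN N) (XN N) l f ∧ LipschitzWith (C * K) F

/-- Discrete characterization and convergence: for all `ψ ∈ 𝒞`, `l > 0` and `f ∈ L²(m_N)`, the
resolvent `R^N_l f` satisfies the integral identity with the complex measure `Σ_N^ψ`, and `Σ_N^ψ`
converges weakly to `Σ^ψ`. As `Σ_N^ψ` may charge `m_N`-null sets, the identity is asked for a
bounded continuous version `F` of the class `R^N_l f ∈ L²(m_N)` only; there is at most one, if `m_N`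
has full support. -/
def DiscreteCharacterization {E : Type*} [MetricSpace E] [MeasurableSpace E] {EN : ℕ → Set E}
    {Ω : ℕ → Type*} [∀ N, MeasurableSpace (Ω N)] (PN : ∀ N, Kernel (EN N) (Ω N))
    (XN : ∀ N, ℝ≥0 → Ω N → EN N) (mN : ∀ N, Measure (EN N)) (𝒞 : Set (E →ᵇ ℂ))
    (SigN : ∀ N, (E →ᵇ ℂ) → ComplexMeasure (EN N)) (Sig : (E →ᵇ ℂ) → ComplexMeasure E) : Prop :=
  ∀ ψ ∈ 𝒞,
    (∀ (N : ℕ) (l : ℝ), 0 < l → ∀ f : EN N → ℝ, MemLp f 2 (mN N) →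
      ∀ F : EN N →ᵇ ℝ, (F : EN N → ℝ) =ᵐ[mN N] markovResolvent (PN N) (XN N) l f →
        ResolventIdentity (mN N) (SigN N ψ) (fun u => ψ (u : E)) l f F) ∧
    ∀ φ : E →ᵇ ℂ, Tendsto (fun N => complexIntegral (SigN N ψ) (fun u => φ (u : E))) atTop
      (𝓝 (complexIntegral (Sig ψ) φ))

/-! Tightness reduces the theorem to identifying limits, and laws on the Skorokhod space are
identified by the joint moments of countably many continuous functionals that separate paths. The
functionals used are the Laplace transforms `x ↦ ∫ e^{-λt} g(x(t)) dt`, with `λ` a positive integer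
and `g` a truncated distance to a point of a dense sequence in `Em`. They are continuous for `J₁`,
unlike evaluations at fixed times, and their moments involve the process through its resolvents
only.

Indeed, a product of such integrals splits according to which time is the smallest, and the Markov
property at that time yields the recursion `M_I = R_Λ (∑_{i ∈ I} h_i M_{I \ {i}})` with `Λ = ∑_{i ∈
I} λ_i` and `M_∅ = 1` (`integral_mul_occupationProd`). It thus suffices that resolvents preserve a
mode of convergence that is stable under sums and products: uniformly bounded, equi-Lipschitz,
pointwise, up to null sets (`ConvergesEquiLipschitz.markovResolvent`).

This preservation is a compactness argument. By equicontinuity the discrete resolvents, extended to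
`E`, have pointwise convergent subsequences with Lipschitz limits; such a limit inherits the
integral identity, whose uniqueness part identifies it. The delicate point is that measures and
integrands vary together, while the complex measures are assumed neither tight nor bounded in
variation. A sliding hump argument (`tendsto_zero_of_equiLipschitz`) shows that weak convergence
alone is enough: a failure along an equi-Lipschitz sequence could be assembled into one bounded
continuous function on which weak convergence fails.

Since `g ∘ ι` is only continuous on `E`, it is approximated by Lipschitz minorants; by invariance,
the stationary moments change by at most the `L¹` distance of the functions. Finally
`tendsto_of_tight_of_moments` embeds the paths into a cube, where moments determine weak
convergence, and tightness brings the convergence back. -/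

/-! ### Weak convergence of complex measures is uniform on equi-Lipschitz sets -/

section UniformWeakConvergence

/-- Soft thresholding at level `δ`. -/
def softThreshold (δ y : ℝ) : ℝ := y - max (-δ) (min δ y)

theorem continuous_softThreshold (δ : ℝ) : Continuous (softThreshold δ) := by
  unfold softThreshold; fun_prop

theorem softThreshold_eq_zero {δ y : ℝ} (h : |y| ≤ δ) : softThreshold δ y = 0 := by
  obtain ⟨h1, h2⟩ := abs_le.1 h
  rw [softThreshold, min_eq_right h2, max_eq_right h1, sub_self]

theorem abs_softThreshold_le {δ : ℝ} (hδ : 0 ≤ δ) (y : ℝ) : |softThreshold δ y| ≤ |y| := by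
  unfold softThreshold
  rcases max_cases (-δ) (min δ y) with h | h <;> rcases min_cases δ y with h' | h' <;>
    rw [abs_le] <;> constructor <;> rcases abs_cases y with h'' | h'' <;> linarith

theorem abs_sub_softThreshold_le {δ : ℝ} (hδ : 0 ≤ δ) (y : ℝ) : |y - softThreshold δ y| ≤ δ := by
  unfold softThreshold
  rw [sub_sub_cancel, abs_le]
  exact ⟨le_max_left _ _, max_le (by linarith) (min_le_left _ _)⟩

variable {E : Type*} [PseudoMetricSpace E]

/-- A continuous cutoff function: `1` at distance less than `r` from `A`, and `0` at distance at
least `2 r`. -/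
noncomputable def distCutoff (r : ℝ) (A : Set E) (x : E) : ℝ :=
  max 0 (min 1 (2 - Metric.infDist x A / r))

theorem continuous_distCutoff (r : ℝ) (A : Set E) : Continuous (distCutoff r A) := by
  unfold distCutoff
  have := Metric.continuous_infDist_pt A
  fun_prop

theorem distCutoff_nonneg (r : ℝ) (A : Set E) (x : E) : 0 ≤ distCutoff r A x := le_max_left _ _

theorem distCutoff_le_one (r : ℝ) (A : Set E) (x : E) : distCutoff r A x ≤ 1 :=
  max_le zero_le_one (min_le_left _ _)

theorem distCutoff_eq_one {r : ℝ} (hr : 0 < r) {A : Set E} {x : E} (h : Metric.infDist x A < r) :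
    distCutoff r A x = 1 := by
  have : Metric.infDist x A / r ≤ 1 := (div_le_one hr).2 h.le
  rw [distCutoff, min_eq_left (by linarith), max_eq_right zero_le_one]

theorem distCutoff_eq_zero {r : ℝ} (hr : 0 < r) {A : Set E} {x : E}
    (h : 2 * r ≤ Metric.infDist x A) : distCutoff r A x = 0 := by
  have : 2 ≤ Metric.infDist x A / r := (le_div_iff₀ hr).2 h
  rw [distCutoff, max_eq_left]
  exact (min_le_right _ _).trans (by linarith)

/-- A bounded real function on a finite measure space that vanishes outside of `s` has a small
integral if `s` is small. -/
theorem integral_abs_le_of_eq_zero {E : Type*} [MeasurableSpace E] (κ : Measure E)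
    [IsFiniteMeasure κ] {f : E → ℝ} {M : ℝ} {V : Set E} (hV : MeasurableSet V)
    (hM : ∀ x, |f x| ≤ M) (h0 : ∀ x ∈ V, f x = 0) :
    ∫ x, |f x| ∂κ ≤ M * κ.real Vᶜ := by
  calc ∫ x, |f x| ∂κ ≤ ∫ x, Vᶜ.indicator (fun _ => M) x ∂κ := by
        refine integral_mono_of_nonneg (Eventually.of_forall fun x => abs_nonneg _) ?_ ?_
        · exact (integrable_const M).indicator hV.compl
        · refine Eventually.of_forall fun x => ?_
          by_cases hx : x ∈ V
          · simp [h0 x hx, hx]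
          · simpa [hx] using hM x
    _ = M * κ.real Vᶜ := by
        rw [integral_indicator_const _ hV.compl, smul_eq_mul, mul_comm]

variable [TopologicalSpace.SeparableSpace E] [MeasurableSpace E] [OpensMeasurableSpace E]

/-- A sequence of linear functionals on `C_b(E)`, given by (complex) measures, which tends to zero
weakly, tends to zero uniformly on equi-Lipschitz, bounded sequences that tend to zero pointwise. -/
theorem tendsto_zero_of_equiLipschitz
    (T : ℕ → (E →ᵇ ℝ) →ₗ[ℝ] ℂ) (κ : ℕ → Measure E) [∀ n, IsFiniteMeasure (κ n)]
    (hT : ∀ n φ, ‖T n φ‖ ≤ ∫ x, |φ x| ∂κ n) (h0 : ∀ φ, Tendsto (fun n => T n φ) atTop (𝓝 0))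
    (g : ℕ → E →ᵇ ℝ) {K : ℝ≥0} {M : ℝ} (hK : ∀ n, LipschitzWith K (g n))
    (hM : ∀ n x, |g n x| ≤ M) (hg : ∀ x, Tendsto (fun n => g n x) atTop (𝓝 0)) :
    Tendsto (fun n => T n (g n)) atTop (𝓝 0) := by
  rcases isEmpty_or_nonempty E with hE | ⟨⟨e0⟩⟩
  · have : ∀ n, g n = 0 := fun n => by ext x; exact hE.elim x
    simp [this]
  have : Nonempty E := ⟨e0⟩
  have hM0 : 0 ≤ M := (abs_nonneg _).trans (hM 0 e0)
  -- uniform boundedness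
  obtain ⟨C, hC0, hC⟩ : ∃ C, 0 ≤ C ∧ ∀ n φ, ‖T n φ‖ ≤ C * ‖φ‖ := by
    have hbd : ∀ n φ, ‖T n φ‖ ≤ (κ n).real univ * ‖φ‖ := fun n φ => by
      refine (hT n φ).trans ?_
      calc ∫ x, |φ x| ∂κ n ≤ ∫ _, ‖φ‖ ∂κ n :=
            integral_mono_of_nonneg (Eventually.of_forall fun x => abs_nonneg _)
              (integrable_const _) (Eventually.of_forall fun x => φ.norm_coe_le_norm x)
        _ = _ := by simp
    -- The masses of the `κ n` need not be bounded; the uniform bound comes from convergence on each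
    -- fixed function.
    obtain ⟨C, hC⟩ := banach_steinhaus (g := fun n => (T n).mkContinuous _ (hbd n)) (fun φ => by
      obtain ⟨B, hB⟩ := ((h0 φ).norm.isBoundedUnder_le).bddAbove_range
      exact ⟨B, fun n => hB ⟨n, rfl⟩⟩)
    refine ⟨C, (norm_nonneg _).trans (hC 0), fun n φ => ?_⟩
    exact (((T n).mkContinuous _ (hbd n)).le_opNorm φ).trans
      (mul_le_mul_of_nonneg_right (hC n) (norm_nonneg _))
  by_contra hcon
  obtain ⟨ε, hε, hfreq⟩ : ∃ ε > 0, ∃ᶠ n in atTop, ε ≤ ‖T n (g n)‖ := by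
    rw [Metric.tendsto_nhds] at hcon
    push Not at hcon
    obtain ⟨ε, hε, h⟩ := hcon
    refine ⟨ε, hε, h.mono fun n hn => ?_⟩
    simpa using hn
  -- Thresholding at level `δ` costs at most `C δ ≤ ε / 8`, and `r` is so small that a `K`-Lipschitz
  -- function deviates by at most `δ / 2` from its value at the centre of a ball of radius `2 r`.
  set δ : ℝ := ε / (8 * (C + 1)) with hδdef
  have hδ : 0 < δ := by positivity
  have hCδ : C * δ ≤ ε / 8 := by
    rw [hδdef, mul_div_assoc', div_le_div_iff₀ (by positivity) (by positivity)]
    nlinarith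
  set r : ℝ := δ / (4 * (K + 1)) with hrdef
  have hr : 0 < r := by positivity
  have hKr : K * (2 * r) ≤ δ / 2 := by
    have hK0 : (0 : ℝ) ≤ K := K.2
    rw [hrdef, mul_div_assoc', mul_div_assoc', div_le_div_iff₀ (by positivity) (by positivity)]
    nlinarith
  -- finite sets that fill the space
  let A : ℕ → Set E := fun p => TopologicalSpace.denseSeq E '' Iic p
  have hA_ne : ∀ p, (A p).Nonempty := fun p => ⟨_, 0, by simp, rfl⟩
  let W : ℕ → Set E := fun p => {x | Metric.infDist x (A p) < 2 * r}
  let V : ℕ → Set E := fun p => {x | Metric.infDist x (A p) < r}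
  have hWmono : Monotone W := fun p q hpq x hx =>
    (Metric.infDist_le_infDist_of_subset (image_mono (Iic_subset_Iic.2 hpq)) (hA_ne p)).trans_lt hx
  have hVmono : Monotone V := fun p q hpq x hx =>
    (Metric.infDist_le_infDist_of_subset (image_mono (Iic_subset_Iic.2 hpq)) (hA_ne p)).trans_lt hx
  have hVW : ∀ p, V p ⊆ W p := fun p x hx => lt_trans (mem_ofPred.1 hx) (by linarith)
  have hVopen : ∀ p, IsOpen (V p) := fun p =>
    isOpen_lt (Metric.continuous_infDist_pt _) continuous_const
  have hVmeas : ∀ p, MeasurableSet (V p) := fun p => (hVopen p).measurableSet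
  have hVcover : ∀ x, ∃ p, x ∈ V p := fun x => by
    obtain ⟨i, hi⟩ := (TopologicalSpace.denseRange_denseSeq E).exists_dist_lt x hr
    have hmem : TopologicalSpace.denseSeq E i ∈ A i := ⟨i, self_mem_Iic, rfl⟩
    exact ⟨i, (Metric.infDist_le_dist_of_mem hmem).trans_lt hi⟩
  have hVsmall : ∀ n, Tendsto (fun p => (κ n).real (V p)ᶜ) atTop (𝓝 0) := fun n => by
    have h1 := tendsto_measure_iInter_atTop (μ := κ n) (s := fun p => (V p)ᶜ)
      (fun p => (hVmeas p).compl.nullMeasurableSet)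
      (fun p q hpq => compl_subset_compl.2 (hVmono hpq)) ⟨0, measure_ne_top _ _⟩
    have h2 : ⋂ p, (V p)ᶜ = ∅ := by
      rw [← compl_iUnion, compl_empty_iff, eq_univ_iff_forall]
      exact fun x => mem_iUnion.2 (hVcover x)
    rw [h2, measure_empty] at h1
    exact (ENNReal.tendsto_toReal ENNReal.zero_ne_top).comp h1
  -- smallness of `g n` near a point and on `W p`
  have hgball : ∀ x, ∀ᶠ n in atTop, ∀ y, dist y x < 2 * r → |g n y| ≤ δ := fun x => by
    have h1 : ∀ᶠ n in atTop, |g n x| < δ / 2 := by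
      have := (hg x).abs
      rw [abs_zero] at this
      exact this.eventually_lt_const (by linarith)
    filter_upwards [h1] with n hn y hy
    have h2 := (hK n).dist_le_mul y x
    rw [Real.dist_eq] at h2
    have h3 : |g n y| ≤ |g n y - g n x| + |g n x| := by
      simpa using abs_add_le (g n y - g n x) (g n x)
    have h4 : (K : ℝ) * dist y x ≤ K * (2 * r) := mul_le_mul_of_nonneg_left hy.le K.2
    linarith
  have hgW : ∀ p, ∀ᶠ n in atTop, ∀ y ∈ W p, |g n y| ≤ δ := fun p => by
    have : ∀ᶠ n in atTop, ∀ i ∈ Iic p, ∀ y, dist y (TopologicalSpace.denseSeq E i) < 2 * r →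
        |g n y| ≤ δ := (eventually_all_finite (finite_Iic p)).2 fun i _ => hgball _
    filter_upwards [this] with n hn y hy
    obtain ⟨_, ⟨i, hi, rfl⟩, hd⟩ := (Metric.infDist_lt_iff (hA_ne p)).1 hy
    exact hn i hi y hd
  -- the humps
  let sg : ℕ → E →ᵇ ℝ := fun n => BoundedContinuousFunction.ofNormedAddCommGroup
    (fun x => softThreshold δ (g n x)) ((continuous_softThreshold δ).comp (g n).continuous) M
    (fun x => (abs_softThreshold_le hδ.le _).trans (hM n x))
  let hump : ℕ → ℕ → E →ᵇ ℝ := fun n p => BoundedContinuousFunction.ofNormedAddCommGroup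
    (fun x => distCutoff r (A p) x * softThreshold δ (g n x))
    ((continuous_distCutoff r (A p)).mul ((continuous_softThreshold δ).comp (g n).continuous)) M
    (fun x => by
      rw [norm_mul, Real.norm_of_nonneg (distCutoff_nonneg _ _ _)]
      exact (mul_le_of_le_one_left (norm_nonneg _) (distCutoff_le_one _ _ _)).trans
        ((abs_softThreshold_le hδ.le _).trans (hM n x)))
  have hump_apply : ∀ n p x, hump n p x = distCutoff r (A p) x * softThreshold δ (g n x) :=
    fun _ _ _ => rfl
  have hump_le : ∀ n p x, |hump n p x| ≤ M := fun n p x => by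
    rw [hump_apply, abs_mul, abs_of_nonneg (distCutoff_nonneg _ _ _)]
    exact (mul_le_of_le_one_left (abs_nonneg _) (distCutoff_le_one _ _ _)).trans
      ((abs_softThreshold_le hδ.le _).trans (hM n x))
  have hump_zero : ∀ n p x, |g n x| ≤ δ → hump n p x = 0 := fun n p x hx => by
    rw [hump_apply, softThreshold_eq_zero hx, mul_zero]
  have hump_off : ∀ n p x, x ∉ W p → hump n p x = 0 := fun n p x hx => by
    rw [hump_apply, distCutoff_eq_zero hr (not_lt.1 hx), zero_mul]
  -- Thresholding is paid for by the uniform bound `C`; the spatial cutoff only affects points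
  -- outside `V p`.
  have hump_close : ∀ n p, ‖T n (g n) - T n (hump n p)‖ ≤ ε / 8 + M * (κ n).real (V p)ᶜ := by
    intro n p
    have h1 : ‖T n (g n - sg n)‖ ≤ ε / 8 := by
      refine ((hC n _).trans (mul_le_mul_of_nonneg_left ?_ hC0)).trans hCδ
      exact (BoundedContinuousFunction.norm_le hδ.le).2 fun x => abs_sub_softThreshold_le hδ.le _
    have h2 : ‖T n (sg n - hump n p)‖ ≤ M * (κ n).real (V p)ᶜ := by
      refine (hT n _).trans (integral_abs_le_of_eq_zero (κ n) (hVmeas p) (fun x => ?_)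
        fun x hx => ?_)
      · change |softThreshold δ (g n x) - distCutoff r (A p) x * softThreshold δ (g n x)| ≤ M
        rw [← one_sub_mul, abs_mul, abs_of_nonneg (by linarith [distCutoff_le_one r (A p) x])]
        exact (mul_le_of_le_one_left (abs_nonneg _) (by linarith [distCutoff_nonneg r (A p) x])).trans
          ((abs_softThreshold_le hδ.le _).trans (hM n x))
      · change softThreshold δ (g n x) - distCutoff r (A p) x * softThreshold δ (g n x) = 0
        rw [distCutoff_eq_one hr hx, one_mul, sub_self]
    calc ‖T n (g n) - T n (hump n p)‖ = ‖T n (g n - sg n) + T n (sg n - hump n p)‖ := by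
          rw [← map_sub, ← map_add, sub_add_sub_cancel]
      _ ≤ _ := (norm_add_le _ _).trans (add_le_add h1 h2)
  -- the recursive choice
  have hstep : ∀ s : ℕ × ℕ × (E →ᵇ ℝ), ∃ q : ℕ × ℕ, s.1 < q.1 ∧ s.2.1 ≤ q.2 ∧
      ε ≤ ‖T q.1 (g q.1)‖ ∧ ‖T q.1 s.2.2‖ ≤ ε / 8 ∧ (∀ x ∈ W s.2.1, |g q.1 x| ≤ δ) ∧
      M * (κ q.1).real (V q.2)ᶜ ≤ ε / 8 := by
    rintro ⟨n0, p0, S⟩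
    have h1 : ∀ᶠ n in atTop, ‖T n S‖ ≤ ε / 8 := by
      have := (h0 S).norm
      rw [norm_zero] at this
      exact (this.eventually_lt_const (by linarith)).mono fun n hn => le_of_lt hn
    -- First `n`, so large that `T n` nearly kills the old humps and `g n` is below the threshold on
    -- `W p0`, where they live; then `p`, so that `κ n` hardly charges the complement of `V p`.
    obtain ⟨n, hn, h1n, h2n, h3n⟩ :=
      (hfreq.and_eventually (h1.and ((hgW p0).and (eventually_gt_atTop n0)))).exists
    have h2 : ∀ᶠ p in atTop, M * (κ n).real (V p)ᶜ < ε / 8 := by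
      have := (hVsmall n).const_mul M
      rw [mul_zero] at this
      exact this.eventually_lt_const (by linarith)
    obtain ⟨p, hp, hpp⟩ := (h2.and (eventually_ge_atTop p0)).exists
    exact ⟨(n, p), h3n, hpp, hn, h1n, h2n, hp.le⟩
  choose nxt hn1 hn2 hn3 hn4 hn5 hn6 using hstep
  -- The state consists of the last index `n`, the last index `p` and the sum of the humps chosen so
  -- far.
  let σ : ℕ → ℕ × ℕ × (E →ᵇ ℝ) := fun k => Nat.rec (0, 0, 0)
    (fun _ s => ((nxt s).1, (nxt s).2, s.2.2 + hump (nxt s).1 (nxt s).2)) k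
  have hσ : ∀ k, σ (k + 1) = ((nxt (σ k)).1, (nxt (σ k)).2,
      (σ k).2.2 + hump (nxt (σ k)).1 (nxt (σ k)).2) := fun _ => rfl
  let n : ℕ → ℕ := fun k => (nxt (σ k)).1
  let p : ℕ → ℕ := fun k => (σ k).2.1
  let S : ℕ → E →ᵇ ℝ := fun k => (σ k).2.2
  have hp_succ : ∀ k, p (k + 1) = (nxt (σ k)).2 := fun _ => rfl
  have hS_succ : ∀ k x, S (k + 1) x = S k x + hump (n k) (p (k + 1)) x := fun _ _ => rfl
  have hpmono : Monotone p := monotone_nat_of_le_succ fun k => hn2 (σ k)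
  have hnmono : StrictMono n := strictMono_nat_of_lt_succ fun k => hn1 (σ (k + 1))
  have hS_off : ∀ k x, x ∉ W (p k) → S k x = 0 := by
    intro k
    induction k with
    | zero => exact fun x _ => rfl
    | succ k ih =>
      intro x hx
      rw [hS_succ, hump_off _ _ _ hx, ih x fun h => hx (hWmono (hpmono k.le_succ) h), add_zero]
  -- At each point at most one hump is nonzero, as a new one vanishes on `W (p k)`, outside of which
  -- the earlier ones vanish. Hence the bound `M` does not accumulate.
  have hS_le : ∀ k x, |S k x| ≤ M := by
    intro k
    induction k with
    | zero =>
      intro x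
      change |(0 : ℝ)| ≤ M
      simpa using hM0
    | succ k ih =>
      intro x
      rw [hS_succ]
      by_cases hx : x ∈ W (p k)
      · rw [hump_zero _ _ _ (hn5 (σ k) x hx), add_zero]
        exact ih x
      · rw [hS_off k x hx, zero_add]
        exact hump_le _ _ _
  have hS_stab : ∀ k x, x ∈ W (p k) → ∀ l ≥ k, S l x = S k x := by
    intro k x hx l hl
    induction l, hl using Nat.le_induction with
    | base => rfl
    | succ l hl ih =>
      rw [hS_succ, hump_zero _ _ _ (hn5 (σ l) x (hWmono (hpmono hl) hx)), add_zero, ih]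
  -- The infinite sum of the humps is locally finite: on the ball of radius `2 r` around `x` all `g
  -- n` with large `n` are below the threshold. This makes `H` well defined and continuous.
  have hS_loc : ∀ x, ∃ k, ∀ l ≥ k, ∀ y, dist y x < 2 * r → S l y = S k y := by
    intro x
    obtain ⟨k, hk⟩ := eventually_atTop.1 (hnmono.tendsto_atTop.eventually (hgball x))
    refine ⟨k, fun l hl y hy => ?_⟩
    induction l, hl using Nat.le_induction with
    | base => rfl
    | succ l hl ih => rw [hS_succ, hump_zero _ _ _ (hk l hl y hy), add_zero, ih]
  choose k0 hk0 using hS_loc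
  have hH : ∀ x y, dist y x < 2 * r → S (k0 y) y = S (k0 x) y := fun x y hy => by
    rw [← hk0 x _ (le_max_left (k0 x) (k0 y)) y hy,
      hk0 y _ (le_max_right (k0 x) (k0 y)) y (by rw [dist_self]; positivity)]
  let H : E →ᵇ ℝ := BoundedContinuousFunction.ofNormedAddCommGroup (fun x => S (k0 x) x)
    (continuous_iff_continuousAt.2 fun x => by
      refine (S (k0 x)).continuous.continuousAt.congr ?_
      filter_upwards [Metric.ball_mem_nhds x (by positivity : 0 < 2 * r)] with y hy
      exact (hH x y hy).symm) M (fun x => hS_le _ x)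
  have hHS : ∀ k x, x ∈ W (p k) → (H - S k) x = 0 := fun k x hx => by
    change S (k0 x) x - S k x = 0
    rw [sub_eq_zero, ← hS_stab k x hx _ (le_max_left k (k0 x)),
      hk0 x _ (le_max_right k (k0 x)) x (by rw [dist_self]; positivity)]
  -- In `T (n k) H`, the earlier humps contribute at most `ε / 8`, the later ones at most `2 ε / 8`,
  -- and the current one at least `ε - 2 ε / 8`.
  have hlow : ∀ k, ε / 8 ≤ ‖T (n k) H‖ := by
    intro k
    have e1 : ‖T (n k) (S k)‖ ≤ ε / 8 := hn4 (σ k)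
    have e2 : ε ≤ ‖T (n k) (g (n k))‖ := hn3 (σ k)
    have e3 := hump_close (n k) (p (k + 1))
    have e4 : M * (κ (n k)).real (V (p (k + 1)))ᶜ ≤ ε / 8 := hn6 (σ k)
    have e5 : ‖T (n k) (H - S (k + 1))‖ ≤ 2 * M * (κ (n k)).real (V (p (k + 1)))ᶜ := by
      refine (hT _ _).trans (integral_abs_le_of_eq_zero _ (hVmeas _) (fun x => ?_)
        fun x hx => hHS (k + 1) x (hVW _ hx))
      change |S (k0 x) x - S (k + 1) x| ≤ 2 * M
      calc _ ≤ |S (k0 x) x| + |S (k + 1) x| := abs_sub _ _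
        _ ≤ 2 * M := by linarith [hS_le (k0 x) x, hS_le (k + 1) x]
    have e6 : T (n k) (g (n k)) = T (n k) H - T (n k) (H - S (k + 1)) - T (n k) (S k)
        + (T (n k) (g (n k)) - T (n k) (hump (n k) (p (k + 1)))) := by
      have : S (k + 1) = S k + hump (n k) (p (k + 1)) := rfl
      rw [map_sub, this, map_add]
      ring
    have e7 : ‖T (n k) (g (n k))‖ ≤ ‖T (n k) H‖ + ‖T (n k) (H - S (k + 1))‖ + ‖T (n k) (S k)‖
        + ‖T (n k) (g (n k)) - T (n k) (hump (n k) (p (k + 1)))‖ := by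
      conv_lhs => rw [e6]
      exact (norm_add_le _ _).trans (add_le_add_left ((norm_sub_le _ _).trans
        (add_le_add_left (norm_sub_le _ _) _)) _)
    linarith
  have hlim := ((h0 H).comp hnmono.tendsto_atTop).norm
  rw [norm_zero] at hlim
  have := ge_of_tendsto' hlim hlow
  linarith

/-- If linear functionals on `C_b(E)` that are given by (complex) measures converge weakly, then
they converge along every bounded equi-Lipschitz sequence that converges pointwise. -/
theorem tendsto_of_equiLipschitz
    (T : ℕ → (E →ᵇ ℝ) →ₗ[ℝ] ℂ) (κ : ℕ → Measure E) [∀ n, IsFiniteMeasure (κ n)]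
    (hT : ∀ n φ, ‖T n φ‖ ≤ ∫ x, |φ x| ∂κ n)
    (T' : (E →ᵇ ℝ) →ₗ[ℝ] ℂ) (κ' : Measure E) [IsFiniteMeasure κ']
    (hT' : ∀ φ, ‖T' φ‖ ≤ ∫ x, |φ x| ∂κ')
    (h0 : ∀ φ, Tendsto (fun n => T n φ) atTop (𝓝 (T' φ)))
    (g : ℕ → E →ᵇ ℝ) (g' : E →ᵇ ℝ) {K : ℝ≥0} {M : ℝ} (hK : ∀ n, LipschitzWith K (g n))
    (hK' : LipschitzWith K g')
    (hM : ∀ n x, |g n x| ≤ M) (hg : ∀ x, Tendsto (fun n => g n x) atTop (𝓝 (g' x))) :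
    Tendsto (fun n => T n (g n)) atTop (𝓝 (T' g')) := by
  have hM' : ∀ x, |g' x| ≤ M := fun x => le_of_tendsto (hg x).abs (Eventually.of_forall (hM · x))
  have hbd : ∀ n x, |(g n - g') x| ≤ 2 * M := fun n x =>
    (abs_sub (g n x) (g' x)).trans (by linarith [hM n x, hM' x])
  have hlim : ∀ x, Tendsto (fun n => (g n - g') x) atTop (𝓝 0) := fun x => by
    simpa using (hg x).sub_const (g' x)
  -- The sliding hump lemma handles `(T n - T') (g n - g')`; the remaining `T' (g n - g')` involves
  -- a fixed measure and tends to zero by dominated convergence.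
  have key := tendsto_zero_of_equiLipschitz (fun n => T n - T') (fun n => κ n + κ')
    (fun n φ => by
      rw [LinearMap.sub_apply, integral_add_measure
        (φ.integrable (κ n)).abs (φ.integrable κ').abs]
      exact (norm_sub_le _ _).trans (add_le_add (hT n φ) (hT' φ)))
    (fun φ => by simpa using (h0 φ).sub_const (T' φ))
    (fun n => g n - g') (K := K + K) (fun n => (hK n).sub hK') hbd hlim
  have h2 : Tendsto (fun n => T' (g n - g')) atTop (𝓝 0) := by
    have : Tendsto (fun n => ∫ x, |(g n - g') x| ∂κ') atTop (𝓝 (∫ _, (0 : ℝ) ∂κ')) :=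
      tendsto_integral_of_dominated_convergence (fun _ => 2 * M)
        (fun n => (g n - g').continuous.abs.aestronglyMeasurable) (integrable_const _)
        (fun n => Eventually.of_forall fun x => by simpa using hbd n x)
        (Eventually.of_forall fun x => by simpa using (hlim x).abs)
    rw [integral_zero] at this
    exact squeeze_zero_norm (fun n => hT' _) this
  have h3 := (key.add h2).add (h0 g')
  rw [add_zero, zero_add] at h3
  refine h3.congr fun n => ?_
  simp only [LinearMap.sub_apply, map_sub]
  ring

end UniformWeakConvergence

/-! ### Integrals against complex measures -/

section ComplexIntegral

theorem norm_ofReal_mul_comp_le {S E : Type*} [TopologicalSpace E] (i : S → E) (ψ : E →ᵇ ℂ) (φ : E →ᵇ ℝ) (u : S) :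
    ‖(φ (i u) : ℂ) * ψ (i u)‖ ≤ ‖ψ‖ * |φ (i u)| := by
  rw [norm_mul, Complex.norm_real, Real.norm_eq_abs, mul_comm]
  exact mul_le_mul_of_nonneg_right (ψ.norm_coe_le_norm _) (abs_nonneg _)

variable {S : Type*} [MeasurableSpace S]

/-- From `|z| ≤ |re z| + |im z|`, the variation is dominated by the total variations of the real and
imaginary parts, which are finite. -/
theorem isFiniteMeasure_variation (σ : ComplexMeasure S) : IsFiniteMeasure σ.variation := by
  have hle : σ.variation ≤ (ComplexMeasure.re σ).totalVariation
      + (ComplexMeasure.im σ).totalVariation := by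
    refine VectorMeasure.variation_le_of_forall_enorm_le fun A hA => ?_
    rw [Measure.add_apply]
    refine le_trans ?_ (add_le_add (SignedMeasure.enorm_le_totalVariation _ A)
      (SignedMeasure.enorm_le_totalVariation _ A))
    have h1 : (ComplexMeasure.re σ) A = (σ A).re := rfl
    have h2 : (ComplexMeasure.im σ) A = (σ A).im := rfl
    rw [h1, h2, ← ofReal_norm, ← ofReal_norm, ← ofReal_norm,
      ← ENNReal.ofReal_add (norm_nonneg _) (norm_nonneg _)]
    exact ENNReal.ofReal_le_ofReal (Complex.norm_le_abs_re_add_abs_im _)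
  exact isFiniteMeasure_of_le _ hle

theorem norm_complexIntegral_le (σ : ComplexMeasure S) (g : S → ℂ) :
    ‖complexIntegral σ g‖ ≤ ∫ x, ‖g x‖ ∂σ.variation := by
  exact VectorMeasure.norm_integral_le_integral_norm.trans (mul_le_of_le_one_left
    (integral_nonneg fun _ => norm_nonneg _) (ContinuousLinearMap.opNorm_mul_le ℝ ℂ))

variable {E : Type*} [TopologicalSpace E] [MeasurableSpace E] [BorelSpace E]

theorem measurable_ofReal_mul_comp {i : S → E} (hi : Measurable i) (ψ : E →ᵇ ℂ) (φ : E →ᵇ ℝ) :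
    Measurable fun u => (φ (i u) : ℂ) * ψ (i u) :=
  (Complex.measurable_ofReal.comp (φ.continuous.measurable.comp hi)).mul
    (ψ.continuous.measurable.comp hi)

theorem integrable_ofReal_mul_comp {i : S → E} (hi : Measurable i) (ψ : E →ᵇ ℂ) (φ : E →ᵇ ℝ)
    (κ : Measure S) [IsFiniteMeasure κ] : Integrable (fun u => (φ (i u) : ℂ) * ψ (i u)) κ :=
  Integrable.of_bound (measurable_ofReal_mul_comp hi ψ φ).aestronglyMeasurable (‖ψ‖ * ‖φ‖)
    (Eventually.of_forall fun u => (norm_ofReal_mul_comp_le i ψ φ u).trans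
      (mul_le_mul_of_nonneg_left (φ.norm_coe_le_norm _) (norm_nonneg _)))

/-- Transports the domination to `E`: functionals that live on the varying spaces `E_N` become
functionals on one space, as the sliding hump lemma requires. The map `i` will be an inclusion or
the identity. -/
theorem integral_norm_ofReal_mul_comp_le {i : S → E} (hi : Measurable i) (ψ : E →ᵇ ℂ) (φ : E →ᵇ ℝ)
    (κ : Measure S) [IsFiniteMeasure κ] :
    ∫ u, ‖(φ (i u) : ℂ) * ψ (i u)‖ ∂κ ≤ ∫ x, |φ x| ∂(‖ψ‖₊ • κ.map i) := by
  rw [integral_smul_nnreal_measure,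
    integral_map hi.aemeasurable φ.continuous.abs.measurable.aestronglyMeasurable]
  change _ ≤ ‖ψ‖ * _
  rw [← integral_const_mul]
  refine integral_mono_of_nonneg (Eventually.of_forall fun _ => norm_nonneg _) ?_
    (Eventually.of_forall fun u => norm_ofReal_mul_comp_le i ψ φ u)
  refine Integrable.const_mul ?_ _
  exact Integrable.of_bound (φ.continuous.abs.measurable.comp hi).aestronglyMeasurable ‖φ‖
    (Eventually.of_forall fun u => by
      rw [Real.norm_eq_abs]; refine (abs_abs _).trans_le ?_; exact φ.norm_coe_le_norm _)

/-- The functional `φ ↦ ∫ (φ ψ) ∘ i dσ` on bounded continuous functions. -/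
noncomputable def complexFunctional (σ : ComplexMeasure S) {i : S → E} (hi : Measurable i)
    (ψ : E →ᵇ ℂ) : (E →ᵇ ℝ) →ₗ[ℝ] ℂ where
  toFun φ := complexIntegral σ fun u => (φ (i u) : ℂ) * ψ (i u)
  map_add' φ φ' := by
    have := isFiniteMeasure_variation σ
    unfold complexIntegral
    rw [← VectorMeasure.integral_fun_add (integrable_ofReal_mul_comp hi ψ φ _)
      (integrable_ofReal_mul_comp hi ψ φ' _)]
    simp [add_mul]
  map_smul' c φ := by
    unfold complexIntegral
    rw [RingHom.id_apply, ← VectorMeasure.integral_fun_smul]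
    simp [mul_assoc]

theorem norm_complexFunctional_le (σ : ComplexMeasure S) {i : S → E} (hi : Measurable i)
    (ψ : E →ᵇ ℂ) (φ : E →ᵇ ℝ) :
    ‖complexFunctional σ hi ψ φ‖ ≤ ∫ x, |φ x| ∂(‖ψ‖₊ • σ.variation.map i) := by
  have := isFiniteMeasure_variation σ
  exact (norm_complexIntegral_le σ _).trans (integral_norm_ofReal_mul_comp_le hi ψ φ _)

/-- The functional `φ ↦ ∫ (φ ψ) ∘ i dm` on bounded continuous functions. -/
noncomputable def measureFunctional (m : Measure S) [IsFiniteMeasure m] {i : S → E}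
    (hi : Measurable i) (ψ : E →ᵇ ℂ) : (E →ᵇ ℝ) →ₗ[ℝ] ℂ where
  toFun φ := ∫ u, (φ (i u) : ℂ) * ψ (i u) ∂m
  map_add' φ φ' := by
    rw [← integral_add (integrable_ofReal_mul_comp hi ψ φ _)
      (integrable_ofReal_mul_comp hi ψ φ' _)]
    simp [add_mul]
  map_smul' c φ := by
    rw [RingHom.id_apply, ← integral_smul]
    simp [mul_assoc]

theorem norm_measureFunctional_le (m : Measure S) [IsFiniteMeasure m] {i : S → E}
    (hi : Measurable i) (ψ : E →ᵇ ℂ) (φ : E →ᵇ ℝ) :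
    ‖measureFunctional m hi ψ φ‖ ≤ ∫ x, |φ x| ∂(‖ψ‖₊ • m.map i) :=
  (norm_integral_le_integral_norm _).trans (integral_norm_ofReal_mul_comp_le hi ψ φ _)

end ComplexIntegral

/-! ### Bounded measurable functions -/

/-- Bounded measurable real functions. -/
def BddMeasurable {S : Type*} [MeasurableSpace S] (f : S → ℝ) : Prop :=
  Measurable f ∧ ∃ C, ∀ x, |f x| ≤ C

namespace BddMeasurable

variable {S S' : Type*} [MeasurableSpace S] [MeasurableSpace S'] {f g : S → ℝ}

theorem exists_nonneg_bound (hf : BddMeasurable f) : ∃ C, 0 ≤ C ∧ ∀ x, |f x| ≤ C := by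
  obtain ⟨-, C, hC⟩ := hf
  exact ⟨|C|, abs_nonneg _, fun x => (hC x).trans (le_abs_self _)⟩

theorem integrable (hf : BddMeasurable f) (κ : Measure S) [IsFiniteMeasure κ] :
    Integrable f κ := by
  obtain ⟨hm, C, hC⟩ := hf
  exact Integrable.of_bound hm.aestronglyMeasurable C (Eventually.of_forall hC)

theorem const (c : ℝ) : BddMeasurable fun _ : S => c := ⟨measurable_const, |c|, fun _ => le_rfl⟩

theorem add (hf : BddMeasurable f) (hg : BddMeasurable g) : BddMeasurable fun x => f x + g x := by
  obtain ⟨hf, C, hC⟩ := hf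
  obtain ⟨hg, D, hD⟩ := hg
  exact ⟨hf.add hg, C + D, fun x => (abs_add_le _ _).trans (add_le_add (hC x) (hD x))⟩

theorem neg (hf : BddMeasurable f) : BddMeasurable fun x => -f x := by
  obtain ⟨hf, C, hC⟩ := hf
  exact ⟨hf.neg, C, fun x => by simpa using hC x⟩

theorem sub (hf : BddMeasurable f) (hg : BddMeasurable g) : BddMeasurable fun x => f x - g x := by
  simpa [sub_eq_add_neg] using hf.add hg.neg

theorem abs (hf : BddMeasurable f) : BddMeasurable fun x => |f x| := by
  obtain ⟨hf, C, hC⟩ := hf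
  exact ⟨continuous_abs.measurable.comp hf, C, fun x => by simpa using hC x⟩

theorem mul (hf : BddMeasurable f) (hg : BddMeasurable g) : BddMeasurable fun x => f x * g x := by
  obtain ⟨C, hC0, hC⟩ := hf.exists_nonneg_bound
  obtain ⟨D, -, hD⟩ := hg.exists_nonneg_bound
  refine ⟨hf.1.mul hg.1, C * D, fun x => ?_⟩
  rw [abs_mul]
  exact mul_le_mul (hC x) (hD x) (abs_nonneg _) hC0

theorem comp (hf : BddMeasurable f) {φ : S' → S} (hφ : Measurable φ) :
    BddMeasurable fun x => f (φ x) := by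
  obtain ⟨hf, C, hC⟩ := hf
  exact ⟨hf.comp hφ, C, fun x => hC _⟩

theorem finset_sum {ι : Type*} (I : Finset ι) {f : ι → S → ℝ}
    (hf : ∀ i ∈ I, BddMeasurable (f i)) : BddMeasurable fun x => ∑ i ∈ I, f i x := by
  classical
  induction I using Finset.induction_on with
  | empty => simpa using const 0
  | insert i I hi ih =>
    simp only [Finset.sum_insert hi]
    exact (hf i (Finset.mem_insert_self _ _)).add
      (ih fun j hj => hf j (Finset.mem_insert_of_mem hj))

theorem finset_prod {ι : Type*} (I : Finset ι) {f : ι → S → ℝ}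
    (hf : ∀ i ∈ I, BddMeasurable (f i)) : BddMeasurable fun x => ∏ i ∈ I, f i x := by
  classical
  induction I using Finset.induction_on with
  | empty => simpa using const 1
  | insert i I hi ih =>
    simp only [Finset.prod_insert hi]
    exact (hf i (Finset.mem_insert_self _ _)).mul
      (ih fun j hj => hf j (Finset.mem_insert_of_mem hj))

theorem abs_integral_le {C : ℝ} (hC : ∀ x, |f x| ≤ C) (κ : Measure S) [IsFiniteMeasure κ] :
    |∫ x, f x ∂κ| ≤ C * κ.real univ :=
  (Real.norm_eq_abs _).symm.trans_le (norm_integral_le_of_norm_le_const (Eventually.of_forall hC))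

theorem integral_right {f : S × S' → ℝ} (hf : BddMeasurable f) (κ : Measure S')
    [IsFiniteMeasure κ] : BddMeasurable fun x => ∫ y, f (x, y) ∂κ := by
  obtain ⟨hf, C, hC⟩ := hf
  exact ⟨hf.stronglyMeasurable.integral_prod_right'.measurable, C * κ.real univ,
    fun x => abs_integral_le (fun y => hC _) κ⟩

theorem integral_kernel {f : S' → ℝ} (hf : BddMeasurable f) (P : Kernel S S')
    [IsMarkovKernel P] : BddMeasurable fun x => ∫ y, f y ∂P x := by
  obtain ⟨hf, C, hC⟩ := hf
  refine ⟨hf.stronglyMeasurable.integral_kernel.measurable, C, fun x => ?_⟩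
  simpa using abs_integral_le hC (P x)

theorem integral_bind {f : S' → ℝ} (hf : BddMeasurable f) (P : Kernel S S') [IsMarkovKernel P]
    (m : Measure S) [IsProbabilityMeasure m] :
    ∫ y, f y ∂(m.bind P) = ∫ x, ∫ y, f y ∂P x ∂m := by
  rw [← Measure.snd_compProd, Measure.snd, integral_map measurable_snd.aemeasurable
    hf.1.aestronglyMeasurable, Measure.integral_compProd ((hf.comp measurable_snd).integrable _)]

theorem integral_integral_swap {f : S × S' → ℝ} (hf : BddMeasurable f) (κ : Measure S)
    (κ' : Measure S') [IsFiniteMeasure κ] [IsFiniteMeasure κ'] :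
    ∫ x, ∫ y, f (x, y) ∂κ' ∂κ = ∫ y, ∫ x, f (x, y) ∂κ ∂κ' :=
  MeasureTheory.integral_integral_swap (f := fun x y => f (x, y)) (hf.integrable (κ.prod κ'))

end BddMeasurable

/-! ### Exponential weights -/

/-- The measure `e^{-l t} dt` on `[0,∞)`. -/
noncomputable def expWeightMeasure (l : ℝ) : Measure ℝ≥0 :=
  ((volume.restrict (Ioi (0 : ℝ))).withDensity fun t => ENNReal.ofReal (Real.exp (-l * t))).map
    Real.toNNReal

theorem integral_expWeightMeasure (l : ℝ) {g : ℝ≥0 → ℝ} (hg : Measurable g) :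
    ∫ t, g t ∂(expWeightMeasure l) = ∫ t in Ioi (0 : ℝ), Real.exp (-l * t) * g t.toNNReal := by
  rw [expWeightMeasure, integral_map measurable_real_toNNReal.aemeasurable hg.aestronglyMeasurable,
    integral_withDensity_eq_integral_toReal_smul (by fun_prop)
      (Eventually.of_forall fun _ => ENNReal.ofReal_lt_top)]
  simp [ENNReal.toReal_ofReal (Real.exp_nonneg _)]

theorem isFiniteMeasure_expWeightMeasure {l : ℝ} (hl : 0 < l) : IsFiniteMeasure (expWeightMeasure l) := by
  have := isFiniteMeasure_withDensity_ofReal (exp_neg_integrableOn_Ioi 0 hl).2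
  unfold expWeightMeasure
  infer_instance

theorem expWeightMeasure_real_univ {l : ℝ} (hl : 0 < l) : (expWeightMeasure l).real univ = 1 / l := by
  have h := integral_expWeightMeasure l (g := fun _ => 1) measurable_const
  simp only [integral_const, smul_eq_mul, mul_one] at h
  rw [h, integral_exp_mul_Ioi (by linarith)]
  simp [neg_div_neg_eq]

/-- Product of two integrals over the line, split according to the order of the two variables. -/
theorem integral_mul_integral_eq {p q : ℝ → ℝ} (hp : Integrable p) (hq : Integrable q) :
    (∫ s, p s) * ∫ r, q r
      = (∫ s, p s * ∫ r, (Ioi s).indicator q r) + ∫ r, q r * ∫ s, (Ici r).indicator p s := by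
  have hpq : Integrable (fun z : ℝ × ℝ => p z.1 * q z.2) (volume.prod volume) := hp.mul_prod hq
  let D : Set (ℝ × ℝ) := {z | z.1 < z.2}
  have hD : MeasurableSet D := measurableSet_lt measurable_fst measurable_snd
  rw [← integral_prod_mul, ← integral_add_compl hD hpq, ← integral_indicator hD,
    ← integral_indicator hD.compl, integral_prod _ (hpq.indicator hD),
    integral_prod_symm _ (hpq.indicator hD.compl)]
  congr 1
  · refine integral_congr_ae (Eventually.of_forall fun s => ?_)
    dsimp only
    rw [← integral_const_mul]
    refine integral_congr_ae (Eventually.of_forall fun r => ?_)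
    by_cases h : s < r <;> simp [D, indicator, h]
  · refine integral_congr_ae (Eventually.of_forall fun r => ?_)
    dsimp only
    rw [← integral_const_mul]
    refine integral_congr_ae (Eventually.of_forall fun s => ?_)
    by_cases h : s < r
    · simp [D, indicator, h]
    · simp [D, indicator, h, not_lt.1 h, mul_comm]

/-- The function `e^{-l s} a(s)`, extended by `0` to the negative half-line. -/
noncomputable def expWeight (l : ℝ) (a : ℝ≥0 → ℝ) : ℝ → ℝ :=
  (Ioi (0 : ℝ)).indicator fun s => Real.exp (-l * s) * a s.toNNReal

theorem integral_expWeight (l : ℝ) {a : ℝ≥0 → ℝ} (ha : Measurable a) :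
    ∫ s, expWeight l a s = ∫ s, a s ∂(expWeightMeasure l) := by
  rw [integral_expWeightMeasure l ha, ← integral_indicator measurableSet_Ioi]; rfl

theorem integrable_expWeight {l : ℝ} (hl : 0 < l) {a : ℝ≥0 → ℝ} (ha : BddMeasurable a) :
    Integrable (expWeight l a) := by
  obtain ⟨ham, C, hC⟩ := ha
  refine (integrable_indicator_iff measurableSet_Ioi).2 ?_
  exact (exp_neg_integrableOn_Ioi 0 hl).mul_bdd (c := C)
    (ham.comp measurable_real_toNNReal).aestronglyMeasurable (Eventually.of_forall fun s => hC _)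

/-- Translation by `s` pulls out the factor `e^{-l s}`, so the part of the integral after time `s`
is again an integral of the same kind, along the shifted path. -/
theorem integral_indicator_Ioi_expWeight (l : ℝ) {a : ℝ≥0 → ℝ} (ha : Measurable a) {s : ℝ}
    (hs : 0 < s) : ∫ r, (Ioi s).indicator (expWeight l a) r
      = Real.exp (-l * s) * ∫ r, a (s.toNNReal + r) ∂(expWeightMeasure l) := by
  rw [← integral_add_right_eq_self _ s, ← integral_expWeight l (by fun_prop), ← integral_const_mul]
  refine integral_congr_ae (Eventually.of_forall fun r => ?_)
  by_cases hr : 0 < r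
  · have h1 : 0 < r + s := by linarith
    simp only [expWeight, indicator, mem_Ioi, hr, h1, lt_add_iff_pos_left, if_true]
    rw [← mul_assoc, ← Real.exp_add, add_comm r s, Real.toNNReal_add hs.le hr.le, mul_add]
  · simp [expWeight, indicator, hr]

/-- Product of two exponentially weighted integrals, as an integral over the smaller of the two
times. -/
theorem integral_mul_integral_expWeightMeasure {l l' : ℝ} (hl : 0 < l) (hl' : 0 < l') {a b : ℝ≥0 → ℝ}
    (ha : BddMeasurable a) (hb : BddMeasurable b) :
    (∫ s, a s ∂(expWeightMeasure l)) * ∫ r, b r ∂(expWeightMeasure l')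
      = ∫ s, (a s * (∫ r, b (s + r) ∂(expWeightMeasure l')) + b s * ∫ r, a (s + r) ∂(expWeightMeasure l))
          ∂(expWeightMeasure (l + l')) := by
  have := isFiniteMeasure_expWeightMeasure hl
  have := isFiniteMeasure_expWeightMeasure hl'
  have := isFiniteMeasure_expWeightMeasure (add_pos hl hl')
  have hadd : Measurable fun z : ℝ≥0 × ℝ≥0 => z.1 + z.2 := measurable_fst.add measurable_snd
  have hb' : BddMeasurable fun s => a s * ∫ r, b (s + r) ∂(expWeightMeasure l') :=
    ha.mul ((hb.comp hadd).integral_right (expWeightMeasure l'))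
  have ha' : BddMeasurable fun s => b s * ∫ r, a (s + r) ∂(expWeightMeasure l) :=
    hb.mul ((ha.comp hadd).integral_right (expWeightMeasure l))
  rw [integral_add (hb'.integrable _) (ha'.integrable _), ← integral_expWeight l ha.1,
    ← integral_expWeight l' hb.1,
    integral_mul_integral_eq (integrable_expWeight hl ha) (integrable_expWeight hl' hb),
    ← integral_expWeight _ hb'.1, ← integral_expWeight _ ha'.1]
  have hexp : ∀ s, Real.exp (-(l + l') * s) = Real.exp (-l * s) * Real.exp (-l' * s) := fun s => by
    rw [← Real.exp_add]; ring_nf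
  congr 1
  · refine integral_congr_ae (Eventually.of_forall fun s => ?_)
    by_cases hs : 0 < s
    · dsimp only
      rw [integral_indicator_Ioi_expWeight l' hb.1 hs]
      simp only [expWeight, indicator, mem_Ioi, hs, if_true, hexp]
      ring
    · simp [expWeight, indicator, hs]
  · refine integral_congr_ae (Eventually.of_forall fun s => ?_)
    by_cases hs : 0 < s
    · dsimp only
      -- This half carries the diagonal, which is Lebesgue null.
      rw [integral_congr_ae (indicator_ae_eq_of_ae_eq_set Ioi_ae_eq_Ici).symm,
        integral_indicator_Ioi_expWeight l ha.1 hs]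
      simp only [expWeight, indicator, mem_Ioi, hs, if_true, hexp]
      ring
    · simp [expWeight, indicator, hs]

/-- The exponentially weighted integral of the future of the path `a` after time `t`. -/
noncomputable def futureIntegral (l : ℝ) (a : ℝ≥0 → ℝ) (t : ℝ≥0) : ℝ :=
  ∫ s, a (t + s) ∂(expWeightMeasure l)

theorem BddMeasurable.futureIntegral {l : ℝ} (hl : 0 < l) {a : ℝ≥0 → ℝ} (ha : BddMeasurable a) :
    BddMeasurable (futureIntegral l a) := by
  have := isFiniteMeasure_expWeightMeasure hl
  exact (ha.comp (measurable_fst.add measurable_snd)).integral_right (expWeightMeasure l)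

/-- A product of exponentially weighted integrals along a path, as an integral over the smallest of
the times. -/
theorem prod_futureIntegral {ι : Type*} [DecidableEq ι] {lam : ι → ℝ} (hlam : ∀ i, 0 < lam i)
    {a : ι → ℝ≥0 → ℝ} (ha : ∀ i, BddMeasurable (a i)) {I : Finset ι} (hI : I.Nonempty) (t : ℝ≥0) :
    ∏ i ∈ I, futureIntegral (lam i) (a i) t
      = ∫ s, (∑ i ∈ I, a i (t + s) * ∏ j ∈ I.erase i, futureIntegral (lam j) (a j) (t + s))
          ∂(expWeightMeasure (∑ i ∈ I, lam i)) := by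
  -- The time of the new factor is either the smallest of all, or comes after the smallest of the
  -- others. Both cases use the identity for `I`, the first one at the later time `t + s`, which is
  -- why `t` is generalized.
  induction hI using Finset.Nonempty.cons_induction generalizing t with
  | singleton i => simp [futureIntegral]
  | cons j I hj hI ih =>
    have hpos : 0 < ∑ i ∈ I, lam i := Finset.sum_pos (fun i _ => hlam i) hI
    have hb : BddMeasurable fun s => ∑ i ∈ I, a i s *
        ∏ k ∈ I.erase i, futureIntegral (lam k) (a k) s :=
      .finset_sum _ fun i _ => (ha i).mul (.finset_prod _ fun k _ => (ha k).futureIntegral (hlam k))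
    have hshift : Measurable fun s : ℝ≥0 => t + s := measurable_const.add measurable_id
    rw [Finset.prod_cons, Finset.sum_cons, ih t, futureIntegral,
      integral_mul_integral_expWeightMeasure (hlam j) hpos ((ha j).comp hshift) (hb.comp hshift)]
    refine integral_congr_ae (Eventually.of_forall fun s => ?_)
    dsimp only
    rw [Finset.sum_cons, Finset.cons_eq_insert, Finset.erase_insert hj, ih (t + s), Finset.sum_mul]
    simp only [add_assoc]
    congr 1
    refine Finset.sum_congr rfl fun i hi => ?_
    have hij : j ≠ i := fun h => hj (h ▸ hi)
    rw [Finset.erase_insert_of_ne hij, Finset.prod_insert fun h => hj (Finset.mem_of_mem_erase h),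
      mul_assoc, futureIntegral, mul_comm (∏ _ ∈ _, _)]
    simp only [add_assoc]

/-! ### Moments of exponentially weighted occupation integrals of a Markov process -/

section Markov

set_option linter.unusedSectionVars false

variable {S Ω : Type*} [MeasurableSpace S] [mΩ : MeasurableSpace Ω]

/-- The natural filtration of a process. -/
abbrev pastSigma (X : ℝ≥0 → Ω → S) (s : ℝ≥0) : MeasurableSpace Ω :=
  ⨆ r : Iic s, MeasurableSpace.comap (X r) inferInstance

theorem pastSigma_mono (X : ℝ≥0 → Ω → S) {s t : ℝ≥0} (h : s ≤ t) :
    pastSigma X s ≤ pastSigma X t :=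
  iSup_le fun r => le_iSup (fun r : Iic t => MeasurableSpace.comap (X r) _)
    ⟨r.1, (mem_Iic.1 r.2).trans h⟩

theorem measurable_pastSigma (X : ℝ≥0 → Ω → S) (s : ℝ≥0) : Measurable[pastSigma X s] (X s) :=
  measurable_iff_comap_le.2
    (le_iSup (fun r : Iic s => MeasurableSpace.comap (X r) inferInstance) ⟨s, self_mem_Iic⟩)

/-- The product of exponentially weighted occupation integrals, after time `t`. -/
noncomputable def occupationProd {ι : Type*} (X : ℝ≥0 → Ω → S) (lam : ι → ℝ) (h : ι → S → ℝ)
    (I : Finset ι) (t : ℝ≥0) (ω : Ω) : ℝ :=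
  ∏ i ∈ I, futureIntegral (lam i) (fun s => h i (X s ω)) t

/-- The moments of exponentially weighted occupation integrals of a Markov process. -/
noncomputable def occupationMoment {ι : Type*} (P : Kernel S Ω) (X : ℝ≥0 → Ω → S) (lam : ι → ℝ)
    (h : ι → S → ℝ) (I : Finset ι) (x : S) : ℝ :=
  ∫ ω, occupationProd X lam h I 0 ω ∂P x

variable {P : Kernel S Ω} [IsMarkovKernel P] {X : ℝ≥0 → Ω → S}

namespace IsMarkovProcess

theorem measurable_eval (hX : IsMarkovProcess P X) (t : ℝ≥0) : Measurable (X t) :=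
  hX.measurable.comp measurable_prodMk_left

theorem pastSigma_le (hX : IsMarkovProcess P X) (s : ℝ≥0) : pastSigma X s ≤ mΩ :=
  iSup_le fun r => (hX.measurable_eval r).comap_le

theorem bddMeasurable_semigroup (hX : IsMarkovProcess P X) {f : S → ℝ} (hf : BddMeasurable f)
    (t : ℝ≥0) : BddMeasurable (semigroup P X t f) :=
  (hf.comp (hX.measurable_eval t)).integral_kernel P

theorem bddMeasurable_semigroup_prod (hX : IsMarkovProcess P X) {f : S → ℝ}
    (hf : BddMeasurable f) : BddMeasurable fun z : S × ℝ≥0 => semigroup P X z.2 f z.1 := by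
  have h1 : BddMeasurable fun q : (S × ℝ≥0) × Ω => f (X q.1.2 q.2) :=
    hf.comp (hX.measurable.comp ((measurable_snd.comp measurable_fst).prodMk measurable_snd))
  obtain ⟨hm, C, hC⟩ := h1
  let κ : Kernel (S × ℝ≥0) Ω := P.comap Prod.fst measurable_fst
  have h2 := hm.stronglyMeasurable.integral_kernel_prod_right' (κ := κ)
  refine ⟨h2.measurable, C, fun z => ?_⟩
  have := BddMeasurable.abs_integral_le (fun ω => hC (z, ω)) (P z.1)
  simpa [semigroup] using this

theorem markovResolvent_eq (hX : IsMarkovProcess P X) {f : S → ℝ} (hf : BddMeasurable f) (l : ℝ)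
    (x : S) : markovResolvent P X l f x = ∫ t, semigroup P X t f x ∂(expWeightMeasure l) := by
  rw [integral_expWeightMeasure l
    ((hX.bddMeasurable_semigroup_prod hf).comp measurable_prodMk_left).1]
  rfl

theorem bddMeasurable_markovResolvent (hX : IsMarkovProcess P X) {f : S → ℝ}
    (hf : BddMeasurable f) {l : ℝ} (hl : 0 < l) : BddMeasurable (markovResolvent P X l f) := by
  have := isFiniteMeasure_expWeightMeasure hl
  have h := (hX.bddMeasurable_semigroup_prod hf).integral_right (expWeightMeasure l)
  exact (funext fun x => hX.markovResolvent_eq hf l x) ▸ h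

theorem abs_markovResolvent_le (hX : IsMarkovProcess P X) {f : S → ℝ} (hf : Measurable f)
    {C : ℝ} (hC : ∀ x, |f x| ≤ C) {l : ℝ} (hl : 0 < l) (x : S) :
    |markovResolvent P X l f x| ≤ C * (1 / l) := by
  have := isFiniteMeasure_expWeightMeasure hl
  rw [hX.markovResolvent_eq ⟨hf, C, hC⟩, ← expWeightMeasure_real_univ hl]
  refine BddMeasurable.abs_integral_le (fun t => ?_) _
  have := BddMeasurable.abs_integral_le (fun ω => hC (X t ω)) (P x)
  simpa [semigroup] using this

/-- The Markov property on events of the past. -/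
theorem setIntegral_markov (hX : IsMarkovProcess P X) {f : S → ℝ} (hf : BddMeasurable f) (x : S)
    (s t : ℝ≥0) {A : Set Ω} (hA : MeasurableSet[pastSigma X s] A) :
    ∫ ω in A, f (X (s + t) ω) ∂P x = ∫ ω in A, semigroup P X t f (X s ω) ∂P x := by
  have hXs := hX.measurable_eval s
  have hXt := hX.measurable_eval t
  have hXst := hX.measurable_eval (s + t)
  let Q : Kernel S S := P.map (X t)
  have : IsMarkovKernel Q := Kernel.IsMarkovKernel.map P hXt
  -- The defining property concerns events; as an identity of measures on the state space it passes
  -- to integrals.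
  have hlaw : ((P x).restrict A).map (X (s + t)) = (((P x).restrict A).map (X s)).bind Q := by
    ext B hB
    rw [Measure.map_apply hXst hB, Measure.restrict_apply (hXst hB), inter_comm,
      hX.markov x s t A B hA hB, Measure.bind_apply hB Q.measurable.aemeasurable,
      lintegral_map (Q.measurable_coe hB) hXs]
    refine lintegral_congr fun ω => ?_
    rw [Kernel.map_apply' _ hXt _ hB]
  have h1 : ∫ y, f y ∂(((P x).restrict A).map (X (s + t))) = ∫ ω in A, f (X (s + t) ω) ∂P x :=
    integral_map hXst.aemeasurable hf.1.aestronglyMeasurable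
  have h2 : ∀ y, ∫ z, f z ∂Q y = semigroup P X t f y := fun y => by
    rw [Kernel.map_apply _ hXt, integral_map hXt.aemeasurable hf.1.aestronglyMeasurable]; rfl
  rw [← h1, hlaw, ← Measure.snd_compProd, Measure.snd, integral_map measurable_snd.aemeasurable
    hf.1.aestronglyMeasurable, Measure.integral_compProd ((hf.comp measurable_snd).integrable _),
    integral_map hXs.aemeasurable]
  · simp only [h2]
  · exact (hf.integral_kernel Q).1.aestronglyMeasurable

/-- The Markov property for functions of the past. -/
theorem integral_markov (hX : IsMarkovProcess P X) {f : S → ℝ} (hf : BddMeasurable f) (x : S)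
    (s t : ℝ≥0) {F : Ω → ℝ} (hF : Measurable[pastSigma X s] F) {C : ℝ} (hC : ∀ ω, |F ω| ≤ C) :
    ∫ ω, F ω * f (X (s + t) ω) ∂P x = ∫ ω, F ω * semigroup P X t f (X s ω) ∂P x := by
  have hle := hX.pastSigma_le s
  have hi := (hf.comp (hX.measurable_eval (s + t))).integrable (P x)
  have hg := hX.bddMeasurable_semigroup hf t
  have hgX : Measurable[pastSigma X s] fun ω => semigroup P X t f (X s ω) :=
    hg.1.comp (measurable_pastSigma X s)
  have h1 : (fun ω => semigroup P X t f (X s ω)) =ᵐ[P x]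
      (P x)[fun ω => f (X (s + t) ω) | pastSigma X s] :=
    ae_eq_condExp_of_forall_setIntegral_eq hle hi
      (fun A _ _ => ((hg.comp (hX.measurable_eval s)).integrable _).integrableOn)
      (fun A hA _ => (hX.setIntegral_markov hf x s t hA).symm)
      hgX.stronglyMeasurable.aestronglyMeasurable
  have h2 := condExp_stronglyMeasurable_mul_of_bound hle hF.stronglyMeasurable hi C
    (Eventually.of_forall hC)
  calc ∫ ω, F ω * f (X (s + t) ω) ∂P x
      = ∫ ω, ((P x)[F * fun ω => f (X (s + t) ω) | pastSigma X s]) ω ∂P x :=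
        (integral_condExp hle).symm
    _ = _ := integral_congr_ae (h2.trans (by
        filter_upwards [h1] with ω hω
        simp [hω]))

theorem bddMeasurable_path (hX : IsMarkovProcess P X) {f : S → ℝ} (hf : BddMeasurable f) (ω : Ω) :
    BddMeasurable fun s => f (X s ω) :=
  hf.comp (hX.measurable.comp measurable_prodMk_right)

variable {ι : Type*} {lam : ι → ℝ} {h : ι → S → ℝ}

theorem bddMeasurable_occupationProd (hX : IsMarkovProcess P X) (hlam : ∀ i, 0 < lam i)
    (hh : ∀ i, BddMeasurable (h i)) (I : Finset ι) :
    BddMeasurable fun z : ℝ≥0 × Ω => occupationProd X lam h I z.1 z.2 := by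
  refine .finset_prod _ fun i _ => ?_
  have := isFiniteMeasure_expWeightMeasure (hlam i)
  exact BddMeasurable.integral_right (f := fun q : (ℝ≥0 × Ω) × ℝ≥0 => h i (X (q.1.1 + q.2) q.1.2))
    ((hh i).comp (hX.measurable.comp
    (((measurable_fst.comp measurable_fst).add measurable_snd).prodMk
      (measurable_snd.comp measurable_fst)))) _

theorem bddMeasurable_occupationMoment (hX : IsMarkovProcess P X) (hlam : ∀ i, 0 < lam i)
    (hh : ∀ i, BddMeasurable (h i)) (I : Finset ι) :
    BddMeasurable (occupationMoment P X lam h I) :=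
  ((hX.bddMeasurable_occupationProd hlam hh I).comp measurable_prodMk_left).integral_kernel P

theorem occupationMoment_empty (x : S) : occupationMoment P X lam h ∅ x = 1 := by
  simp [occupationMoment, occupationProd]

variable [DecidableEq ι]

/-- The Markov property for products of occupation integrals, together with the recursion for their
moments. -/
theorem integral_mul_occupationProd (hX : IsMarkovProcess P X) (hlam : ∀ i, 0 < lam i)
    (hh : ∀ i, BddMeasurable (h i)) (I : Finset ι) :
    (∀ (x : S) (s : ℝ≥0) (F : Ω → ℝ), Measurable[pastSigma X s] F → (∃ C, ∀ ω, |F ω| ≤ C) →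
      ∫ ω, F ω * occupationProd X lam h I s ω ∂P x
        = ∫ ω, F ω * occupationMoment P X lam h I (X s ω) ∂P x) ∧
    (I.Nonempty → ∀ x, occupationMoment P X lam h I x = markovResolvent P X (∑ i ∈ I, lam i)
      (fun y => ∑ i ∈ I, h i y * occupationMoment P X lam h (I.erase i) y) x) := by
  -- The two claims need each other: the recursion for `I` uses the Markov property for its subsets,
  -- and it turns the resolvent in `key` into the moment that the Markov property for `I` asks for.
  induction I using Finset.strongInduction with
  | H I ih =>
  rcases I.eq_empty_or_nonempty with rfl | hI
  · refine ⟨fun x s F _ _ => ?_, fun h => absurd h (by simp)⟩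
    simp [occupationMoment_empty, occupationProd]
  have hpos : 0 < ∑ i ∈ I, lam i := Finset.sum_pos (fun i _ => hlam i) hI
  have := isFiniteMeasure_expWeightMeasure hpos
  set Λ := ∑ i ∈ I, lam i
  set φ : S → ℝ := fun y => ∑ i ∈ I, h i y * occupationMoment P X lam h (I.erase i) y with hφdef
  have hφ : BddMeasurable φ := .finset_sum _ fun i _ =>
    (hh i).mul (hX.bddMeasurable_occupationMoment hlam hh _)
  have key : ∀ (x : S) (s : ℝ≥0) (F : Ω → ℝ), Measurable[pastSigma X s] F →
      (∃ C, ∀ ω, |F ω| ≤ C) → ∫ ω, F ω * occupationProd X lam h I s ω ∂P x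
        = ∫ ω, F ω * markovResolvent P X Λ φ (X s ω) ∂P x := by
    rintro x s F hF ⟨C, hC⟩
    have hF' : BddMeasurable F := ⟨hF.mono (hX.pastSigma_le s) le_rfl, C, hC⟩
    have hterm : ∀ i, BddMeasurable fun z : Ω × ℝ≥0 =>
        h i (X (s + z.2) z.1) * occupationProd X lam h (I.erase i) (s + z.2) z.1 := fun i => by
      have hz : Measurable fun z : Ω × ℝ≥0 => ((s + z.2 : ℝ≥0), z.1) :=
        (measurable_const.add measurable_snd).prodMk measurable_fst
      exact ((hh i).comp (hX.measurable.comp hz)).mul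
        ((hX.bddMeasurable_occupationProd hlam hh (I.erase i)).comp hz)
    have hsum : BddMeasurable fun z : Ω × ℝ≥0 => F z.1 * ∑ i ∈ I,
        h i (X (s + z.2) z.1) * occupationProd X lam h (I.erase i) (s + z.2) z.1 :=
      (hF'.comp measurable_fst).mul (.finset_sum _ fun i _ => hterm i)
    have hres : BddMeasurable fun z : Ω × ℝ≥0 => F z.1 * semigroup P X z.2 φ (X s z.1) :=
      (hF'.comp measurable_fst).mul ((hX.bddMeasurable_semigroup_prod hφ).comp
        (((hX.measurable_eval s).comp measurable_fst).prodMk measurable_snd))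
    calc ∫ ω, F ω * occupationProd X lam h I s ω ∂P x
        = ∫ ω, ∫ t, F ω * ∑ i ∈ I, h i (X (s + t) ω)
            * occupationProd X lam h (I.erase i) (s + t) ω ∂(expWeightMeasure Λ) ∂P x := by
          refine integral_congr_ae (Eventually.of_forall fun ω => ?_)
          dsimp only
          rw [integral_const_mul, occupationProd,
            prod_futureIntegral hlam (fun i => hX.bddMeasurable_path (hh i) ω) hI]
          rfl
      _ = ∫ t, ∫ ω, F ω * ∑ i ∈ I, h i (X (s + t) ω)
            * occupationProd X lam h (I.erase i) (s + t) ω ∂P x ∂(expWeightMeasure Λ) :=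
          hsum.integral_integral_swap _ _
      _ = ∫ t, ∫ ω, F ω * semigroup P X t φ (X s ω) ∂P x ∂(expWeightMeasure Λ) := by
          refine integral_congr_ae (Eventually.of_forall fun t => ?_)
          dsimp only
          rw [← hX.integral_markov hφ x s t hF hC]
          simp only [hφdef, Finset.mul_sum]
          rw [integral_finsetSum, integral_finsetSum]
          · refine Finset.sum_congr rfl fun i hi => ?_
            -- The factor at the smallest time joins `F`, and the product is known at time `s + t`;
            -- the induction hypothesis replaces the remaining product by its conditional moment.
            have hFi : Measurable[pastSigma X (s + t)] fun ω => F ω * h i (X (s + t) ω) :=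
              Measurable.mul (hF.mono (pastSigma_mono X le_self_add) le_rfl)
                ((hh i).1.comp (measurable_pastSigma X (s + t)))
            have hFi' : BddMeasurable fun ω => F ω * h i (X (s + t) ω) :=
              hF'.mul ((hh i).comp (hX.measurable_eval _))
            have := (ih _ (Finset.erase_ssubset hi)).1 x (s + t) _ hFi hFi'.2
            simpa only [mul_assoc] using this
          · exact fun i _ => (hF'.mul (((hh i).comp (hX.measurable_eval _)).mul
              ((hX.bddMeasurable_occupationMoment hlam hh _).comp
                (hX.measurable_eval _)))).integrable _
          · exact fun i _ => (hF'.mul ((hterm i).comp measurable_prodMk_right)).integrable _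
      _ = ∫ ω, ∫ t, F ω * semigroup P X t φ (X s ω) ∂(expWeightMeasure Λ) ∂P x :=
          (hres.integral_integral_swap _ _).symm
      _ = _ := by
          simp only [integral_const_mul, ← hX.markovResolvent_eq hφ]
  -- Take `s = 0` and `F = 1` in `key`: under `P x` the process starts almost surely from `x`.
  have hrec : ∀ x, occupationMoment P X lam h I x = markovResolvent P X Λ φ x := fun x => by
    have h1 := key x 0 (fun _ => 1) measurable_const ⟨1, by simp⟩
    simp only [one_mul] at h1
    rw [occupationMoment, h1, integral_congr_ae (g := fun _ => markovResolvent P X Λ φ x)]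
    · simp
    · filter_upwards [hX.start x] with ω hω
      rw [hω]
  refine ⟨fun x s F hF hC => ?_, fun _ => hrec⟩
  simp only [hrec]
  exact key x s F hF hC

end IsMarkovProcess

/-! ### Invariant measures -/

theorem IsInvariantFor.integral_integral (hX : IsMarkovProcess P X) {m : Measure S}
    [IsProbabilityMeasure m] (hm : IsInvariantFor P X m) {f : S → ℝ} (hf : BddMeasurable f)
    (t : ℝ≥0) : ∫ ω, f (X t ω) ∂(m.bind P) = ∫ x, f x ∂m := by
  rw [← integral_map (hX.measurable_eval t).aemeasurable hf.1.aestronglyMeasurable, hm t]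

/-- The resolvent respects almost everywhere equality with respect to an invariant measure. -/
theorem IsInvariantFor.markovResolvent_congr (hX : IsMarkovProcess P X) {m : Measure S}
    [IsProbabilityMeasure m] (hm : IsInvariantFor P X m) {f g : S → ℝ} (hf : BddMeasurable f)
    (hg : BddMeasurable g) (hfg : f =ᵐ[m] g) {l : ℝ} (hl : 0 < l) :
    markovResolvent P X l f =ᵐ[m] markovResolvent P X l g := by
  have := isFiniteMeasure_expWeightMeasure hl
  have hd := (hf.sub hg).abs
  have hRd := hX.bddMeasurable_markovResolvent hd hl
  have hprod := hX.bddMeasurable_semigroup_prod hd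
  -- It is enough to bound `|R f - R g|` by `R |f - g|`, whose `m`-integral is `∫ |f - g| dm / l =
  -- 0` by invariance.
  have hle : ∀ x, |markovResolvent P X l f x - markovResolvent P X l g x|
      ≤ markovResolvent P X l (fun y => |f y - g y|) x := fun x => by
    rw [hX.markovResolvent_eq hf, hX.markovResolvent_eq hg, hX.markovResolvent_eq hd,
      ← integral_sub (((hX.bddMeasurable_semigroup_prod hf).comp
          measurable_prodMk_left).integrable _)
        (((hX.bddMeasurable_semigroup_prod hg).comp measurable_prodMk_left).integrable _)]
    refine (abs_integral_le_integral_abs).trans (integral_mono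
      (((hX.bddMeasurable_semigroup_prod hf).sub (hX.bddMeasurable_semigroup_prod hg)).abs.comp
        measurable_prodMk_left |>.integrable _) ((hprod.comp measurable_prodMk_left).integrable _)
      fun t => ?_)
    dsimp only [semigroup]
    rw [← integral_sub ((hf.comp (hX.measurable_eval t)).integrable _)
      ((hg.comp (hX.measurable_eval t)).integrable _)]
    exact abs_integral_le_integral_abs
  have hzero : ∫ x, markovResolvent P X l (fun y => |f y - g y|) x ∂m = 0 := by
    simp only [hX.markovResolvent_eq hd]
    rw [hprod.integral_integral_swap]
    refine integral_eq_zero_of_ae (Eventually.of_forall fun t => ?_)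
    dsimp only [semigroup, Pi.zero_apply]
    rw [← (hd.comp (hX.measurable_eval t)).integral_bind, hm.integral_integral hX hd]
    refine integral_eq_zero_of_ae (hfg.mono fun x hx => ?_)
    simp [hx]
  have hnonneg : ∀ x, 0 ≤ markovResolvent P X l (fun y => |f y - g y|) x := fun x =>
    (abs_nonneg _).trans (hle x)
  filter_upwards [(integral_eq_zero_iff_of_nonneg hnonneg (hRd.integrable m)).1 hzero] with x hx
  have := hle x
  rw [hx] at this
  exact sub_eq_zero.1 (abs_nonpos_iff.1 this)

end Markov

/-! ### Convergence of resolvents -/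

section EquiLipschitz

/-- A bounded equi-Lipschitz sequence on a separable space has a pointwise convergent
subsequence. -/
theorem exists_subseq_tendsto_of_equiLipschitz {E : Type*} [PseudoMetricSpace E]
    [TopologicalSpace.SeparableSpace E] {g : ℕ → E → ℝ} {K : ℝ≥0} {B : ℝ}
    (hK : ∀ n, LipschitzWith K (g n)) (hB : ∀ n x, |g n x| ≤ B) :
    ∃ s : ℕ → ℕ, StrictMono s ∧ ∃ G : E → ℝ, ∀ x, Tendsto (fun n => g (s n) x) atTop (𝓝 (G x)) := by
  rcases isEmpty_or_nonempty E with hE | hE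
  · exact ⟨id, strictMono_id, fun _ => 0, fun x => hE.elim x⟩
  -- Tychonoff's theorem provides convergence on the dense sequence; the common Lipschitz constant
  -- spreads it to all points.
  have hcpt : IsCompact (Set.pi univ fun _ : ℕ => Icc (-B) B) :=
    isCompact_univ_pi fun _ => isCompact_Icc
  obtain ⟨a, -, s, hs, ha⟩ := hcpt.tendsto_subseq
    (x := fun n i => g n (TopologicalSpace.denseSeq E i)) fun n i _ => abs_le.1 (hB n _)
  rw [tendsto_pi_nhds] at ha
  refine ⟨s, hs, ?_⟩
  have hc : ∀ x, CauchySeq fun n => g (s n) x := fun x => by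
    rw [Metric.cauchySeq_iff]
    intro ε hε
    obtain ⟨i, hi⟩ := (TopologicalSpace.denseRange_denseSeq E).exists_dist_lt x
      (show 0 < ε / (4 * (K + 1)) by positivity)
    have hKi : (K : ℝ) * dist x (TopologicalSpace.denseSeq E i) ≤ ε / 4 := by
      have hK0 : (0 : ℝ) ≤ K := K.2
      rw [lt_div_iff₀ (by positivity)] at hi
      nlinarith [dist_nonneg (x := x) (y := TopologicalSpace.denseSeq E i)]
    obtain ⟨N, hN⟩ := Metric.cauchySeq_iff.1 (ha i).cauchySeq (ε / 2) (by linarith)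
    refine ⟨N, fun p hp q hq => ?_⟩
    have h1 := (hK (s p)).dist_le_mul x (TopologicalSpace.denseSeq E i)
    have h2 := (hK (s q)).dist_le_mul x (TopologicalSpace.denseSeq E i)
    have h3 := hN p hp q hq
    rw [dist_comm] at h2
    calc dist (g (s p) x) (g (s q) x) ≤ _ := dist_triangle4 _
            (g (s p) (TopologicalSpace.denseSeq E i)) (g (s q) (TopologicalSpace.denseSeq E i)) _
      _ < ε := by
        simp only [Function.comp] at h3
        linarith
  choose G hG using fun x => cauchySeq_tendsto_of_complete (hc x)
  exact ⟨G, hG⟩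

theorem LipschitzWith.of_tendsto {E : Type*} [PseudoMetricSpace E] {g : ℕ → E → ℝ} {K : ℝ≥0}
    (hK : ∀ n, LipschitzWith K (g n)) {G : E → ℝ}
    (hG : ∀ x, Tendsto (fun n => g n x) atTop (𝓝 (G x))) : LipschitzWith K G :=
  LipschitzWith.of_dist_le_mul fun x y =>
    le_of_tendsto ((hG x).dist (hG y)) (Eventually.of_forall fun n => (hK n).dist_le_mul x y)

theorem LipschitzWith.mul_of_bounded {E : Type*} [PseudoMetricSpace E] {f g : E → ℝ}
    {K L : ℝ≥0} {A B : ℝ} (hf : LipschitzWith K f) (hg : LipschitzWith L g) (hA : ∀ x, |f x| ≤ A)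
    (hB : ∀ x, |g x| ≤ B) :
    LipschitzWith (A.toNNReal * L + B.toNNReal * K) fun x => f x * g x := by
  refine LipschitzWith.of_dist_le_mul fun x y => ?_
  have h1 := hf.dist_le_mul x y
  have h2 := hg.dist_le_mul x y
  rw [Real.dist_eq] at h1 h2 ⊢
  have hA0 : 0 ≤ A := (abs_nonneg _).trans (hA x)
  have hB0 : 0 ≤ B := (abs_nonneg _).trans (hB x)
  push_cast
  rw [Real.coe_toNNReal _ hA0, Real.coe_toNNReal _ hB0]
  calc |f x * g x - f y * g y| = |f x * (g x - g y) + g y * (f x - f y)| := by ring_nf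
    _ ≤ |f x| * |g x - g y| + |g y| * |f x - f y| := by
        rw [← abs_mul, ← abs_mul]; exact abs_add_le _ _
    _ ≤ A * (L * dist x y) + B * (K * dist x y) :=
        add_le_add (mul_le_mul (hA x) h2 (abs_nonneg _) hA0)
          (mul_le_mul (hB y) h1 (abs_nonneg _) hB0)
    _ = _ := by ring

/-- A bounded Lipschitz function on a subset extends to the whole space. -/
theorem LipschitzWith.exists_extension {E : Type*} [PseudoMetricSpace E] {A : Set E} {f : A → ℝ}
    {K : ℝ≥0} {B : ℝ} (hB0 : 0 ≤ B) (hf : LipschitzWith K f) (hB : ∀ x, |f x| ≤ B) :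
    ∃ g : E → ℝ, LipschitzWith K g ∧ (∀ x, |g x| ≤ B) ∧ ∀ x : A, g x = f x := by
  classical
  let f' : E → ℝ := fun x => if h : x ∈ A then f ⟨x, h⟩ else 0
  have hf' : ∀ x : A, f' x = f x := fun x => dif_pos x.2
  have hLip : LipschitzOnWith K f' A := by
    rw [lipschitzOnWith_iff_restrict]
    convert hf using 1
    exact funext hf'
  obtain ⟨g, hg, hgf⟩ := hLip.extend_real
  refine ⟨fun x => max (-B) (min B (g x)), (hg.const_min B).const_max (-B), fun x => ?_,
    fun x => ?_⟩
  · exact abs_le.2 ⟨le_max_left _ _, max_le (by linarith) (min_le_left _ _)⟩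
  · dsimp only
    rw [← hgf x.2, hf', min_eq_right (abs_le.1 (hB x)).2, max_eq_right (abs_le.1 (hB x)).1]

/-- A bounded Lipschitz function, as a bounded continuous function. -/
def LipschitzWith.toBCF {E : Type*} [PseudoMetricSpace E] {f : E → ℝ} {K : ℝ≥0} {B : ℝ}
    (hf : LipschitzWith K f) (hB : ∀ x, |f x| ≤ B) : E →ᵇ ℝ :=
  BoundedContinuousFunction.ofNormedAddCommGroup f hf.continuous B hB

theorem LipschitzWith.bddMeasurable {E : Type*} [PseudoMetricSpace E] [MeasurableSpace E]
    [OpensMeasurableSpace E] {f : E → ℝ} {K : ℝ≥0} {B : ℝ}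
    (hf : LipschitzWith K f) (hB : ∀ x, |f x| ≤ B) : BddMeasurable f :=
  ⟨hf.continuous.measurable, B, hB⟩

/-- The product of a real and a complex bounded continuous function. -/
noncomputable def mulBCF {E : Type*} [TopologicalSpace E] (φ : E →ᵇ ℝ) (ψ : E →ᵇ ℂ) : E →ᵇ ℂ :=
  BoundedContinuousFunction.ofNormedAddCommGroup (fun x => (φ x : ℂ) * ψ x)
    ((Complex.continuous_ofReal.comp φ.continuous).mul ψ.continuous) (‖ψ‖ * ‖φ‖) fun x =>
      (norm_ofReal_mul_comp_le id ψ φ x).trans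
        (mul_le_mul_of_nonneg_left (φ.norm_coe_le_norm x) (norm_nonneg _))

end EquiLipschitz

/-! ### Stability of equi-Lipschitz convergence under sums, products and resolvents -/

section ResolventConvergence

set_option linter.unusedSectionVars false

variable {E : Type*} [MetricSpace E] [TopologicalSpace.SeparableSpace E] [MeasurableSpace E]
  [BorelSpace E] {EN : ℕ → Set E} {mN : ∀ N, Measure (EN N)} [∀ N, IsProbabilityMeasure (mN N)]
  {m : Measure E} [IsProbabilityMeasure m]

theorem tendsto_integral_complex
    (h : ∀ φ : E →ᵇ ℝ, Tendsto (fun N => ∫ x : EN N, φ (x : E) ∂(mN N)) atTop (𝓝 (∫ x, φ x ∂m)))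
    (χ : E →ᵇ ℂ) : Tendsto (fun N => ∫ x : EN N, χ (x : E) ∂(mN N)) atTop (𝓝 (∫ x, χ x ∂m)) := by
  let χr : E →ᵇ ℝ := BoundedContinuousFunction.ofNormedAddCommGroup (fun x => (χ x).re)
    (Complex.continuous_re.comp χ.continuous) ‖χ‖
    fun x => (Complex.abs_re_le_norm _).trans (χ.norm_coe_le_norm x)
  let χi : E →ᵇ ℝ := BoundedContinuousFunction.ofNormedAddCommGroup (fun x => (χ x).im)
    (Complex.continuous_im.comp χ.continuous) ‖χ‖
    fun x => (Complex.abs_im_le_norm _).trans (χ.norm_coe_le_norm x)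
  have hdec : ∀ {S : Type _} [MeasurableSpace S] (μ : Measure S) [IsFiniteMeasure μ] (i : S → E),
      Measurable i → ∫ x, χ (i x) ∂μ
        = ((∫ x, χr (i x) ∂μ : ℝ) : ℂ) + ((∫ x, χi (i x) ∂μ : ℝ) : ℂ) * Complex.I := by
    intro S _ μ _ i hi
    have hint : Integrable (fun x => χ (i x)) μ := Integrable.of_bound
      (χ.continuous.measurable.comp hi).aestronglyMeasurable ‖χ‖
      (Eventually.of_forall fun x => χ.norm_coe_le_norm _)
    exact (integral_re_add_im hint).symm
  have e := fun N => hdec (mN N) Subtype.val measurable_subtype_coe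
  have e' := hdec m id measurable_id
  simp only [id] at e'
  simp only [e, e']
  exact ((Complex.continuous_ofReal.tendsto _).comp (h χr)).add
    (((Complex.continuous_ofReal.tendsto _).comp (h χi)).mul_const _)

/-- Convergence of functions `V N` on `E_N` (up to null sets) to a function `V'` on `E` through
uniformly bounded and equi-Lipschitz functions that converge pointwise. -/
def ConvergesEquiLipschitz (mN : ∀ N, Measure (EN N)) (m : Measure E) (V : ∀ N, EN N → ℝ)
    (V' : E → ℝ) : Prop :=
  ∃ (K : ℝ≥0) (M : ℝ) (F : ℕ → E → ℝ) (F' : E → ℝ), (∀ N, LipschitzWith K (F N)) ∧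
    LipschitzWith K F' ∧ (∀ N x, |F N x| ≤ M) ∧ (∀ x, |F' x| ≤ M) ∧
    (∀ x, Tendsto (fun N => F N x) atTop (𝓝 (F' x))) ∧
    (∀ N, (fun x : EN N => F N x) =ᵐ[mN N] V N) ∧ F' =ᵐ[m] V'

namespace ConvergesEquiLipschitz

variable {V W : ∀ N, EN N → ℝ} {V' W' : E → ℝ}

theorem of_lipschitz {h : E → ℝ} {K : ℝ≥0} {M : ℝ} (hK : LipschitzWith K h)
    (hM : ∀ x, |h x| ≤ M) : ConvergesEquiLipschitz mN m (fun _ x => h x) h :=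
  ⟨K, M, fun _ => h, h, fun _ => hK, hK, fun _ => hM, hM, fun _ => tendsto_const_nhds,
    fun _ => EventuallyEq.rfl, EventuallyEq.rfl⟩

theorem add (hV : ConvergesEquiLipschitz mN m V V') (hW : ConvergesEquiLipschitz mN m W W') :
    ConvergesEquiLipschitz mN m (fun N x => V N x + W N x) fun x => V' x + W' x := by
  obtain ⟨K, M, F, F', h1, h2, h3, h4, h5, h6, h7⟩ := hV
  obtain ⟨L, R, G, G', k1, k2, k3, k4, k5, k6, k7⟩ := hW
  exact ⟨K + L, M + R, fun N x => F N x + G N x, fun x => F' x + G' x, fun N => (h1 N).add (k1 N),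
    h2.add k2, fun N x => (abs_add_le _ _).trans (add_le_add (h3 N x) (k3 N x)),
    fun x => (abs_add_le _ _).trans (add_le_add (h4 x) (k4 x)), fun x => (h5 x).add (k5 x),
    fun N => (h6 N).add (k6 N), h7.add k7⟩

theorem mul (hV : ConvergesEquiLipschitz mN m V V') (hW : ConvergesEquiLipschitz mN m W W') :
    ConvergesEquiLipschitz mN m (fun N x => V N x * W N x) fun x => V' x * W' x := by
  obtain ⟨K, M, F, F', h1, h2, h3, h4, h5, h6, h7⟩ := hV
  obtain ⟨L, R, G, G', k1, k2, k3, k4, k5, k6, k7⟩ := hW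
  have hbd : ∀ {f g : E → ℝ}, (∀ x, |f x| ≤ M) → (∀ x, |g x| ≤ R) → ∀ x, |f x * g x| ≤ M * R :=
    fun hf hg x => by
      rw [abs_mul]
      exact mul_le_mul (hf x) (hg x) (abs_nonneg _) ((abs_nonneg _).trans (hf x))
  exact ⟨_, M * R, fun N x => F N x * G N x, fun x => F' x * G' x,
    fun N => (h1 N).mul_of_bounded (k1 N) (h3 N) (k3 N), h2.mul_of_bounded k2 h4 k4,
    fun N => hbd (h3 N) (k3 N), hbd h4 k4, fun x => (h5 x).mul (k5 x),
    fun N => (h6 N).mul (k6 N), h7.mul k7⟩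

theorem const (c : ℝ) : ConvergesEquiLipschitz mN m (fun _ _ => c) fun _ => c :=
  of_lipschitz (LipschitzWith.const c) fun _ => le_rfl

theorem finset_sum {ι : Type*} (I : Finset ι) {V : ι → ∀ N, EN N → ℝ} {V' : ι → E → ℝ}
    (h : ∀ i ∈ I, ConvergesEquiLipschitz mN m (V i) (V' i)) :
    ConvergesEquiLipschitz mN m (fun N x => ∑ i ∈ I, V i N x) fun x => ∑ i ∈ I, V' i x := by
  classical
  induction I using Finset.induction_on with
  | empty => simpa using const 0
  | insert i I hi ih =>
    simp only [Finset.sum_insert hi]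
    exact (h i (Finset.mem_insert_self _ _)).add
      (ih fun j hj => h j (Finset.mem_insert_of_mem hj))

/-- The integrals converge along functions that converge in the equi-Lipschitz sense. -/
theorem tendsto_measureFunctional
    (h : ∀ φ : E →ᵇ ℝ, Tendsto (fun N => ∫ x : EN N, φ (x : E) ∂(mN N)) atTop (𝓝 (∫ x, φ x ∂m)))
    (ψ : E →ᵇ ℂ) {s : ℕ → ℕ} (hs : Tendsto s atTop atTop) {F : ℕ → E →ᵇ ℝ} {F' : E →ᵇ ℝ}
    {K : ℝ≥0} {M : ℝ} (hK : ∀ N, LipschitzWith K (F N)) (hK' : LipschitzWith K F')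
    (hM : ∀ N x, |F N x| ≤ M) (hF : ∀ x, Tendsto (fun N => F N x) atTop (𝓝 (F' x))) :
    Tendsto (fun k => ∫ x : EN (s k), (F k x : ℂ) * ψ x ∂(mN (s k))) atTop
      (𝓝 (∫ x, (F' x : ℂ) * ψ x ∂m)) :=
  tendsto_of_equiLipschitz
    (fun k => measureFunctional (mN (s k)) (i := Subtype.val) measurable_subtype_coe ψ) _
    (fun k => norm_measureFunctional_le (mN (s k)) measurable_subtype_coe ψ)
    (measureFunctional m (i := id) measurable_id ψ) _ (norm_measureFunctional_le m measurable_id ψ)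
    (fun φ => (tendsto_integral_complex h (mulBCF φ ψ)).comp hs) F F' hK hK' hM hF

theorem tendsto_integral
    (h : ∀ φ : E →ᵇ ℝ, Tendsto (fun N => ∫ x : EN N, φ (x : E) ∂(mN N)) atTop (𝓝 (∫ x, φ x ∂m)))
    (hV : ConvergesEquiLipschitz mN m V V') :
    Tendsto (fun N => ∫ x, V N x ∂(mN N)) atTop (𝓝 (∫ x, V' x ∂m)) := by
  obtain ⟨K, M, F, F', h1, h2, h3, h4, h5, h6, h7⟩ := hV
  have key := tendsto_measureFunctional h (BoundedContinuousFunction.const E 1) tendsto_id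
    (F := fun N => (h1 N).toBCF (h3 N)) (F' := h2.toBCF h4) h1 h2 h3 h5
  have key' := (Complex.continuous_re.tendsto _).comp key
  simp only [BoundedContinuousFunction.const_apply, mul_one, Function.comp_def] at key'
  rw [integral_complex_ofReal, Complex.ofReal_re] at key'
  refine (key'.congr fun N => ?_).trans_eq ?_
  · rw [integral_complex_ofReal, Complex.ofReal_re]
    exact integral_congr_ae (h6 N)
  · rw [← integral_congr_ae h7]
    rfl

end ConvergesEquiLipschitz

variable {Ω : Type*} [MeasurableSpace Ω] {P : Kernel E Ω} [IsMarkovKernel P] {u : ℝ≥0 → Ω → E}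
  {ΩN : ℕ → Type*} [∀ N, MeasurableSpace (ΩN N)] {PN : ∀ N, Kernel (EN N) (ΩN N)}
  [∀ N, IsMarkovKernel (PN N)] {uN : ∀ N, ℝ≥0 → ΩN N → EN N} [∀ N, (mN N).IsOpenPosMeasure]
  {𝒞 : Set (E →ᵇ ℂ)} {Sig : (E →ᵇ ℂ) → ComplexMeasure E}
  {SigN : ∀ N, (E →ᵇ ℂ) → ComplexMeasure (EN N)}

/-- The resolvents of convergent functions converge. -/
theorem ConvergesEquiLipschitz.markovResolvent
    (hu : IsMarkovProcess P u) (hm : IsInvariantFor P u m) (huN : ∀ N, IsMarkovProcess (PN N) (uN N))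
    (hmN : ∀ N, IsInvariantFor (PN N) (uN N) (mN N))
    (h_charac : CharacterizesLimit P u m 𝒞 Sig)
    (h_weak : ∀ φ : E →ᵇ ℝ,
      Tendsto (fun N => ∫ x : EN N, φ (x : E) ∂(mN N)) atTop (𝓝 (∫ x, φ x ∂m)))
    (h_equi : ResolventEquicontinuity PN uN mN)
    (h_discr : DiscreteCharacterization PN uN mN 𝒞 SigN Sig)
    {V : ∀ N, EN N → ℝ} {V' : E → ℝ} (hVm : ∀ N, BddMeasurable (V N)) (hVm' : BddMeasurable V')
    (hV : ConvergesEquiLipschitz mN m V V') {l : ℝ} (hl : 0 < l) :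
    ConvergesEquiLipschitz mN m (fun N => _root_.markovResolvent (PN N) (uN N) l (V N))
      (_root_.markovResolvent P u l V') := by
  obtain ⟨K, M, F, F', hFK, hFK', hFM, hFM', hFlim, hFV, hFV'⟩ := hV
  obtain ⟨e⟩ : Nonempty E := nonempty_of_isProbabilityMeasure m
  have hM0 : 0 ≤ M := (abs_nonneg _).trans (hFM' e)
  have hfK : ∀ N, LipschitzWith K fun x : EN N => F N x := fun N => by
    have := (hFK N).comp (LipschitzWith.subtype_val (EN N))
    rwa [mul_one] at this
  have hfM : ∀ N (x : EN N), |F N x| ≤ M := fun N x => hFM N x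
  have hfb : ∀ N, BddMeasurable fun x : EN N => F N x := fun N => (hfK N).bddMeasurable (hfM N)
  obtain ⟨C, hC⟩ := h_equi l hl
  choose G hGae hGK using fun N => hC N _ K (hfK N) ⟨M, hfM N⟩
  set B : ℝ := M * (1 / l) with hBdef
  have hB0 : 0 ≤ B := by positivity
  -- The bound of the resolvent passes to its continuous version almost everywhere, and then
  -- everywhere because `mN N` charges every nonempty open set.
  have hGB : ∀ N x, |G N x| ≤ B := by
    intro N
    have hopen : IsOpen {x | B < |G N x|} :=
      isOpen_lt continuous_const (hGK N).continuous.abs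
    have hnull : mN N {x | B < |G N x|} = 0 := by
      have : ∀ᵐ x ∂(mN N), ¬ B < |G N x| := by
        filter_upwards [hGae N] with x hx
        rw [hx, not_lt]
        exact (huN N).abs_markovResolvent_le (hfb N).1 (hfM N) hl x
      simpa [ae_iff] using this
    intro x
    by_contra hx
    have : x ∈ (∅ : Set (EN N)) := ((hopen.measure_eq_zero_iff (mN N)).1 hnull) ▸ not_le.1 hx
    exact this
  choose G' hG'K hG'B hG'eq using fun N => (hGK N).exists_extension hB0 (hGB N)
  obtain ⟨R, hRae, ⟨⟨KR, hRK⟩, MR, hRM⟩, hRid, hRuniq⟩ :=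
    h_charac l hl F' ⟨⟨K, hFK'⟩, M, hFM'⟩
  -- Every subsequence has a further one along which `G'` converges pointwise to a bounded Lipschitz
  -- `L`; it remains to show that `L` solves the limiting identity, so that `L = R`.
  have hlim : ∀ x, Tendsto (fun N => G' N x) atTop (𝓝 (R x)) := by
    intro x
    refine tendsto_of_subseq_tendsto fun ns hns => ?_
    obtain ⟨ms, hms, L, hL⟩ := exists_subseq_tendsto_of_equiLipschitz (g := fun n => G' (ns n))
      (fun n => hG'K (ns n)) (fun n => hG'B (ns n))
    refine ⟨ms, ?_⟩
    have hLK : LipschitzWith (C * K) L := LipschitzWith.of_tendsto (fun n => hG'K (ns (ms n))) hL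
    have hLB : ∀ x, |L x| ≤ B := fun x =>
      le_of_tendsto (hL x).abs (Eventually.of_forall fun n => hG'B _ x)
    have hsub : Tendsto (fun n => ns (ms n)) atTop atTop := hns.comp hms.tendsto_atTop
    suffices hLR : L = R by
      rw [← hLR]
      exact hL x
    refine hRuniq L ⟨⟨_, hLK⟩, B, hLB⟩ fun ψ hψ => ?_
    -- The integrals see `E_N` only, where the extension `G' N` agrees with the continuous version
    -- `G N` of the resolvent.
    have hident : ∀ N, -complexIntegral (SigN N ψ) (fun x => (G' N x : ℂ) * ψ x)
        + (l : ℂ) * ∫ x : EN N, (G' N x : ℂ) * ψ x ∂(mN N)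
        = ∫ x : EN N, (F N x : ℂ) * ψ x ∂(mN N) := fun N => by
      have := (h_discr ψ hψ).1 N l hl (fun x => F N x)
        (MemLp.of_bound (hfb N).1.aestronglyMeasurable M (Eventually.of_forall (hfM N)))
        ((hGK N).toBCF (hGB N)) (hGae N)
      simp only [hG'eq]
      exact this
    -- Complex measures and integrands vary together: this is where the sliding hump argument
    -- enters.
    have t1 : Tendsto (fun k => complexIntegral (SigN (ns (ms k)) ψ)
        (fun x => (G' (ns (ms k)) x : ℂ) * ψ x)) atTop
        (𝓝 (complexIntegral (Sig ψ) fun x => (L x : ℂ) * ψ x)) := by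
      have := fun N => isFiniteMeasure_variation (SigN N ψ)
      have := isFiniteMeasure_variation (Sig ψ)
      exact tendsto_of_equiLipschitz
        (fun k => complexFunctional (SigN (ns (ms k)) ψ) (i := Subtype.val)
          measurable_subtype_coe ψ) _
        (fun k => norm_complexFunctional_le (SigN (ns (ms k)) ψ) measurable_subtype_coe ψ)
        (complexFunctional (Sig ψ) (i := id) measurable_id ψ) _
        (norm_complexFunctional_le (Sig ψ) measurable_id ψ)
        (fun φ => ((h_discr ψ hψ).2 (mulBCF φ ψ)).comp hsub)
        (fun k => (hG'K (ns (ms k))).toBCF (hG'B _)) (hLK.toBCF hLB)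
        (fun k => hG'K _) hLK (fun k => hG'B _) hL
    have t2 := tendsto_measureFunctional h_weak ψ hsub
      (F := fun k => (hG'K (ns (ms k))).toBCF (hG'B _)) (F' := hLK.toBCF hLB)
      (fun k => hG'K _) hLK (fun k => hG'B _) hL
    have t3 := tendsto_measureFunctional h_weak ψ hsub
      (F := fun k => (hFK (ns (ms k))).toBCF (hFM _)) (F' := hFK'.toBCF hFM')
      (fun k => hFK _) hFK' (fun k => hFM _) (fun x => (hFlim x).comp hsub)
    exact tendsto_nhds_unique ((t1.neg.add (t2.const_mul (l : ℂ))).congr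
      fun k => hident (ns (ms k))) t3
  refine ⟨max (C * K) KR, max B MR, G', R, fun N => (hG'K N).weaken (le_max_left _ _),
    hRK.weaken (le_max_right _ _), fun N x => (hG'B N x).trans (le_max_left _ _),
    fun x => (hRM x).trans (le_max_right _ _), hlim, fun N => ?_, ?_⟩
  · simp only [hG'eq]
    -- `V N` agrees with `F N` only almost everywhere; invariance ensures that the resolvents do not
    -- notice the difference.
    exact (hGae N).trans ((hmN N).markovResolvent_congr (huN N) (hfb N) (hVm N) (hFV N) hl)
  · exact hRae.trans (hm.markovResolvent_congr hu (hFK'.bddMeasurable hFM') hVm' hFV' hl)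

/-- The moments of occupation integrals of bounded Lipschitz functions converge. -/
theorem convergesEquiLipschitz_occupationMoment
    (hu : IsMarkovProcess P u) (hm : IsInvariantFor P u m) (huN : ∀ N, IsMarkovProcess (PN N) (uN N))
    (hmN : ∀ N, IsInvariantFor (PN N) (uN N) (mN N))
    (h_charac : CharacterizesLimit P u m 𝒞 Sig)
    (h_weak : ∀ φ : E →ᵇ ℝ,
      Tendsto (fun N => ∫ x : EN N, φ (x : E) ∂(mN N)) atTop (𝓝 (∫ x, φ x ∂m)))
    (h_equi : ResolventEquicontinuity PN uN mN)
    (h_discr : DiscreteCharacterization PN uN mN 𝒞 SigN Sig)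
    {ι : Type*} [DecidableEq ι] {lam : ι → ℝ} (hlam : ∀ i, 0 < lam i) {h : ι → E → ℝ}
    (hh : ∀ i, BddLipschitz (h i)) (I : Finset ι) :
    ConvergesEquiLipschitz mN m
      (fun N => occupationMoment (PN N) (uN N) lam (fun i x => h i x) I)
      (occupationMoment P u lam h I) := by
  have hb : ∀ i, BddMeasurable (h i) := fun i => by
    obtain ⟨⟨K, hK⟩, M, hM⟩ := hh i
    exact hK.bddMeasurable hM
  have hbN : ∀ N i, BddMeasurable fun x : EN N => h i x := fun N i =>
    (hb i).comp measurable_subtype_coe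
  induction I using Finset.strongInduction with
  | H I ih =>
  rcases I.eq_empty_or_nonempty with rfl | hI
  · have h1 : occupationMoment P u lam h ∅ = fun _ => 1 :=
      funext fun x => IsMarkovProcess.occupationMoment_empty x
    have h2 : ∀ N, occupationMoment (PN N) (uN N) lam (fun i x => h i x) ∅ = fun _ => 1 :=
      fun N => funext fun x => IsMarkovProcess.occupationMoment_empty x
    simp only [h1, h2]
    exact ConvergesEquiLipschitz.const 1
  · have h1 := funext ((hu.integral_mul_occupationProd hlam hb I).2 hI)
    have h2 := fun N => funext (((huN N).integral_mul_occupationProd hlam (hbN N) I).2 hI)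
    simp only [h1, h2]
    have hsum : ConvergesEquiLipschitz mN m
        (fun N x => ∑ i ∈ I, h i x * occupationMoment (PN N) (uN N) lam (fun i x => h i x)
          (I.erase i) x)
        fun x => ∑ i ∈ I, h i x * occupationMoment P u lam h (I.erase i) x := by
      refine ConvergesEquiLipschitz.finset_sum I
        (V := fun i N x => h i x * occupationMoment (PN N) (uN N) lam (fun i x => h i x)
          (I.erase i) x)
        (V' := fun i x => h i x * occupationMoment P u lam h (I.erase i) x) fun i hi => ?_
      obtain ⟨⟨K, hK⟩, M, hM⟩ := hh i
      exact (ConvergesEquiLipschitz.of_lipschitz hK hM).mul (ih _ (Finset.erase_ssubset hi))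
    have hsN : ∀ N, BddMeasurable fun x : EN N => ∑ i ∈ I,
        h i x * occupationMoment (PN N) (uN N) lam (fun i x => h i x) (I.erase i) x := fun N =>
      .finset_sum _ fun i _ => (hbN N i).mul
        ((huN N).bddMeasurable_occupationMoment hlam (hbN N) _)
    have hs : BddMeasurable fun x => ∑ i ∈ I, h i x * occupationMoment P u lam h (I.erase i) x :=
      .finset_sum _ fun i _ => (hb i).mul (hu.bddMeasurable_occupationMoment hlam hb _)
    exact ConvergesEquiLipschitz.markovResolvent hu hm huN hmN h_charac h_weak h_equi h_discr
      hsN hs hsum (Finset.sum_pos (fun i _ => hlam i) hI)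

end ResolventConvergence

/-! ### From Lipschitz functions to continuous functions -/

/-- Lipschitz regularization of a function from below. -/
noncomputable def lipschitzRegularization {E : Type*} [PseudoMetricSpace E] (g : E → ℝ) (k : ℝ≥0)
    (x : E) : ℝ := ⨅ y, (g y + k * dist x y)

section Regularization

variable {E : Type*} [PseudoMetricSpace E] {g : E → ℝ}

theorem bddBelow_lipschitzRegularization (h0 : ∀ x, 0 ≤ g x) (k : ℝ≥0) (x : E) :
    BddBelow (range fun y => g y + k * dist x y) :=
  ⟨0, by rintro _ ⟨y, rfl⟩; exact add_nonneg (h0 y) (mul_nonneg k.2 dist_nonneg)⟩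

theorem lipschitzRegularization_nonneg (h0 : ∀ x, 0 ≤ g x) (k : ℝ≥0) (x : E) :
    0 ≤ lipschitzRegularization g k x :=
  Real.iInf_nonneg fun y => add_nonneg (h0 y) (mul_nonneg k.2 dist_nonneg)

theorem lipschitzRegularization_le (h0 : ∀ x, 0 ≤ g x) (k : ℝ≥0) (x : E) :
    lipschitzRegularization g k x ≤ g x := by
  simpa [lipschitzRegularization] using ciInf_le (bddBelow_lipschitzRegularization h0 k x) x

theorem lipschitzWith_lipschitzRegularization (h0 : ∀ x, 0 ≤ g x) (k : ℝ≥0) :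
    LipschitzWith k (lipschitzRegularization g k) := by
  refine LipschitzWith.of_le_add_mul k fun x y => ?_
  have : Nonempty E := ⟨x⟩
  rw [← sub_le_iff_le_add]
  refine le_ciInf fun z => ?_
  have h1 := ciInf_le (bddBelow_lipschitzRegularization h0 k x) z
  have h2 : (k : ℝ) * dist x z ≤ k * (dist x y + dist y z) :=
    mul_le_mul_of_nonneg_left (dist_triangle _ _ _) k.2
  change (⨅ y, (g y + k * dist x y)) - k * dist x y ≤ _
  linarith

/-- In the infimum, points near `x` have values close to `g x` by continuity, and points at distance
at least `δ` pay a penalty of at least `k δ ≥ 1 ≥ g x` once `k ≥ 1 / δ`. -/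
theorem tendsto_lipschitzRegularization (hg : Continuous g) (h0 : ∀ x, 0 ≤ g x)
    (h1 : ∀ x, g x ≤ 1) (x : E) :
    Tendsto (fun k : ℕ => lipschitzRegularization g k x) atTop (𝓝 (g x)) := by
  have : Nonempty E := ⟨x⟩
  rw [Metric.tendsto_atTop]
  intro ε hε
  obtain ⟨δ, hδ, hδg⟩ := Metric.continuous_iff.1 hg x (ε / 2) (by linarith)
  obtain ⟨k0, hk0⟩ := exists_nat_ge (1 / δ)
  refine ⟨k0, fun k hk => ?_⟩
  have hle := lipschitzRegularization_le h0 k x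
  have hge : g x - ε / 2 ≤ lipschitzRegularization g k x := by
    refine le_ciInf fun y => ?_
    rcases lt_or_ge (dist y x) δ with hy | hy
    · have := hδg y hy
      rw [Real.dist_eq, abs_lt] at this
      have h2 : (0 : ℝ) ≤ ((k : ℝ≥0) : ℝ) * dist x y := mul_nonneg (NNReal.coe_nonneg _) dist_nonneg
      linarith [this.1]
    · have h2 : (1 : ℝ) ≤ k * dist x y := by
        rw [dist_comm]
        calc (1 : ℝ) = 1 / δ * δ := by field_simp
          _ ≤ k * dist y x := mul_le_mul (hk0.trans (by exact_mod_cast hk)) hy hδ.le (by positivity)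
      have h3 := h0 y
      have h4 := h1 x
      push_cast
      linarith
  rw [Real.dist_eq, abs_lt]
  constructor <;> linarith

/-- Replace the factors one at a time; the untouched ones are bounded by `1`. -/
theorem abs_prod_sub_prod_le_sum {ι : Type*} (I : Finset ι) {a b : ι → ℝ} (ha : ∀ i, |a i| ≤ 1)
    (hb : ∀ i, |b i| ≤ 1) : |∏ i ∈ I, a i - ∏ i ∈ I, b i| ≤ ∑ i ∈ I, |a i - b i| := by
  classical
  induction I using Finset.induction_on with
  | empty => simp
  | insert i I hi ih =>
    rw [Finset.prod_insert hi, Finset.prod_insert hi, Finset.sum_insert hi]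
    have hpb : |∏ i ∈ I, b i| ≤ 1 := by
      rw [Finset.abs_prod]
      exact Finset.prod_le_one (fun i _ => abs_nonneg _) fun i _ => hb i
    calc |a i * ∏ i ∈ I, a i - b i * ∏ i ∈ I, b i|
        = |(a i - b i) * ∏ i ∈ I, b i + a i * (∏ i ∈ I, a i - ∏ i ∈ I, b i)| := by ring_nf
      _ ≤ |a i - b i| * |∏ i ∈ I, b i| + |a i| * |∏ i ∈ I, a i - ∏ i ∈ I, b i| := by
          rw [← abs_mul, ← abs_mul]; exact abs_add_le _ _
      _ ≤ |a i - b i| * 1 + 1 * |∏ i ∈ I, a i - ∏ i ∈ I, b i| := by gcongr; exact ha i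
      _ ≤ _ := by linarith

end Regularization

/-! ### Stability of stationary moments in `L¹` -/

section MomentStability

variable {S Ω : Type*} [MeasurableSpace S] [MeasurableSpace Ω] {P : Kernel S Ω}
  [IsMarkovKernel P] {X : ℝ≥0 → Ω → S} {m : Measure S} [IsProbabilityMeasure m]
  {ι : Type*} {lam : ι → ℝ} {g h : ι → S → ℝ}

theorem IsMarkovProcess.integral_occupationMoment (hX : IsMarkovProcess P X)
    (hlam : ∀ i, 0 < lam i) (hh : ∀ i, BddMeasurable (h i)) (I : Finset ι) :
    ∫ x, occupationMoment P X lam h I x ∂m = ∫ ω, occupationProd X lam h I 0 ω ∂(m.bind P) :=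
  (((hX.bddMeasurable_occupationProd hlam hh I).comp measurable_prodMk_left).integral_bind P m).symm

/-- The stationary moments of occupation integrals depend continuously on the functions, in
`L¹`. -/
theorem IsInvariantFor.abs_integral_occupationMoment_sub_le (hX : IsMarkovProcess P X)
    (hm : IsInvariantFor P X m) (hlam : ∀ i, 1 ≤ lam i) (hg : ∀ i, Measurable (g i))
    (hg1 : ∀ i x, |g i x| ≤ 1) (hh : ∀ i, Measurable (h i)) (hh1 : ∀ i x, |h i x| ≤ 1)
    (I : Finset ι) :
    |∫ x, occupationMoment P X lam g I x ∂m - ∫ x, occupationMoment P X lam h I x ∂m|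
      ≤ ∑ i ∈ I, ∫ x, |g i x - h i x| ∂m := by
  have hpos : ∀ i, 0 < lam i := fun i => zero_lt_one.trans_le (hlam i)
  have hgb : ∀ i, BddMeasurable (g i) := fun i => ⟨hg i, 1, hg1 i⟩
  have hhb : ∀ i, BddMeasurable (h i) := fun i => ⟨hh i, 1, hh1 i⟩
  have := fun i => isFiniteMeasure_expWeightMeasure (hpos i)
  -- Rates `lam i ≥ 1` give weights of mass at most `1`, so each occupation integral is bounded by
  -- `1` and differences of products are controlled by sums of differences.
  have hmass : ∀ i, (expWeightMeasure (lam i)).real univ ≤ 1 := fun i => by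
    rw [expWeightMeasure_real_univ (hpos i), div_le_one (hpos i)]
    exact hlam i
  have hprob : IsProbabilityMeasure (m.bind P) := inferInstance
  have hjoint : ∀ {f : S → ℝ}, BddMeasurable f → BddMeasurable fun z : Ω × ℝ≥0 => f (X z.2 z.1) :=
    fun hf => hf.comp (hX.measurable.comp measurable_swap)
  have hL : ∀ {f : S → ℝ}, (∀ x, |f x| ≤ 1) → ∀ i ω,
      |futureIntegral (lam i) (fun s => f (X s ω)) 0| ≤ 1 := fun hf i ω =>
    (BddMeasurable.abs_integral_le (fun s => hf _) _).trans (by rw [one_mul]; exact hmass i)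
  have hLm : ∀ i {f : S → ℝ}, BddMeasurable f →
      BddMeasurable fun ω => futureIntegral (lam i) (fun s => f (X s ω)) 0 := fun i f hf => by
    simp only [futureIntegral, zero_add]
    exact (hjoint hf).integral_right _
  rw [hX.integral_occupationMoment hpos hgb, hX.integral_occupationMoment hpos hhb]
  have hPm : ∀ {f : ι → S → ℝ}, (∀ i, BddMeasurable (f i)) →
      BddMeasurable fun ω => occupationProd X lam f I 0 ω := fun hf =>
    (hX.bddMeasurable_occupationProd hpos hf I).comp measurable_prodMk_left
  rw [← integral_sub ((hPm hgb).integrable _) ((hPm hhb).integrable _)]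
  have hdiff : ∀ i, BddMeasurable fun ω => |futureIntegral (lam i) (fun s => g i (X s ω)) 0
      - futureIntegral (lam i) (fun s => h i (X s ω)) 0| := fun i =>
    ((hLm i (hgb i)).sub (hLm i (hhb i))).abs
  calc _ ≤ ∫ ω, |occupationProd X lam g I 0 ω - occupationProd X lam h I 0 ω| ∂(m.bind P) :=
        abs_integral_le_integral_abs
    _ ≤ ∫ ω, ∑ i ∈ I, |futureIntegral (lam i) (fun s => g i (X s ω)) 0
          - futureIntegral (lam i) (fun s => h i (X s ω)) 0| ∂(m.bind P) :=
        integral_mono (((hPm hgb).sub (hPm hhb)).abs.integrable _)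
          ((BddMeasurable.finset_sum I fun i _ => hdiff i).integrable _) fun ω =>
            abs_prod_sub_prod_le_sum I (fun i => hL (hg1 i) i ω) (fun i => hL (hh1 i) i ω)
    _ = ∑ i ∈ I, ∫ ω, |futureIntegral (lam i) (fun s => g i (X s ω)) 0
          - futureIntegral (lam i) (fun s => h i (X s ω)) 0| ∂(m.bind P) :=
        integral_finsetSum _ fun i _ => (hdiff i).integrable _
    _ ≤ _ := Finset.sum_le_sum fun i _ => ?_
  have hd := ((hgb i).sub (hhb i)).abs
  calc _ ≤ ∫ ω, ∫ s, |g i (X s ω) - h i (X s ω)| ∂(expWeightMeasure (lam i)) ∂(m.bind P) := by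
        refine integral_mono ((hdiff i).integrable _)
          (((hjoint hd).integral_right _).integrable _) fun ω => ?_
        simp only [futureIntegral, zero_add]
        rw [← integral_sub ((hX.bddMeasurable_path (hgb i) ω).integrable _)
          ((hX.bddMeasurable_path (hhb i) ω).integrable _)]
        exact abs_integral_le_integral_abs
    -- Under the stationary law each `X s` has law `m`.
    _ = ∫ _, ∫ x, |g i x - h i x| ∂m ∂(expWeightMeasure (lam i)) := by
        rw [(hjoint hd).integral_integral_swap]
        exact integral_congr_ae (Eventually.of_forall fun s => hm.integral_integral hX hd s)
    _ ≤ _ := by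
        rw [integral_const, smul_eq_mul]
        exact mul_le_of_le_one_left (integral_nonneg fun x => abs_nonneg _) (hmass i)

end MomentStability

/-! ### Convergence of moments for merely continuous functions -/

section ContinuousMoments

variable {E : Type*} [MetricSpace E] [TopologicalSpace.SeparableSpace E] [MeasurableSpace E]
  [BorelSpace E] {EN : ℕ → Set E} {mN : ∀ N, Measure (EN N)} [∀ N, IsProbabilityMeasure (mN N)]
  {m : Measure E} [IsProbabilityMeasure m]
  {Ω : Type*} [MeasurableSpace Ω] {P : Kernel E Ω} [IsMarkovKernel P] {u : ℝ≥0 → Ω → E}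
  {ΩN : ℕ → Type*} [∀ N, MeasurableSpace (ΩN N)] {PN : ∀ N, Kernel (EN N) (ΩN N)}
  [∀ N, IsMarkovKernel (PN N)] {uN : ∀ N, ℝ≥0 → ΩN N → EN N} [∀ N, (mN N).IsOpenPosMeasure]
  {𝒞 : Set (E →ᵇ ℂ)} {Sig : (E →ᵇ ℂ) → ComplexMeasure E}
  {SigN : ∀ N, (E →ᵇ ℂ) → ComplexMeasure (EN N)}

/-- The stationary moments of occupation integrals of continuous functions converge. -/
theorem tendsto_integral_occupationProd
    (hu : IsMarkovProcess P u) (hm : IsInvariantFor P u m) (huN : ∀ N, IsMarkovProcess (PN N) (uN N))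
    (hmN : ∀ N, IsInvariantFor (PN N) (uN N) (mN N))
    (h_charac : CharacterizesLimit P u m 𝒞 Sig)
    (h_weak : ∀ φ : E →ᵇ ℝ,
      Tendsto (fun N => ∫ x : EN N, φ (x : E) ∂(mN N)) atTop (𝓝 (∫ x, φ x ∂m)))
    (h_equi : ResolventEquicontinuity PN uN mN)
    (h_discr : DiscreteCharacterization PN uN mN 𝒞 SigN Sig)
    {ι : Type*} {lam : ι → ℝ} (hlam : ∀ i, 1 ≤ lam i) {g : ι → E → ℝ}
    (hg : ∀ i, Continuous (g i)) (hg0 : ∀ i x, 0 ≤ g i x) (hg1 : ∀ i x, g i x ≤ 1)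
    (I : Finset ι) :
    Tendsto (fun N => ∫ ω, occupationProd (uN N) lam (fun i x => g i x) I 0 ω ∂((mN N).bind (PN N)))
      atTop (𝓝 (∫ ω, occupationProd u lam g I 0 ω ∂(m.bind P))) := by
  classical
  have hpos : ∀ i, 0 < lam i := fun i => zero_lt_one.trans_le (hlam i)
  let h : ℕ → ι → E → ℝ := fun k i => lipschitzRegularization (g i) k
  have hh0 : ∀ k i x, 0 ≤ h k i x := fun k i x => lipschitzRegularization_nonneg (hg0 i) _ x
  have hhg : ∀ k i x, h k i x ≤ g i x := fun k i x => lipschitzRegularization_le (hg0 i) _ x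
  have hhL : ∀ (k : ℕ) i, LipschitzWith (k : ℝ≥0) (h k i) := fun k i =>
    lipschitzWith_lipschitzRegularization (hg0 i) _
  have hga : ∀ i x, |g i x| ≤ 1 := fun i x => abs_le.2 ⟨by linarith [hg0 i x], hg1 i x⟩
  have hha : ∀ k i x, |h k i x| ≤ 1 := fun k i x =>
    abs_le.2 ⟨by linarith [hh0 k i x], (hhg k i x).trans (hg1 i x)⟩
  have hgm : ∀ i, Measurable (g i) := fun i => (hg i).measurable
  have hhm : ∀ k i, Measurable (h k i) := fun k i => (hhL k i).continuous.measurable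
  have hgb : ∀ i, BddMeasurable (g i) := fun i => ⟨hgm i, 1, hga i⟩
  let A : ℕ → ℝ := fun N => ∫ x, occupationMoment (PN N) (uN N) lam (fun i x => g i x) I x ∂(mN N)
  let A' : ℝ := ∫ x, occupationMoment P u lam g I x ∂m
  let B : ℕ → ℕ → ℝ := fun k N =>
    ∫ x, occupationMoment (PN N) (uN N) lam (fun i x => h k i x) I x ∂(mN N)
  let B' : ℕ → ℝ := fun k => ∫ x, occupationMoment P u lam (h k) I x ∂m
  let e : ℕ → ℕ → ℝ := fun k N => ∑ i ∈ I, ∫ x : EN N, |g i x - h k i x| ∂(mN N)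
  let e' : ℕ → ℝ := fun k => ∑ i ∈ I, ∫ x, |g i x - h k i x| ∂m
  have hA : A = fun N => ∫ ω, occupationProd (uN N) lam (fun i x => g i x) I 0 ω
      ∂((mN N).bind (PN N)) := funext fun N => (huN N).integral_occupationMoment hpos
    (fun i => (hgb i).comp measurable_subtype_coe) I
  have hA' : A' = ∫ ω, occupationProd u lam g I 0 ω ∂(m.bind P) :=
    hu.integral_occupationMoment hpos hgb I
  rw [← hA, ← hA']
  have hB : ∀ k, Tendsto (B k) atTop (𝓝 (B' k)) := fun k =>
    (convergesEquiLipschitz_occupationMoment hu hm huN hmN h_charac h_weak h_equi h_discr hpos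
      (fun i => ⟨⟨_, hhL k i⟩, 1, hha k i⟩) I).tendsto_integral h_weak
  have hAB : ∀ k N, |A N - B k N| ≤ e k N := fun k N =>
    (hmN N).abs_integral_occupationMoment_sub_le (huN N) hlam
      (fun i => (hgm i).comp measurable_subtype_coe) (fun i x => hga i x)
      (fun i => (hhm k i).comp measurable_subtype_coe) (fun i x => hha k i x) I
  have hAB' : ∀ k, |A' - B' k| ≤ e' k := fun k =>
    hm.abs_integral_occupationMoment_sub_le hu hlam hgm hga (hhm k) (hha k) I
  -- For fixed `k` the error function is bounded and continuous, so weak convergence carries its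
  -- smallness under `m` over to `mN N` for all large `N`. This replaces a uniform approximation of
  -- `g i`, which need not exist.
  have hee : ∀ k, Tendsto (e k) atTop (𝓝 (e' k)) := fun k =>
    tendsto_finsetSum _ fun i _ => h_weak (BoundedContinuousFunction.ofNormedAddCommGroup
      (fun x => |g i x - h k i x|) ((hg i).sub (hhL k i).continuous).abs 2 fun x => by
        rw [Real.norm_eq_abs, abs_abs]
        exact (abs_sub _ _).trans (by linarith [hga i x, hha k i x]))
  have he' : Tendsto e' atTop (𝓝 0) := by
    have : Tendsto e' atTop (𝓝 (∑ i ∈ I, ∫ _ : E, (0 : ℝ) ∂m)) := by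
      refine tendsto_finsetSum _ fun i _ => tendsto_integral_of_dominated_convergence (fun _ => 2)
        (fun k => ((hgm i).sub (hhm k i)).abs.aestronglyMeasurable) (integrable_const _)
        (fun k => Eventually.of_forall fun x => ?_) (Eventually.of_forall fun x => ?_)
      · rw [Real.norm_eq_abs, abs_abs]
        exact (abs_sub _ _).trans (by linarith [hga i x, hha k i x])
      · simpa using ((tendsto_lipschitzRegularization (hg i) (hg0 i) (hg1 i) x).const_sub
          (g i x)).abs
    simpa using this
  rw [Metric.tendsto_atTop]
  intro ε hε
  obtain ⟨k, hk⟩ := (he'.eventually_lt_const (show 0 < ε / 4 by linarith)).exists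
  obtain ⟨N0, hN0⟩ := eventually_atTop.1 (((hee k).eventually_lt_const hk).and
    ((hB k).eventually (Metric.ball_mem_nhds _ (show 0 < ε / 4 by linarith))))
  refine ⟨N0, fun N hN => ?_⟩
  obtain ⟨h1, h2⟩ := hN0 N hN
  have h2' : |B k N - B' k| < ε / 4 := h2
  have h3 := hAB k N
  have h4 := hAB' k
  rw [abs_sub_comm] at h4
  calc dist (A N) A' = |(A N - B k N) + (B k N - B' k) + (B' k - A')| := by
        rw [Real.dist_eq]; ring_nf
    _ ≤ |A N - B k N| + |B k N - B' k| + |B' k - A'| := abs_add_three _ _ _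
    _ < ε := by linarith

end ContinuousMoments

/-! ### The Skorokhod topology is pseudometrizable -/

namespace SkorokhodSpace

section Uniformity

variable {S : Type*} [PseudoMetricSpace S]

theorem mem_nbhd_self (x : SkorokhodSpace S) (T : ℝ≥0) {ε : ℝ} (hε : 0 < ε) : x ∈ nbhd x T ε :=
  ⟨OrderIso.refl _, fun t _ => by simpa using hε⟩

/-- Compose the time changes. The one between `y` and `z` moves points of `[0, T]` by less than `1`,
hence the horizon `T + 1` for the other. -/
theorem mem_nbhd_trans {x y z : SkorokhodSpace S} {T : ℝ≥0} {ε : ℝ}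
    (hy : y ∈ nbhd x (T + 1) (ε / 2)) (hz : z ∈ nbhd y T (min 1 (ε / 2))) : z ∈ nbhd x T ε := by
  obtain ⟨τ, hτ⟩ := hy
  obtain ⟨σ, hσ⟩ := hz
  refine ⟨σ.trans τ, fun t ht => ?_⟩
  obtain ⟨h1, h2⟩ := hσ t ht
  have h3 : σ t ≤ T + 1 := by
    have h4 : ((σ t : ℝ≥0) : ℝ) - t < 1 :=
      ((le_abs_self _).trans_eq (NNReal.dist_eq _ _).symm).trans_lt (h1.trans_le (min_le_left _ _))
    have h5 : (t : ℝ) ≤ T := ht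
    rw [← NNReal.coe_le_coe]
    push_cast
    linarith
  obtain ⟨h4, h5⟩ := hτ _ h3
  have h6 := h1.trans_le (min_le_right _ _)
  have h7 := h2.trans_le (min_le_right _ _)
  exact ⟨(dist_triangle _ (σ t) _).trans_lt (by simpa using add_lt_add h4 h6),
    (dist_triangle _ (y.1 (σ t)) _).trans_lt (by simpa using add_lt_add h7 h5)⟩

/-- Invert the time change: it moves `T + 1` by less than `1`, so its inverse maps `[0, T]` into
`[0, T + 1]`, where the estimates are available. -/
theorem mem_nbhd_symm {x y : SkorokhodSpace S} {T : ℝ≥0} {ε : ℝ} (hε : ε ≤ 1)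
    (hy : y ∈ nbhd x (T + 1) ε) : x ∈ nbhd y T ε := by
  obtain ⟨τ, hτ⟩ := hy
  refine ⟨τ.symm, fun s hs => ?_⟩
  have h1 : T ≤ τ (T + 1) := by
    have h2 := (hτ (T + 1) le_rfl).1
    rw [NNReal.dist_eq, abs_lt] at h2
    have h3 := h2.1
    rw [← NNReal.coe_le_coe]
    push_cast at h3
    linarith
  have h2 : τ.symm s ≤ T + 1 := by
    rw [OrderIso.symm_apply_le]
    exact hs.trans h1
  have h3 := hτ _ h2
  rw [OrderIso.apply_symm_apply] at h3
  exact ⟨by rw [dist_comm]; exact h3.1, by rw [dist_comm]; exact h3.2⟩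

/-- The topology is given by its open sets, so this is not automatic. The points that have a basic
set inside `nbhd x T ε` form an open set, thanks to `mem_nbhd_trans`. -/
theorem nbhd_mem_nhds (x : SkorokhodSpace S) (T : ℝ≥0) {ε : ℝ} (hε : 0 < ε) :
    nbhd x T ε ∈ 𝓝 x := by
  rw [mem_nhds_iff]
  refine ⟨{y | ∃ (T' : ℝ≥0) (ε' : ℝ), 0 < ε' ∧ nbhd y T' ε' ⊆ nbhd x T ε}, ?_, ?_,
    ⟨T, ε, hε, Subset.rfl⟩⟩
  · rintro y ⟨T', ε', hε', h⟩
    exact h (mem_nbhd_self y T' hε')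
  · rintro y ⟨T', ε', hε', h⟩
    exact ⟨T' + 1, ε' / 2, half_pos hε', fun z hz => ⟨T', min 1 (ε' / 2),
      lt_min one_pos (half_pos hε'), fun w hw => h (mem_nbhd_trans hz hw)⟩⟩

/-- A decreasing sequence of entourages that generates the uniformity. -/
def entourage (n : ℕ) : Set (SkorokhodSpace S × SkorokhodSpace S) :=
  {p | p.2 ∈ nbhd p.1 n (1 / (n + 1))}

theorem entourage_antitone : Antitone (entourage (S := S)) := fun n k h p hp =>
  nbhd_mono p.1 (by exact_mod_cast h) (one_div_le_one_div_of_le (by positivity)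
    (by exact_mod_cast Nat.succ_le_succ h)) hp

theorem hasBasis_entourage :
    (⨅ n, 𝓟 (entourage (S := S) n)).HasBasis (fun _ : ℕ => True) entourage :=
  hasBasis_iInf_principal entourage_antitone.directed_ge

theorem hasBasis_nhds (x : SkorokhodSpace S) :
    (𝓝 x).HasBasis (fun _ : ℕ => True) fun n => nbhd x n (1 / (n + 1)) := by
  refine ⟨fun U => ⟨fun hU => ?_, fun ⟨n, _, hn⟩ => ?_⟩⟩
  · obtain ⟨V, hVU, hV, hx⟩ := mem_nhds_iff.1 hU
    obtain ⟨T, ε, hε, h⟩ := hV x hx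
    obtain ⟨n1, hn1⟩ := exists_nat_ge T
    obtain ⟨n2, hn2⟩ := exists_nat_one_div_lt hε
    refine ⟨max n1 n2, trivial, (nbhd_mono x ?_ ?_).trans (h.trans hVU)⟩
    · exact hn1.trans (by exact_mod_cast le_max_left _ _)
    · exact (one_div_le_one_div_of_le (by positivity)
        (by exact_mod_cast Nat.succ_le_succ (le_max_right n1 n2))).trans hn2.le
  · exact mem_of_superset (nbhd_mem_nhds x n (by positivity)) hn

/-- The uniform structure of the Skorokhod space. -/
abbrev uniformSpace : UniformSpace (SkorokhodSpace S) where
  uniformity := ⨅ n, 𝓟 (entourage (S := S) n)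
  nhds_eq_comap_uniformity x :=
    (hasBasis_nhds x).eq_of_same_basis (hasBasis_entourage.comap (Prod.mk x))
  symm := by
    refine (hasBasis_entourage.tendsto_iff hasBasis_entourage).2 fun n _ => ⟨n + 1, trivial, ?_⟩
    rintro ⟨x, y⟩ h
    have h1 : (1 : ℝ) / ((n + 1 : ℕ) + 1) ≤ 1 := by
      rw [div_le_one (by positivity)]
      linarith [(Nat.cast_nonneg (n + 1) : (0 : ℝ) ≤ _)]
    have h' : y ∈ nbhd x ((n : ℝ≥0) + 1) (1 / ((n + 1 : ℕ) + 1)) := by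
      simpa [entourage] using h
    refine nbhd_mono y le_rfl ?_ (mem_nbhd_symm h1 h')
    exact one_div_le_one_div_of_le (by positivity) (by push_cast; linarith)
  comp := by
    -- The index `2 n + 1` makes the radius half of `1 / (n + 1)` and the horizon at least `n + 1`.
    refine (hasBasis_entourage.lift' (monotone_id.relComp monotone_id)).le_basis_iff
      hasBasis_entourage |>.2 fun n _ => ⟨2 * n + 1, trivial, ?_⟩
    rintro ⟨x, z⟩ ⟨y, h1, h2⟩
    have hle : (1 : ℝ) / ((2 * n + 1 : ℕ) + 1) ≤ 1 / (n + 1) / 2 := by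
      rw [div_div]
      exact one_div_le_one_div_of_le (by positivity) (by push_cast; linarith)
    refine mem_nbhd_trans (y := y) (nbhd_mono x ?_ hle h1) (nbhd_mono y ?_ (le_min ?_ hle) h2)
    · norm_cast; omega
    · norm_cast; omega
    · rw [div_le_one (by positivity)]
      linarith [(Nat.cast_nonneg (2 * n + 1) : (0 : ℝ) ≤ _)]

instance : TopologicalSpace.PseudoMetrizableSpace (SkorokhodSpace S) := by
  have h : (⨅ n, 𝓟 (entourage (S := S) n)).IsCountablyGenerated :=
    hasBasis_entourage.isCountablyGenerated
  exact @UniformSpace.pseudoMetrizableSpace _ uniformSpace h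

end Uniformity

end SkorokhodSpace

/-! ### Oscillations of càdlàg paths -/

section Oscillation

variable {S : Type*} [PseudoMetricSpace S]

/-- The interval `[0, T)` has a finite partition into intervals `[a, b)` on which the oscillation of
`x` is less than `ε`. -/
inductive HasOscPartition (x : ℝ≥0 → S) (ε : ℝ) : ℝ≥0 → Prop
  | zero : HasOscPartition x ε 0
  | step {a b : ℝ≥0} : HasOscPartition x ε a → a < b →
      (∀ s ∈ Ico a b, ∀ t ∈ Ico a b, dist (x s) (x t) < ε) → HasOscPartition x ε b

theorem IsCadlag.exists_hasOscPartition {x : ℝ≥0 → S} (hx : IsCadlag x) {ε : ℝ} (hε : 0 < ε)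
    (T : ℝ≥0) : ∃ T', T < T' ∧ HasOscPartition x ε T' := by
  by_contra! hcon
  have hub : ∀ T', HasOscPartition x ε T' → T' ≤ T := fun T' h => by
    by_contra h'
    exact hcon T' (not_le.1 h') h
  let A : Set ℝ≥0 := {T' | HasOscPartition x ε T'}
  have hA0 : (0 : ℝ≥0) ∈ A := .zero
  have hAb : BddAbove A := ⟨T, hub⟩
  have hosc : ∀ {z : S} {s t : ℝ≥0}, dist (x s) z < ε / 2 → dist (x t) z < ε / 2 →
      dist (x s) (x t) < ε := fun h1 h2 =>
    (dist_triangle_right _ _ _).trans_lt (by linarith)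
  have hc : HasOscPartition x ε (sSup A) := by
    rcases eq_or_ne (sSup A) 0 with h0 | h0
    · rw [h0]
      exact .zero
    obtain ⟨l, hl⟩ := (hx (sSup A)).2
    have h1 := hl.eventually (Metric.ball_mem_nhds l (half_pos hε))
    obtain ⟨c', hc', hsub⟩ := (mem_nhdsLT_iff_exists_Ioo_subset' (pos_iff_ne_zero.2 h0)).1 h1
    obtain ⟨a, ha, hca⟩ := exists_lt_of_lt_csSup ⟨0, hA0⟩ hc'
    rcases (le_csSup hAb ha).eq_or_lt with h | h
    · rw [← h]
      exact ha
    · exact .step ha h fun s hs t ht => hosc (hsub ⟨hca.trans_le hs.1, hs.2⟩)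
        (hsub ⟨hca.trans_le ht.1, ht.2⟩)
  have h1 := (hx (sSup A)).1.eventually (Metric.ball_mem_nhds _ (half_pos hε))
  obtain ⟨d, hd, hsub⟩ := mem_nhdsGE_iff_exists_Ico_subset.1 h1
  exact (le_csSup hAb (HasOscPartition.step hc hd
    fun s hs t ht => hosc (hsub hs) (hsub ht))).not_gt hd

/-- In the interior of a partition interval the oscillation is below `ε`, so only the left endpoints
remain. -/
theorem HasOscPartition.finite {x : ℝ≥0 → S} {ε : ℝ} {T : ℝ≥0} (h : HasOscPartition x ε T) :
    {t | t < T ∧ ¬ ∀ᶠ s in 𝓝 t, dist (x s) (x t) < ε}.Finite := by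
  induction h with
  | zero => simp
  | @step a b _ hab hosc ih =>
    refine (ih.union (finite_singleton a)).subset ?_
    rintro t ⟨htb, ht⟩
    rcases lt_trichotomy t a with h | h | h
    · exact Or.inl ⟨h, ht⟩
    · exact Or.inr h
    · refine absurd ?_ ht
      filter_upwards [Ioo_mem_nhds h htb] with s hs
      exact hosc s ⟨hs.1.le, hs.2⟩ t ⟨h.le, htb⟩

theorem IsCadlag.countable_not_continuousAt {x : ℝ≥0 → S} (hx : IsCadlag x) :
    {t | ¬ ContinuousAt x t}.Countable := by
  choose T hT hpart using fun (n k : ℕ) =>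
    hx.exists_hasOscPartition (show (0 : ℝ) < 1 / (n + 1) by positivity) (k : ℝ≥0)
  refine (countable_iUnion fun n => countable_iUnion fun k =>
    (hpart n k).finite.countable).mono fun t ht => ?_
  simp only [mem_iUnion]
  obtain ⟨k, hk⟩ := exists_nat_ge t
  by_contra! hcon
  refine ht (Metric.tendsto_nhds.2 fun ε hε => ?_)
  obtain ⟨n, hn⟩ := exists_nat_one_div_lt hε
  have := hcon n k
  rw [mem_ofPred, not_and, not_frequently] at this
  exact (this (hk.trans_lt (hT n k))).mono fun s hs => (not_le.1 hs).trans hn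

/-- Sampling at the first grid time strictly after `t` gives measurable functions with countably
many values; they converge by right continuity. -/
theorem IsCadlag.measurable [MeasurableSpace S] [BorelSpace S] {x : ℝ≥0 → S} (hx : IsCadlag x) :
    Measurable x := by
  let d : ℕ → ℝ≥0 → ℝ≥0 := fun n t => ((⌊((n : ℝ≥0) + 1) * t⌋₊ : ℝ≥0) + 1) / (n + 1)
  refine measurable_of_tendsto_metrizable (f := fun n t => x (d n t)) (fun n => ?_)
    (tendsto_pi_nhds.2 fun t => ?_)
  · exact (measurable_of_countable fun k : ℕ => x (((k : ℝ≥0) + 1) / (n + 1))).comp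
      (Nat.measurable_floor.comp (measurable_const.mul measurable_id))
  · have hge : ∀ n, t ≤ d n t := fun n => by
      rw [le_div_iff₀ (by positivity), mul_comm]
      exact (Nat.lt_floor_add_one _).le
    have hle : ∀ n, d n t ≤ t + 1 / (n + 1) := fun n => by
      rw [div_le_iff₀ (by positivity), add_mul t, one_div, inv_mul_cancel₀ (by positivity),
        mul_comm t]
      gcongr
      exact Nat.floor_le (by positivity)
    have hlim : Tendsto (fun n => d n t) atTop (𝓝 t) := by
      refine tendsto_of_tendsto_of_tendsto_of_le_of_le tendsto_const_nhds ?_ hge hle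
      have := (tendsto_one_div_add_atTop_nhds_zero_nat (𝕜 := ℝ≥0)).const_add t
      simpa using this
    exact (hx t).1.tendsto.comp (tendsto_nhdsWithin_iff.2 ⟨hlim, Eventually.of_forall hge⟩)

end Oscillation

/-! ### Time changes and discretization -/

section Discretization

/-- Two time changes, one after the other. -/
noncomputable def glueTimeChange (τ σ : ℝ≥0 ≃o ℝ≥0) (a : ℝ≥0) : ℝ≥0 ≃o ℝ≥0 :=
  StrictMono.orderIsoOfSurjective (fun t => if t ≤ a then τ t else τ a + σ (t - a))
    (by
      intro s t hst
      dsimp only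
      split_ifs with h1 h2 h2
      · exact τ.strictMono hst
      · exact (τ.monotone h1).trans_lt (lt_add_of_pos_right _
          ((zero_le).trans_lt (σ.strictMono (tsub_pos_of_lt (not_le.1 h2)))))
      · exact absurd (hst.le.trans h2) h1
      · exact add_lt_add_right (σ.strictMono
          (tsub_lt_tsub_right_of_le (not_le.1 h1).le hst)) _)
    (by
      intro y
      rcases le_or_gt y (τ a) with hy | hy
      · exact ⟨τ.symm y, by simp [(OrderIso.symm_apply_le τ).2 hy]⟩
      · have h1 : 0 < σ.symm (y - τ a) :=
          (zero_le).trans_lt (σ.symm.strictMono (tsub_pos_of_lt hy))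
        refine ⟨a + σ.symm (y - τ a), ?_⟩
        dsimp only
        rw [if_neg (not_le.2 (lt_add_of_pos_right _ h1)), add_tsub_cancel_left,
          OrderIso.apply_symm_apply, add_tsub_cancel_of_le hy.le])

theorem glueTimeChange_apply (τ σ : ℝ≥0 ≃o ℝ≥0) (a t : ℝ≥0) :
    glueTimeChange τ σ a t = if t ≤ a then τ t else τ a + σ (t - a) := rfl

variable {S : Type*} [PseudoMetricSpace S]

/-- The time `t`, rounded down to a multiple of `1 / (n + 1)`. -/
noncomputable def gridFloor (n : ℕ) (t : ℝ≥0) : ℝ≥0 := (⌊((n : ℝ≥0) + 1) * t⌋₊ : ℝ≥0) / (n + 1)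

/-- The time `t`, rounded up to a multiple of `1 / (n + 1)`. -/
noncomputable def gridCeil (n : ℕ) (t : ℝ≥0) : ℝ≥0 := (⌈((n : ℝ≥0) + 1) * t⌉₊ : ℝ≥0) / (n + 1)

theorem le_gridCeil (n : ℕ) (t : ℝ≥0) : t ≤ gridCeil n t := by
  rw [gridCeil, le_div_iff₀ (by positivity), mul_comm]
  exact Nat.le_ceil _

theorem gridCeil_le (n : ℕ) (t : ℝ≥0) : gridCeil n t ≤ t + 1 / (n + 1) := by
  rw [gridCeil, div_le_iff₀ (by positivity), add_mul t, one_div, inv_mul_cancel₀ (by positivity),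
    mul_comm t]
  exact (Nat.ceil_lt_add_one (by positivity)).le

theorem le_gridFloor {n : ℕ} {a t : ℝ≥0} (h : gridCeil n a ≤ t) : a ≤ gridFloor n t := by
  refine (le_gridCeil n a).trans ?_
  unfold gridCeil gridFloor at *
  rw [div_le_iff₀ (by positivity), mul_comm t] at h
  gcongr
  exact Nat.le_floor h

theorem gridFloor_lt {n : ℕ} {b t : ℝ≥0} (h : t < gridCeil n b) : gridFloor n t < b := by
  unfold gridCeil gridFloor at *
  rw [lt_div_iff₀ (by positivity), mul_comm] at h
  rw [div_lt_iff₀ (by positivity), mul_comm b]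
  exact Nat.lt_ceil.1 ((Nat.floor_lt (by positivity)).2 h)

/-- Send `gridCeil n a` to `a` for every partition point `a` and interpolate linearly. Then
`gridFloor n t` and `τ t` lie in the same partition interval. The mesh must be finer than the
partition, so that distinct partition points have distinct grid points. -/
theorem HasOscPartition.exists_timeChange {x : ℝ≥0 → S} {ε : ℝ} {T : ℝ≥0}
    (h : HasOscPartition x ε T) : ∀ᶠ n : ℕ in atTop, ∃ τ : ℝ≥0 ≃o ℝ≥0, τ (gridCeil n T) = T ∧
      ∀ t < gridCeil n T, dist (τ t) t ≤ 1 / (n + 1) ∧ dist (x (gridFloor n t)) (x (τ t)) < ε := by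
  induction h with
  | zero => exact Eventually.of_forall fun n => ⟨OrderIso.refl _, by simp [gridCeil]⟩
  | @step a b _ hab hosc ih =>
    have hsmall : ∀ᶠ n : ℕ in atTop, (1 : ℝ≥0) / (n + 1) < b - a :=
      (tendsto_one_div_add_atTop_nhds_zero_nat (𝕜 := ℝ≥0)).eventually_lt_const
        (tsub_pos_of_lt hab)
    filter_upwards [ih, hsmall] with n hn hnab
    obtain ⟨τ, hτa, hτ⟩ := hn
    set a' := gridCeil n a with ha'
    set b' := gridCeil n b with hb'
    have haa' : a ≤ a' := le_gridCeil n a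
    have hbb' : b ≤ b' := le_gridCeil n b
    have haa'' : a' ≤ a + 1 / (n + 1) := gridCeil_le n a
    have hbb'' : b' ≤ b + 1 / (n + 1) := gridCeil_le n b
    have hab' : a' < b' := by
      refine haa''.trans_lt (lt_of_lt_of_le ?_ hbb')
      rw [add_comm]
      exact lt_tsub_iff_right.1 hnab
    have hc : 0 < (b - a) / (b' - a') := div_pos (tsub_pos_of_lt hab) (tsub_pos_of_lt hab')
    let σ : ℝ≥0 ≃o ℝ≥0 := OrderIso.mulRight₀ _ hc
    have hσ : ∀ v, σ v = v * ((b - a) / (b' - a')) := fun v => rfl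
    have hval : ∀ t, a' ≤ t → glueTimeChange τ σ a' t = a + (t - a') * ((b - a) / (b' - a')) := by
      intro t ht
      rw [glueTimeChange_apply, hτa, hσ]
      split_ifs with h
      · rw [le_antisymm h ht, hτa, tsub_self, zero_mul, add_zero]
      · rfl
    have hvalb : glueTimeChange τ σ a' b' = b := by
      rw [hval b' hab'.le, mul_div_cancel₀ _ (tsub_pos_of_lt hab').ne',
        add_tsub_cancel_of_le hab.le]
    refine ⟨glueTimeChange τ σ a', hvalb, fun t ht => ?_⟩
    rcases lt_or_ge t a' with hta | hta
    · rw [glueTimeChange_apply, if_pos hta.le]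
      exact hτ t hta
    · refine ⟨?_, ?_⟩
      · rw [hval t hta, NNReal.dist_eq]
        have e1 : (a : ℝ) ≤ a' := haa'
        have e2 : (b : ℝ) ≤ b' := hbb'
        have e3 : (a' : ℝ) ≤ a + 1 / (n + 1) := by exact_mod_cast haa''
        have e4 : (b' : ℝ) ≤ b + 1 / (n + 1) := by exact_mod_cast hbb''
        have e5 : (0 : ℝ) < b' - a' := sub_pos.2 hab'
        have e6 : (a' : ℝ) ≤ t := hta
        have e7 : (t : ℝ) < b' := ht
        push_cast [NNReal.coe_sub hta, NNReal.coe_sub hab.le, NNReal.coe_sub hab'.le]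
        -- The displacement of `t` is a convex combination, with weight `θ`, of `a - a'` and `b -
        -- b'`, which both lie in `[-1 / (n + 1), 0]`.
        set θ : ℝ := (t - a') / (b' - a') with hθ
        have hθ0 : 0 ≤ θ := div_nonneg (by linarith) e5.le
        have hθ1 : θ ≤ 1 := (div_le_one e5).2 (by linarith)
        have ht' : (t : ℝ) = a' + θ * (b' - a') := by
          rw [hθ, div_mul_cancel₀ _ e5.ne']; ring
        have hrew : (a : ℝ) + (t - a') * ((b - a) / (b' - a')) - t
            = (1 - θ) * (a - a') + θ * (b - b') := by
          have : ((t : ℝ) - a') * ((b - a) / (b' - a')) = θ * (b - a) := by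
            rw [hθ]; ring
          rw [this]
          conv_lhs => rw [ht']
          ring
        rw [hrew, abs_le]
        constructor <;> nlinarith
      · refine hosc _ ⟨le_gridFloor hta, gridFloor_lt ht⟩ _ ⟨?_, ?_⟩
        · rw [hval t hta]
          exact le_self_add
        · calc glueTimeChange τ σ a' t < glueTimeChange τ σ a' b' :=
                (glueTimeChange τ σ a').strictMono ht
            _ = b := hvalb

theorem isCadlag_step (n : ℕ) (z : ℕ → S) :
    IsCadlag fun t : ℝ≥0 => z ⌊((n : ℝ≥0) + 1) * t⌋₊ := by
  have hcont : Continuous fun t : ℝ≥0 => ((n : ℝ≥0) + 1) * t := by fun_prop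
  intro t
  constructor
  · have h1 : ∀ᶠ s in 𝓝[≥] t, ⌊((n : ℝ≥0) + 1) * s⌋₊ = ⌊((n : ℝ≥0) + 1) * t⌋₊ := by
      have h2 : ∀ᶠ s in 𝓝 t, ((n : ℝ≥0) + 1) * s < ⌊((n : ℝ≥0) + 1) * t⌋₊ + 1 :=
        hcont.continuousAt.eventually_lt_const (Nat.lt_floor_add_one _)
      filter_upwards [nhdsWithin_le_nhds h2, self_mem_nhdsWithin] with s hs hts
      rw [Nat.floor_eq_iff (by positivity)]
      exact ⟨(Nat.floor_le (by positivity)).trans (mul_le_mul_right hts _), hs⟩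
    refine (tendsto_const_nhds (x := z ⌊((n : ℝ≥0) + 1) * t⌋₊)).congr' ?_
    filter_upwards [h1] with s hs
    rw [hs]
  -- The ceiling minus one is the index just before `t`, also when `t` is a grid point; at `t = 0`
  -- there is nothing to the left.
  · refine ⟨z (⌈((n : ℝ≥0) + 1) * t⌉₊ - 1), ?_⟩
    have h1 : ∀ᶠ s in 𝓝[<] t, ⌊((n : ℝ≥0) + 1) * s⌋₊ = ⌈((n : ℝ≥0) + 1) * t⌉₊ - 1 := by
      rcases eq_or_ne t 0 with rfl | ht
      · simp
      have hpos : 0 < ((n : ℝ≥0) + 1) * t := mul_pos (by positivity) (pos_iff_ne_zero.2 ht)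
      have hceil : 0 < ⌈((n : ℝ≥0) + 1) * t⌉₊ := Nat.ceil_pos.2 hpos
      have h2 : ∀ᶠ s in 𝓝 t, ((⌈((n : ℝ≥0) + 1) * t⌉₊ - 1 : ℕ) : ℝ≥0) < ((n : ℝ≥0) + 1) * s :=
        hcont.continuousAt.eventually_const_lt (Nat.lt_ceil.1 (Nat.sub_one_lt hceil.ne'))
      filter_upwards [nhdsWithin_le_nhds h2, self_mem_nhdsWithin] with s hs hts
      rw [Nat.floor_eq_iff (by positivity)]
      refine ⟨hs.le, ?_⟩
      have h3 : (((⌈((n : ℝ≥0) + 1) * t⌉₊ - 1 : ℕ) : ℝ≥0) + 1) = ⌈((n : ℝ≥0) + 1) * t⌉₊ := by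
        exact_mod_cast Nat.sub_add_cancel hceil
      rw [h3]
      exact (mul_lt_mul_of_pos_left hts (by positivity)).trans_le (Nat.le_ceil _)
    refine (tendsto_const_nhds (x := z (⌈((n : ℝ≥0) + 1) * t⌉₊ - 1))).congr' ?_
    filter_upwards [h1] with s hs
    rw [hs]

namespace SkorokhodSpace

/-- The path that jumps to the state `z k` at time `k / (n + 1)`. -/
noncomputable def stepPath (n : ℕ) (z : ℕ → S) : SkorokhodSpace S :=
  ⟨fun t => z ⌊((n : ℝ≥0) + 1) * t⌋₊, isCadlag_step n z⟩

/-- Up to a fixed horizon only finitely many states are visited, so coordinatewise closeness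
suffices, without any time change. -/
theorem continuous_stepPath (n : ℕ) : Continuous (stepPath (S := S) n) := by
  refine continuous_iff_continuousAt.2 fun z => (hasBasis_nhds _).tendsto_right_iff.2 fun k _ => ?_
  have h : ∀ᶠ z' in 𝓝 z, ∀ i ∈ Iic ⌊((n : ℝ≥0) + 1) * k⌋₊,
      dist ((z' : ℕ → S) i) (z i) < 1 / (k + 1) :=
    (eventually_all_finite (finite_Iic _)).2 fun i _ =>
      (continuous_apply i).continuousAt.eventually
        (Metric.ball_mem_nhds (z i) (show (0 : ℝ) < 1 / (k + 1) by positivity))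
  filter_upwards [h] with z' hz'
  refine ⟨OrderIso.refl _, fun t ht => ⟨?_, hz' _ ?_⟩⟩
  · simp only [OrderIso.refl_apply, dist_self]
    positivity
  · exact Nat.floor_mono (mul_le_mul_right ht _)

/-- The discretizations of a path converge to the path. -/
theorem tendsto_stepPath (x : SkorokhodSpace S) :
    Tendsto (fun n : ℕ => stepPath n fun k => x.1 (k / (n + 1))) atTop (𝓝 x) := by
  refine (hasBasis_nhds x).tendsto_right_iff.2 fun k _ => ?_
  have hk : (0 : ℝ) < 1 / (k + 1) := by positivity
  obtain ⟨T, hT, hpart⟩ := x.2.exists_hasOscPartition hk (k : ℝ≥0)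
  have hsmall : ∀ᶠ n : ℕ in atTop, (1 : ℝ) / (n + 1) < 1 / (k + 1) :=
    (tendsto_one_div_add_atTop_nhds_zero_nat (𝕜 := ℝ)).eventually_lt_const hk
  filter_upwards [hpart.exists_timeChange, hsmall] with n hn hnk
  obtain ⟨τ, -, hτ⟩ := hn
  refine ⟨τ, fun t ht => ?_⟩
  obtain ⟨h1, h2⟩ := hτ t ((ht.trans_lt hT).trans_le (le_gridCeil n T))
  exact ⟨h1.trans_lt hnk, h2⟩

/-- Random càdlàg paths are measurable for the Borel σ-algebra of the Skorokhod space if all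
evaluations are measurable. -/
theorem measurable_of_eval [TopologicalSpace.SeparableSpace S] [MeasurableSpace S] [BorelSpace S]
    {Ω : Type*} [MeasurableSpace Ω] {Y : Ω → SkorokhodSpace S}
    (hY : ∀ t, Measurable fun ω => (Y ω).1 t) : Measurable Y := by
  -- Step paths are continuous functions of countably many evaluations. Second countability
  -- identifies the product σ-algebra on sequences with the Borel one, and measurability survives
  -- pointwise limits in a pseudometrizable space.
  have := UniformSpace.secondCountable_of_separable S
  exact measurable_of_tendsto_metrizable
    (f := fun n ω => stepPath n fun k => (Y ω).1 (k / (n + 1)))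
    (fun n => (continuous_stepPath n).measurable.comp (measurable_pi_lambda _ fun k => hY _))
    (tendsto_pi_nhds.2 fun ω => tendsto_stepPath (Y ω))

end SkorokhodSpace

end Discretization

/-! ### Laplace transforms of càdlàg paths -/

section Laplace

theorem expWeightMeasure_countable (l : ℝ) {A : Set ℝ≥0} (hA : A.Countable) :
    expWeightMeasure l A = 0 := by
  rw [expWeightMeasure, Measure.map_apply measurable_real_toNNReal hA.measurableSet]
  refine withDensity_absolutelyContinuous _ _ ?_
  rw [Measure.restrict_apply (measurable_real_toNNReal hA.measurableSet)]
  refine (Countable.mono ?_ (hA.image ((↑) : ℝ≥0 → ℝ))).measure_zero _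
  rintro t ⟨ht, ht0⟩
  exact ⟨_, ht, Real.coe_toNNReal _ (le_of_lt ht0)⟩

theorem expWeightMeasure_Ioo_pos (l : ℝ) {s t : ℝ≥0} (hst : s < t) :
    expWeightMeasure l (Ioo s t) ≠ 0 := by
  have hm : MeasurableSet (Real.toNNReal ⁻¹' Ioo s t) := measurable_real_toNNReal measurableSet_Ioo
  rw [expWeightMeasure, Measure.map_apply measurable_real_toNNReal measurableSet_Ioo]
  intro h
  rw [withDensity_apply_eq_zero' (by fun_prop)] at h
  have h1 : {x : ℝ | ENNReal.ofReal (Real.exp (-l * x)) ≠ 0} = univ :=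
    eq_univ_of_forall fun x => by simp [Real.exp_pos]
  rw [h1, univ_inter, Measure.restrict_apply hm] at h
  have h2 : Ioo (s : ℝ) t ⊆ Real.toNNReal ⁻¹' Ioo s t ∩ Ioi 0 := by
    rintro r ⟨hr1, hr2⟩
    have hr0 : 0 < r := lt_of_le_of_lt s.2 hr1
    refine ⟨⟨?_, ?_⟩, hr0⟩ <;> rw [← NNReal.coe_lt_coe, Real.coe_toNNReal _ hr0.le]
    exacts [hr1, hr2]
  have h3 := measure_mono_null h2 h
  rw [Real.volume_Ioo, ENNReal.ofReal_eq_zero] at h3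
  have : (s : ℝ) < t := hst
  linarith

/-- The function `e^{-t}` on `[0,∞)`. -/
noncomputable def expNegBCF : ℝ≥0 →ᵇ ℝ :=
  BoundedContinuousFunction.ofNormedAddCommGroup (fun t => Real.exp (-t)) (by fun_prop) 1 fun t => by
    rw [Real.norm_of_nonneg (Real.exp_nonneg _), Real.exp_le_one_iff, neg_nonpos]
    exact t.2

theorem integral_expWeightMeasure_nat {a : ℝ≥0 → ℝ} (ha : Measurable a) (k : ℕ) :
    ∫ t, (expNegBCF ^ k) t * a t ∂(expWeightMeasure 1) = ∫ t, a t ∂(expWeightMeasure (k + 1)) := by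
  have hm : Measurable fun t => (expNegBCF ^ k) t * a t :=
    (expNegBCF ^ k).continuous.measurable.mul ha
  rw [integral_expWeightMeasure _ ha, integral_expWeightMeasure _ hm]
  refine setIntegral_congr_fun measurableSet_Ioi fun t ht => ?_
  have h1 : (expNegBCF ^ k) t.toNNReal = Real.exp (-t) ^ k := by
    rw [BoundedContinuousFunction.coe_pow, Pi.pow_apply]
    change Real.exp (-(t.toNNReal : ℝ)) ^ k = _
    rw [Real.coe_toNNReal _ (le_of_lt ht)]
  rw [h1, ← mul_assoc, ← Real.exp_nat_mul, ← Real.exp_add]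
  ring_nf

/-- Finite measures on `[0,∞)` are determined by their Laplace transform at the integers. -/
theorem ext_of_integral_expNegBCF {μ ν : Measure ℝ≥0} [IsFiniteMeasure μ] [IsFiniteMeasure ν]
    (h : ∀ k : ℕ, ∫ t, (expNegBCF ^ k) t ∂μ = ∫ t, (expNegBCF ^ k) t ∂ν) : μ = ν := by
  have key : ∀ p : Polynomial ℝ,
      ∫ t, (Polynomial.aeval expNegBCF p) t ∂μ = ∫ t, (Polynomial.aeval expNegBCF p) t ∂ν := by
    intro p
    induction p using Polynomial.induction_on' with
    | add p q hp hq =>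
      simp only [map_add, BoundedContinuousFunction.coe_add, Pi.add_apply]
      rw [integral_add (BoundedContinuousFunction.integrable _ _)
        (BoundedContinuousFunction.integrable _ _), integral_add
        (BoundedContinuousFunction.integrable _ _) (BoundedContinuousFunction.integrable _ _),
        hp, hq]
    | monomial k c =>
      have : ∀ t, (Polynomial.aeval expNegBCF (Polynomial.monomial k c)) t
          = c * (expNegBCF ^ k) t := fun t => by
        rw [Polynomial.aeval_monomial, ← Algebra.smul_def]
        rfl
      simp only [this, integral_const_mul, h]
  -- The algebra generated by `e^{-t}` consists of the polynomials in it and separates points, as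
  -- `e^{-t}` is injective.
  let A : StarSubalgebra ℝ (ℝ≥0 →ᵇ ℝ) :=
    { Algebra.adjoin ℝ {expNegBCF} with
      star_mem' := fun {f} hf => by
        have : star f = f := by ext t; simp
        rw [this]
        exact hf }
  refine ext_of_forall_mem_subalgebra_integral_eq_of_polish (𝕜 := ℝ) (A := A) ?_ ?_
  · intro s t hst
    refine ⟨_, ⟨_, ⟨expNegBCF, Algebra.subset_adjoin rfl, rfl⟩, rfl⟩, ?_⟩
    change Real.exp (-(s : ℝ)) ≠ Real.exp (-t)
    intro h
    exact hst (NNReal.coe_injective (neg_injective (Real.exp_injective h)))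
  · intro g hg
    have hg' : g ∈ Algebra.adjoin ℝ {expNegBCF} := hg
    rw [Algebra.adjoin_singleton_eq_range_aeval] at hg'
    obtain ⟨p, rfl⟩ := hg'
    exact key p

/-- Nonnegative bounded càdlàg functions are determined by their Laplace transforms at the positive
integers. -/
theorem IsCadlag.eq_of_laplace {a b : ℝ≥0 → ℝ} (ha : IsCadlag a) (hb : IsCadlag b)
    (ha0 : ∀ t, 0 ≤ a t) (hb0 : ∀ t, 0 ≤ b t) {C : ℝ} (haC : ∀ t, a t ≤ C) (hbC : ∀ t, b t ≤ C)
    (h : ∀ k : ℕ, ∫ t, a t ∂(expWeightMeasure (k + 1)) = ∫ t, b t ∂(expWeightMeasure (k + 1))) :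
    a = b := by
  have := isFiniteMeasure_expWeightMeasure one_pos
  have hint : ∀ {c : ℝ≥0 → ℝ}, IsCadlag c → (∀ t, 0 ≤ c t) → (∀ t, c t ≤ C) →
      Integrable c (expWeightMeasure 1) := fun hc h0 h1 =>
    BddMeasurable.integrable ⟨hc.measurable, C, fun t => abs_le.2 ⟨by linarith [h0 t, h1 t], h1 t⟩⟩ _
  have hlap : ∀ {c : ℝ≥0 → ℝ}, IsCadlag c → (∀ t, 0 ≤ c t) → ∀ k : ℕ, ∫ t, (expNegBCF ^ k) t
      ∂((expWeightMeasure 1).withDensity fun t => ENNReal.ofReal (c t))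
      = ∫ t, c t ∂(expWeightMeasure (k + 1)) := fun {c} hc h0 k => by
    rw [integral_withDensity_eq_integral_toReal_smul hc.measurable.ennreal_ofReal
      (Eventually.of_forall fun _ => ENNReal.ofReal_lt_top),
      ← integral_expWeightMeasure_nat hc.measurable]
    simp only [ENNReal.toReal_ofReal (h0 _), smul_eq_mul, mul_comm]
  have := isFiniteMeasure_withDensity_ofReal (hint ha ha0 haC).2
  have := isFiniteMeasure_withDensity_ofReal (hint hb hb0 hbC).2
  -- The integral of `e^{-k t}` against `a(t) e^{-t} dt` is the Laplace transform of `a` at `k + 1`,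
  -- so the two finite measures coincide.
  have heq : (expWeightMeasure 1).withDensity (fun t => ENNReal.ofReal (a t))
      = (expWeightMeasure 1).withDensity fun t => ENNReal.ofReal (b t) :=
    ext_of_integral_expNegBCF fun k => by rw [hlap ha ha0, hlap hb hb0, h]
  have hae := (withDensity_eq_iff ha.measurable.ennreal_ofReal.aemeasurable
    hb.measurable.ennreal_ofReal.aemeasurable
    (hint ha ha0 haC).lintegral_lt_top.ne).1 heq
  funext t
  have hlim : ∀ {c : ℝ≥0 → ℝ}, IsCadlag c → Tendsto c (𝓝[>] t) (𝓝 (c t)) := fun hc =>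
    (hc t).1.tendsto.mono_left (nhdsWithin_mono _ Ioi_subset_Ici_self)
  -- By right continuity it is enough that `a` and `b` agree at times arbitrarily close to the right
  -- of `t`; otherwise they would differ on a whole interval, which has positive measure.
  refine tendsto_nhds_unique_of_frequently_eq (hlim ha) (hlim hb) fun hne => ?_
  obtain ⟨t', ht', hsub⟩ := mem_nhdsGT_iff_exists_Ioo_subset.1 hne
  refine expWeightMeasure_Ioo_pos 1 ht' (measure_mono_null (fun s hs => ?_) hae)
  intro hs'
  refine hsub hs ?_
  simpa [ENNReal.ofReal_eq_ofReal_iff (ha0 s) (hb0 s)] using hs'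

end Laplace

/-! ### Continuity of the Laplace functionals for `J₁` -/

namespace SkorokhodSpace

variable {S : Type*} [PseudoMetricSpace S]

/-- Evaluation at a continuity point of `x` is continuous at `x`. -/
theorem tendsto_eval {x : SkorokhodSpace S} {t : ℝ≥0} (hx : ContinuousAt x.1 t) :
    Tendsto (fun y : SkorokhodSpace S => y.1 t) (𝓝 x) (𝓝 (x.1 t)) := by
  rw [Metric.tendsto_nhds]
  intro ε hε
  obtain ⟨δ, hδ, hδx⟩ := Metric.continuousAt_iff.1 hx (ε / 2) (half_pos hε)
  filter_upwards [nbhd_mem_nhds x t (lt_min hδ (half_pos hε))] with y ⟨τ, hτ⟩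
  obtain ⟨h1, h2⟩ := hτ t le_rfl
  calc dist (y.1 t) (x.1 t) ≤ dist (y.1 t) (x.1 (τ t)) + dist (x.1 (τ t)) (x.1 t) :=
        dist_triangle _ _ _
    _ < ε / 2 + ε / 2 := add_lt_add (h2.trans_le (min_le_right _ _))
        (hδx (h1.trans_le (min_le_left _ _)))
    _ = ε := add_halves ε

/-- The exponentially weighted integral of a bounded continuous function along the path is a
continuous function of the path. -/
theorem continuous_integral_expWeightMeasure {f : S → ℝ} (hf : Continuous f) {C : ℝ}
    (hC : ∀ y, |f y| ≤ C) {l : ℝ} (hl : 0 < l) :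
    Continuous fun x : SkorokhodSpace S => ∫ t, f (x.1 t) ∂(expWeightMeasure l) := by
  have := isFiniteMeasure_expWeightMeasure hl
  refine continuous_iff_continuousAt.2 fun x =>
    tendsto_integral_filter_of_dominated_convergence (fun _ => C)
      (Eventually.of_forall fun y => (y.2.comp hf).measurable.aestronglyMeasurable)
      (Eventually.of_forall fun y => Eventually.of_forall fun t => hC _) (integrable_const _) ?_
  -- Evaluation is continuous at `x` except at countably many times, which the exponential weight
  -- does not see.
  have h0 : ∀ᵐ t ∂(expWeightMeasure l), ContinuousAt x.1 t :=
    expWeightMeasure_countable l x.2.countable_not_continuousAt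
  filter_upwards [h0] with t ht
  exact (hf.tendsto _).comp (tendsto_eval ht)

end SkorokhodSpace

/-! ### Weak convergence in a countable product of intervals -/

section Cube

variable {κ : Type*} [Countable κ]

/-- The coordinates of a cube. -/
def cubeCoord (i : κ) : C(κ → Icc (0 : ℝ) 1, ℝ) := ⟨fun x => x i, by fun_prop⟩

/-- Probability measures on the cube converge weakly if their moments converge. -/
theorem tendsto_integral_cube {ν : ℕ → Measure (κ → Icc (0 : ℝ) 1)} {ν' : Measure (κ → Icc (0 : ℝ) 1)}
    [∀ n, IsProbabilityMeasure (ν n)] [IsProbabilityMeasure ν']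
    (h : ∀ (k : ℕ) (c : Fin k → κ), Tendsto (fun n => ∫ x, ∏ j, ((x (c j) : ℝ)) ∂(ν n)) atTop
      (𝓝 (∫ x, ∏ j, ((x (c j) : ℝ)) ∂ν'))) (g : C(κ → Icc (0 : ℝ) 1, ℝ)) :
    Tendsto (fun n => ∫ x, g x ∂(ν n)) atTop (𝓝 (∫ x, g x ∂ν')) := by
  have hint : ∀ (μ : Measure (κ → Icc (0 : ℝ) 1)) [IsProbabilityMeasure μ]
      (g : C(κ → Icc (0 : ℝ) 1, ℝ)), Integrable g μ := fun μ _ g =>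
    Integrable.of_bound g.continuous.aestronglyMeasurable ‖g‖
      (Eventually.of_forall fun x => g.norm_coe_le_norm x)
  have hadj : ∀ g ∈ Algebra.adjoin ℝ (range (cubeCoord (κ := κ))),
      Tendsto (fun n => ∫ x, g x ∂(ν n)) atTop (𝓝 (∫ x, g x ∂ν')) := by
    intro g hg
    rw [← Subalgebra.mem_toSubmodule, Algebra.adjoin_eq_span] at hg
    induction hg using Submodule.span_induction with
    | mem g hg =>
      obtain ⟨l, hl, rfl⟩ := Submonoid.exists_list_of_mem_closure hg
      choose c hc using fun j : Fin l.length => hl _ (l.get_mem j)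
      have hprod : ∀ x, l.prod x = ∏ j, ((x (c j) : ℝ)) := fun x => by
        rw [← Fin.prod_univ_getElem, ContinuousMap.coe_prod, Finset.prod_apply]
        refine Finset.prod_congr rfl fun j _ => ?_
        rw [← List.get_eq_getElem, ← hc j]
        rfl
      simp only [hprod]
      exact h _ c
    | zero => simp
    | add f g _ _ hf hg =>
      simp only [ContinuousMap.add_apply]
      rw [integral_add (hint ν' f) (hint ν' g)]
      exact (hf.add hg).congr fun n => (integral_add (hint (ν n) f) (hint (ν n) g)).symm
    | smul a g _ hg =>
      simp only [ContinuousMap.smul_apply, smul_eq_mul, integral_const_mul]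
      exact hg.const_mul a
  have hsep : (Algebra.adjoin ℝ (range (cubeCoord (κ := κ)))).SeparatesPoints := by
    intro x y hxy
    obtain ⟨i, hi⟩ := Function.ne_iff.1 hxy
    exact ⟨_, ⟨cubeCoord i, Algebra.subset_adjoin ⟨i, rfl⟩, rfl⟩, fun h => hi (Subtype.ext h)⟩
  rw [Metric.tendsto_atTop]
  intro ε hε
  -- By Stone–Weierstrass, a polynomial in the coordinates is within `ε / 3` of `g`, an error that
  -- is uniform over all probability measures.
  obtain ⟨⟨p, hp⟩, hpg⟩ :=
    ContinuousMap.exists_mem_subalgebra_near_continuousMap_of_separatesPoints _ hsep g (ε / 3)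
      (by linarith)
  have hclose : ∀ (μ : Measure (κ → Icc (0 : ℝ) 1)) [IsProbabilityMeasure μ],
      |∫ x, p x ∂μ - ∫ x, g x ∂μ| < ε / 3 := fun μ _ => by
    rw [← integral_sub (hint μ p) (hint μ g)]
    refine lt_of_le_of_lt ?_ hpg
    have := BddMeasurable.abs_integral_le (f := fun x => p x - g x)
      (fun x => (p - g).norm_coe_le_norm x) μ
    simpa using this
  obtain ⟨N, hN⟩ := Metric.tendsto_atTop.1 (hadj p hp) (ε / 3) (by linarith)
  refine ⟨N, fun n hn => ?_⟩
  have h1 := hclose (ν n)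
  have h2 := hclose ν'
  have h3 := hN n hn
  rw [Real.dist_eq] at h3 ⊢
  rw [abs_lt] at *
  constructor <;> linarith [h1.1, h1.2, h2.1, h2.2, h3.1, h3.2]

end Cube

/-- Weak convergence of a tight sequence of probability measures follows from convergence of the
moments of a countable family of continuous functions that separates points. -/
theorem tendsto_of_tight_of_moments {D : Type*} [TopologicalSpace D]
    [TopologicalSpace.PseudoMetrizableSpace D] [MeasurableSpace D] [BorelSpace D]
    {κ : Type*} [Countable κ] {J : D → κ → Icc (0 : ℝ) 1} (hJ : Continuous J)
    (hinj : Function.Injective J) {μ : ℕ → ProbabilityMeasure D} {μ' : ProbabilityMeasure D}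
    (htight : ∀ ε : ℝ≥0∞, 0 < ε → ∃ K : Set D, IsCompact K ∧ ∀ n, (μ n : Measure D) Kᶜ ≤ ε)
    (h : ∀ (k : ℕ) (c : Fin k → κ), Tendsto (fun n => ∫ x, ∏ j, ((J x (c j) : ℝ)) ∂(μ n : Measure D))
      atTop (𝓝 (∫ x, ∏ j, ((J x (c j) : ℝ)) ∂(μ' : Measure D)))) :
    Tendsto μ atTop (𝓝 μ') := by
  have hJm : Measurable J := hJ.measurable
  have hT2 : T2Space D := T2Space.of_injective_continuous hinj hJ
  have hcube : Tendsto (fun n => (μ n).map hJm.aemeasurable) atTop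
      (𝓝 (μ'.map hJm.aemeasurable)) := by
    rw [ProbabilityMeasure.tendsto_iff_forall_integral_tendsto]
    intro g
    refine tendsto_integral_cube (fun k c => ?_) g.toContinuousMap
    have hm : Measurable fun x : κ → Icc (0 : ℝ) 1 => ∏ j, ((x (c j) : ℝ)) := by fun_prop
    simp only [ProbabilityMeasure.toMeasure_map]
    rw [integral_map hJm.aemeasurable hm.aestronglyMeasurable]
    refine (h k c).congr fun n => ?_
    rw [integral_map hJm.aemeasurable hm.aestronglyMeasurable]
  -- Closed sets of `D` need not have closed images, but `F ∩ K` is compact, so its image is closed;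
  -- by injectivity its preimage is `F ∩ K` again, and the portmanteau theorem in the cube applies.
  refine tendsto_of_forall_isClosed_limsup_le' fun F hF => ?_
  refine ENNReal.le_of_forall_pos_le_add fun ε hε _ => ?_
  obtain ⟨K, hK, hKμ⟩ := htight ε (by exact_mod_cast hε)
  have hFK : IsCompact (F ∩ K) := hK.inter_left hF
  have hJFK : IsClosed (J '' (F ∩ K)) := (hFK.image hJ).isClosed
  have hpre : J ⁻¹' (J '' (F ∩ K)) = F ∩ K := preimage_image_eq _ hinj
  have h1 := ProbabilityMeasure.limsup_measure_closed_le_of_tendsto hcube hJFK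
  have h2 : ∀ ρ : ProbabilityMeasure D, ((ρ.map hJm.aemeasurable : ProbabilityMeasure _) :
      Measure (κ → Icc (0 : ℝ) 1)) (J '' (F ∩ K)) = (ρ : Measure D) (F ∩ K) := fun ρ => by
    rw [ProbabilityMeasure.toMeasure_map, Measure.map_apply hJm hJFK.measurableSet, hpre]
  simp only [h2] at h1
  calc limsup (fun n => (μ n : Measure D) F) atTop
      ≤ limsup (fun n => (μ n : Measure D) (F ∩ K) + ε) atTop := by
        refine limsup_le_limsup (Eventually.of_forall fun n => ?_)
        calc (μ n : Measure D) F ≤ (μ n : Measure D) (F ∩ K ∪ Kᶜ) := measure_mono fun x hx => by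
              by_cases hxK : x ∈ K
              · exact Or.inl ⟨hx, hxK⟩
              · exact Or.inr hxK
          _ ≤ _ := (measure_union_le _ _).trans (add_le_add le_rfl (hKμ n))
    _ ≤ limsup (fun n => (μ n : Measure D) (F ∩ K)) atTop + ε := by
        rw [limsup_add_const _ _ _ (by isBoundedDefault) (by isBoundedDefault)]
    _ ≤ (μ' : Measure D) F + ε := add_le_add (h1.trans (measure_mono inter_subset_left)) le_rfl

/-! ### Convergence in law -/

section LaplaceCoordinates

/-- The distance to the `j`-th point of a dense sequence, truncated at `1`. -/
noncomputable def truncDist (S : Type*) [PseudoMetricSpace S] [TopologicalSpace.SeparableSpace S]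
    [Nonempty S] (j : ℕ) (y : S) : ℝ :=
  min 1 (dist y (TopologicalSpace.denseSeq S j))

variable {S : Type*} [MetricSpace S] [TopologicalSpace.SeparableSpace S] [Nonempty S]

theorem continuous_truncDist (j : ℕ) : Continuous (truncDist S j) := by
  unfold truncDist
  fun_prop

theorem truncDist_nonneg (j : ℕ) (y : S) : 0 ≤ truncDist S j y :=
  le_min zero_le_one dist_nonneg

theorem truncDist_le_one (j : ℕ) (y : S) : truncDist S j y ≤ 1 := min_le_left _ _

/-- Take a point of the dense sequence that is closer to `y` than half the distance from `y` to `z`,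
and closer than `1 / 2`, so that the truncation is inactive. -/
theorem eq_of_truncDist_eq {y z : S} (h : ∀ j, truncDist S j y = truncDist S j z) : y = z := by
  by_contra hyz
  obtain ⟨j, hj⟩ := (TopologicalSpace.denseRange_denseSeq S).exists_dist_lt y
    (lt_min one_half_pos (half_pos (dist_pos.2 hyz)))
  obtain ⟨hj1, hj2⟩ := lt_min_iff.1 hj
  have h1 : truncDist S j y = dist y (TopologicalSpace.denseSeq S j) :=
    min_eq_right (by linarith)
  have h2 : truncDist S j z < min 1 (dist y z / 2) := by
    rw [← h j, h1]
    exact lt_min (by linarith) hj2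
  have h3 : dist z (TopologicalSpace.denseSeq S j) < dist y z / 2 := by
    rcases min_lt_iff.1 h2 with h | h
    · exact absurd (h.trans_le (min_le_left _ _)) (lt_irrefl _)
    · exact h.trans_le (min_le_right _ _)
  linarith [dist_triangle_right y z (TopologicalSpace.denseSeq S j)]

namespace SkorokhodSpace

/-- Laplace transforms, at the positive integers, of the truncated distances of a path to the
points of a dense sequence. -/
noncomputable def laplaceCoord (x : SkorokhodSpace S) (i : ℕ × ℕ) : Icc (0 : ℝ) 1 :=
  ⟨∫ t, truncDist S i.2 (x.1 t) ∂(expWeightMeasure (i.1 + 1)), integral_nonneg fun _ =>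
    truncDist_nonneg _ _, by
    have hl : (0 : ℝ) < i.1 + 1 := by positivity
    have := isFiniteMeasure_expWeightMeasure hl
    calc ∫ t, truncDist S i.2 (x.1 t) ∂(expWeightMeasure (i.1 + 1))
        ≤ ∫ _, (1 : ℝ) ∂(expWeightMeasure (i.1 + 1)) :=
          integral_mono_of_nonneg (Eventually.of_forall fun _ => truncDist_nonneg _ _)
            (integrable_const _) (Eventually.of_forall fun _ => truncDist_le_one _ _)
      _ = 1 / (i.1 + 1 : ℝ) := by
          rw [integral_const, expWeightMeasure_real_univ hl, smul_eq_mul, mul_one]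
      _ ≤ 1 := by
          rw [div_le_one hl]
          linarith [(Nat.cast_nonneg i.1 : (0 : ℝ) ≤ i.1)]⟩

theorem continuous_laplaceCoord : Continuous (laplaceCoord (S := S)) :=
  continuous_pi fun i => Continuous.subtype_mk (continuous_integral_expWeightMeasure
    (continuous_truncDist i.2)
    (fun y => (abs_of_nonneg (truncDist_nonneg i.2 y)).trans_le (truncDist_le_one i.2 y))
    (by positivity)) _

/-- Laplace transforms determine each truncated distance along a path as a function of time, and the
truncated distances separate states. -/
theorem injective_laplaceCoord : Function.Injective (laplaceCoord (S := S)) := by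
  intro x y hxy
  refine Subtype.ext (funext fun t => eq_of_truncDist_eq fun j => ?_)
  exact congrFun (IsCadlag.eq_of_laplace (x.2.comp (continuous_truncDist j))
    (y.2.comp (continuous_truncDist j)) (fun _ => truncDist_nonneg _ _)
    (fun _ => truncDist_nonneg _ _) (fun _ => truncDist_le_one _ _)
    (fun _ => truncDist_le_one _ _)
    fun k => congrArg Subtype.val (congrFun hxy (k, j))) t

theorem integral_map_prod_laplaceCoord {E Ω : Type*} [MeasurableSpace Ω] {ν : Measure Ω} {f : E → S}
    {X : ℝ≥0 → Ω → E} {Y : Ω → SkorokhodSpace S} (hY : Measurable Y)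
    (hYX : ∀ t ω, (Y ω).1 t = f (X t ω)) {k : ℕ} (c : Fin k → ℕ × ℕ) :
    ∫ x, ∏ j, (laplaceCoord x (c j) : ℝ) ∂(ν.map Y) =
      ∫ ω, occupationProd X (fun j => ((c j).1 + 1 : ℝ)) (fun j x => truncDist S (c j).2 (f x))
        Finset.univ 0 ω ∂ν := by
  have hm : Continuous fun x : SkorokhodSpace S => ∏ j, (laplaceCoord x (c j) : ℝ) :=
    continuous_finsetProd _ fun j _ => continuous_subtype_val.comp
      ((continuous_apply (c j)).comp continuous_laplaceCoord)
  rw [integral_map hY.aemeasurable hm.measurable.aestronglyMeasurable]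
  simp only [occupationProd, futureIntegral, zero_add, laplaceCoord, hYX]

end SkorokhodSpace

end LaplaceCoordinates

/-- Black box theorem. `u` is a càdlàg Markov process on the separable metric space `E` with
invariant probability measure `m` of full support; `uN N` is a Markov process on `EN N ⊆ E` with
invariant probability measure `mN N` of full support in `EN N`, and with càdlàg paths when it is
seen in the Polish space `Em`, into which `E` is continuously embedded by `ι`. Under the five
assumptions, `uN N` started from `mN N` converges in law in `D([0,∞), Em)` to `u` started
from `m`. -/
theorem theorem2
    {E : Type*} [MetricSpace E] [TopologicalSpace.SeparableSpace E]
    [MeasurableSpace E] [BorelSpace E]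
    {Em : Type*} [MetricSpace Em] [CompleteSpace Em] [TopologicalSpace.SeparableSpace Em]
    (ι : E → Em) (hι : Continuous ι) (hι_inj : Function.Injective ι)
    -- the limit process
    {Ω : Type*} [MeasurableSpace Ω] (P : Kernel E Ω) [IsMarkovKernel P] (u : ℝ≥0 → Ω → E)
    (hu : IsMarkovProcess P u) (hu_cadlag : ∀ ω, IsCadlag (fun t => u t ω))
    (m : Measure E) [IsProbabilityMeasure m] [m.IsOpenPosMeasure] (hm : IsInvariantFor P u m)
    -- the approximating processes
    (EN : ℕ → Set E)
    {ΩN : ℕ → Type*} [∀ N, MeasurableSpace (ΩN N)] (PN : ∀ N, Kernel (EN N) (ΩN N))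
    [∀ N, IsMarkovKernel (PN N)] (uN : ∀ N, ℝ≥0 → ΩN N → EN N)
    (huN : ∀ N, IsMarkovProcess (PN N) (uN N))
    (huN_cadlag : ∀ N ω, IsCadlag (fun t => ι (uN N t ω)))
    (mN : ∀ N, Measure (EN N)) [∀ N, IsProbabilityMeasure (mN N)]
    [∀ N, (mN N).IsOpenPosMeasure] (hmN : ∀ N, IsInvariantFor (PN N) (uN N) (mN N))
    -- the class of test functions and the complex measures
    (𝒞 : Set (E →ᵇ ℂ)) (Sig : (E →ᵇ ℂ) → ComplexMeasure E)
    (SigN : ∀ N, (E →ᵇ ℂ) → ComplexMeasure (EN N))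
    -- the five assumptions
    (h_charac : CharacterizesLimit P u m 𝒞 Sig)
    (h_state : StateSpaceConvergence EN mN m)
    (h_tight : IsTightSequence (D := SkorokhodSpace Em) (fun N => (mN N).bind (PN N))
      (fun N ω => ⟨fun t => ι (uN N t ω), huN_cadlag N ω⟩))
    (h_equi : ResolventEquicontinuity PN uN mN)
    (h_discr : DiscreteCharacterization PN uN mN 𝒞 SigN Sig) :
    TendstoInDistribution (E := SkorokhodSpace Em)
      (fun N ω => ⟨fun t => ι (uN N t ω), huN_cadlag N ω⟩) atTop
      (fun ω => ⟨fun t => ι (u t ω), (hu_cadlag ω).comp hι⟩)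
      (fun N => (mN N).bind (PN N)) (m.bind P) := by
  borelize Em
  have : Nonempty Em := (nonempty_of_isProbabilityMeasure m).map ι
  have hY : Measurable (β := SkorokhodSpace Em) fun ω =>
      ⟨fun t => ι (u t ω), (hu_cadlag ω).comp hι⟩ :=
    SkorokhodSpace.measurable_of_eval fun t => hι.measurable.comp (hu.measurable_eval t)
  have hYN : ∀ N, Measurable (β := SkorokhodSpace Em) fun ω =>
      ⟨fun t => ι (uN N t ω), huN_cadlag N ω⟩ := fun N =>
    SkorokhodSpace.measurable_of_eval fun t =>
      hι.measurable.comp (measurable_subtype_coe.comp ((huN N).measurable_eval t))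
  refine ⟨fun N => (hYN N).aemeasurable, hY.aemeasurable, ?_⟩
  -- Makes the compact sets of the tightness assumption closed, hence measurable.
  have : T2Space (SkorokhodSpace Em) := T2Space.of_injective_continuous
    SkorokhodSpace.injective_laplaceCoord SkorokhodSpace.continuous_laplaceCoord
  refine tendsto_of_tight_of_moments SkorokhodSpace.continuous_laplaceCoord
    SkorokhodSpace.injective_laplaceCoord (fun ε hε => ?_) fun k c => ?_
  · obtain ⟨K, hK, hKN⟩ := h_tight ε hε
    refine ⟨K, hK, fun N => ?_⟩
    rw [ProbabilityMeasure.coe_mk, Measure.map_apply (hYN N) hK.isClosed.measurableSet.compl]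
    exact hKN N
  -- The index set is `Fin k`, so that a coordinate may occur repeatedly and all monomials are
  -- covered.
  · have hlim := tendsto_integral_occupationProd (I := Finset.univ) (ι := Fin k)
      (lam := fun j => ((c j).1 + 1 : ℝ)) (g := fun j x => truncDist Em (c j).2 (ι x))
      hu hm huN hmN h_charac h_state.2 h_equi h_discr
      (fun j => by linarith [(Nat.cast_nonneg (c j).1 : (0 : ℝ) ≤ (c j).1)])
      (fun j => (continuous_truncDist (c j).2).comp hι)
      (fun j x => truncDist_nonneg _ _) (fun j x => truncDist_le_one _ _)
    rw [← SkorokhodSpace.integral_map_prod_laplaceCoord hY fun _ _ => rfl] at hlim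
    exact hlim.congr fun N =>
      (SkorokhodSpace.integral_map_prod_laplaceCoord (f := fun x : EN N => ι x) (hYN N)
        (fun _ _ => rfl) c).symm
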